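/- **Diagrams.** A *diagram* is a finite graph with trivalent and univalent vertices, each trivalent vertex carrying a cyclic order of its three incident edge-ends; the univalent vertices (*legs*) are arranged in a linear order (on an orienting line). Edges without vertices (closed circles) and components without legs are allowed. Legs are of two kinds, of grade $2$ and of grade $1$. All spaces below are spaces of finite formal $\mathbb Q$-linear combinations of diagrams, modulo isomorphism, the AS relation (reversing the cyclic order at a vertex changes the sign), the IHX relation, and the following further relations. * $\mathcal W$: transposing two adjacent legs of grades $g,h$ multiplies by $(-1)^{gh}$. The grade-$2$ legs are called *dots* $\bullet$. * $\widetilde{\mathcal W}$: no further relations (legs are dots and grade-$1$ legs). * $\widehat{\mathcal W}$ (legs are dots and grade-$1$ legs): for adjacent legs of grades $g,h$ on edges $x$ (left) and $y$ (right), $D_{xy}-(-1)^{gh}D_{yx}=D'$. If both are dots, $D'$ has in place of the two legs one dot on a new edge $z$ ending in a new trivalent vertex with edges $x,z,y$ in this cyclic order; if exactly one of them is a dot, $D'$ is the same with a grade-$1$ leg on $z$; if both have grade $1$, $D'$ is obtained by deleting the two legs and joining $x$ to $y$. * $\widehat{\mathcal W}_{\mathbf F}$: the grade-$2$ legs are called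 *curvature legs* $F$; the relations are those of $\widehat{\mathcal W}$ with $F$ in place of $\bullet$, except that a curvature leg commutes with an adjacent grade-$1$ leg. The linear map $\chi_{\mathcal W}:\mathcal W\to\widetilde{\mathcal W}$ sends a diagram to the average over all rearrangements of its legs, each with the sign with which that rearrangement acts in $\mathcal W$. The map $\pi:\widetilde{\mathcal W}\to\widehat{\mathcal W}$ is the quotient map. The map $B_{\bullet\to F}:\widehat{\mathcal W}\to\widehat{\mathcal W}_{\mathbf F}$ replaces every dot on an edge $e$ by a curvature leg on $e$ plus $\tfrac12$ times a *fork*: a trivalent vertex with edges $e,p,q$ in this cyclic order, where $p$ and $q$ end in grade-$1$ legs placed, $p$ to the left of $q$, where the dot was. **Operator diagrams.** Let $\mathcal V$ be $\widehat{\mathcal W}$ or $\widehat{\mathcal W}_{\mathbf F}$. Allow in addition *parameter legs* labelled $a$ (grade $2$) or $b$ (grade $1$), anywhere on the line, and *operator legs* labelled $\partial_a$ (grade $2$) or $\partial_b$ (grade $1$), in a group at the far right of the line. A diagram has type $(i,j)$ if its parameter legs have total grade $i$ and its operator legs total grade $j$. Let $\mathcal V[a,b]^{(i,j)}$ be the space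 of combinations of diagrams of type $(i,j)$ modulo the relations of $\mathcal V$ and the relations that parameter legs may be moved past any non-operator leg, and operator legs past operator legs, with sign $(-1)^{gh}$. Put $\mathcal V[[a,b]]=\prod_{i,j\ge0}\mathcal V[a,b]^{(i,j)}$. Write $[\,\cdot\,]_{a,b,\partial_a,\partial_b=0}$ for the projection to $\mathcal V[a,b]^{(0,0)}=\mathcal V$. For diagrams $v,w$, the product $v\vdash w$ is obtained by placing $v$ to the left of $w$ and pushing the operator legs of $v$ to the far right. An operator leg of grade $g$ passes a leg of grade $h$ with the sign $(-1)^{gh}$; when it meets a parameter leg for the same parameter there is, in addition to the term in which it passes, the term in which the two legs are deleted and their edges are joined. The product $v\# w$ is defined in the same way without the additional terms. Both products are well defined and bilinear on the spaces $\mathcal V[a,b]^{(i,j)}$ and are extended to power series type by type; $v\vdash w$ is *convergent* if, for each type $(i,j)$, the type $(i,j)$ part of $v^{(k,l)}\vdash w^{(m,n)}$ vanishes for all but finitely many $((k,l),(m,n))$. Write $\exp_\#(u)=\sum_{n\ge0}\frac1{n!}u^{\# n}$, which is well defined if each type occurs in only finitely many of the powers $u^{\# n}$. Let $\mathrm{Op}:\mathcal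 W\to\mathcal V[[a,b]]$ be the linear map which replaces every dot by an operator leg $\partial_a$ and every grade-$1$ leg by an operator leg $\partial_b$, keeping the order. For $\mathcal V=\widehat{\mathcal W}$ let $P=P_a+P_b$, where $P_a$ is a single edge whose ends are, from left to right, a parameter leg $a$ and a dot, and $P_b$ is a single edge whose ends are, from left to right, a parameter leg $b$ and a grade-$1$ leg. For $\mathcal V=\widehat{\mathcal W}_{\mathbf F}$ let $P^{\mathbf F}=P^{\mathbf F}_a+\tfrac12Y+P_b$, where $P_a^{\mathbf F}$ is a single edge whose ends are, from left to right, a parameter leg $a$ and a curvature leg, $Y$ is a trivalent vertex with edges $e,p,q$ in this cyclic order ending, from left to right, in a parameter leg $a$ and two grade-$1$ legs, and $P_b$ is as before. **Theorem.** Let $v\in\mathcal W$. Then the exponentials $\exp_\#(P)$ and $\exp_\#(P^{\mathbf F})$ are well defined, the products $\mathrm{Op}(v)\vdash\exp_\#(P)$ in $\widehat{\mathcal W}[[a,b]]$ and $\mathrm{Op}(v)\vdash\exp_\#(P^{\mathbf F})$ in $\widehat{\mathcal W}_{\mathbf F}[[a,b]]$ are convergent, and $$(\pi\circ\chi_{\mathcal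 W})(v)=\bigl[\mathrm{Op}(v)\vdash\exp_\#(P)\bigr]_{a,b,\partial_a,\partial_b=0},$$ $$(B_{\bullet\to F}\circ\pi\circ\chi_{\mathcal W})(v)=\bigl[\mathrm{Op}(v)\vdash\exp_\#(P^{\mathbf F})\bigr]_{a,b,\partial_a,\partial_b=0}.$$ -/

import Mathlib

noncomputable section

namespace Weil

/-- The two formal parameters: `a` of grade 2 and `b` of grade 1. -/
inductive Par
  | a
  | b
  deriving DecidableEq

def Par.grade : Par → ℕ
  | .a => 2
  | .b => 1

/-- The kinds of non-operator legs.  `two` is the ordinary leg of grade 2: the leg with a fat dot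
in the spaces `𝒲`, `𝒲~`, `𝒲^`, and the curvature leg in the space `𝒲^_F`.  `one` is the ordinary
leg of grade 1.  `par p` is a parameter leg. -/
inductive Kind
  | two
  | one
  | par (p : Par)
  deriving DecidableEq

def Kind.grade : Kind → ℕ
  | .two => 2
  | .one => 1
  | .par p => p.grade

def Kind.parGrade : Kind → ℕ
  | .par p => p.grade
  | _ => 0

/-- The internal vertices of a graph whose edges are named by natural numbers: a trivalent vertex
whose incident edges, in counterclockwise cyclic order, are `x, y, z`; or a joint of the edges `x`
and `y`, i.e. a point in the interior of an edge (joints are smoothed away by a relation below; a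
joint of an edge with itself is a closed circle). -/
inductive Node
  | tri (x y z : ℕ)
  | joint (x y : ℕ)

def Node.labels : Node → Multiset ℕ
  | .tri x y z => {x, y, z}
  | .joint x y => {x, y}

def Node.relabel (f : ℕ → ℕ) : Node → Node
  | .tri x y z => .tri (f x) (f y) (f z)
  | .joint x y => .joint (f x) (f y)

/-- Combinatorial data for a graph with legs on an orienting line: internal vertices, the
non-operator legs from left to right, and then (at the far right-hand end of the line) the operator
legs from left to right; `(p, x)` in `ops` is a leg labelled `∂_p` at the end of the edge `x`. -/
@[ext] structure Raw where
  nodes : Multiset Node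
  legs : List (Kind × ℕ)
  ops : List (Par × ℕ)

namespace Raw

/-- The names of the edges at all the ends of edges. -/
def labels (r : Raw) : Multiset ℕ :=
  r.nodes.bind Node.labels + ((r.legs.map Prod.snd : List ℕ) : Multiset ℕ)
    + ((r.ops.map Prod.snd : List ℕ) : Multiset ℕ)

/-- Every edge has exactly two ends, each at an internal vertex or a leg. -/
def Closed (r : Raw) : Prop := ∀ x ∈ r.labels, r.labels.count x = 2

/-- The pair (parameter-grade, operator-grade). -/
def type (r : Raw) : ℕ × ℕ :=
  ((r.legs.map fun l => l.1.parGrade).sum, (r.ops.map fun d => d.1.grade).sum)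

def relabel (f : ℕ → ℕ) (r : Raw) : Raw :=
  ⟨r.nodes.map (Node.relabel f), r.legs.map (Prod.map id f), r.ops.map (Prod.map id f)⟩

def add (n : Node) (r : Raw) : Raw := ⟨n ::ₘ r.nodes, r.legs, r.ops⟩

/-- Put the internal vertices and the non-operator legs of `d` in front of `r`. -/
def prepend (d r : Raw) : Raw := ⟨d.nodes + r.nodes, d.legs ++ r.legs, r.ops⟩

end Raw

/-- Operator Weil diagrams of type `t`.  A diagram of type `(0, 0)` has neither parameter legs nor
operator legs, so it is an ordinary Weil diagram. -/
def diagrams (t : ℕ × ℕ) : Set Raw := {r | r.Closed ∧ r.type = t}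

/-- Formal linear combinations. -/
abbrev Comb := Raw →₀ ℚ

abbrev δ (r : Raw) : Comb := Finsupp.single r 1

/-- What happens when two adjacent legs are exchanged: there is no relation; they commute up to
sign; the graded commutator is a leg of kind `m` at the stem of a trivalent vertex;
or the graded commutator is the diagram with the two legs joined. -/
inductive Exch
  | free
  | comm
  | bracket (m : Kind)
  | join

/-- The four spaces: `sym` is `𝒲`, `tilde` is `𝒲~`, `hat` is `𝒲^`, `hatF` is `𝒲^_F`. -/
inductive Theory
  | sym
  | tilde
  | hat
  | hatF

/-- The exchange relations of the four theories.  Parameter legs can be moved about freely, up to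
sign, in each of them. -/
def Theory.exch : Theory → Kind → Kind → Exch
  | _, .par _, _ => .comm
  | _, _, .par _ => .comm
  | .sym, _, _ => .comm
  | .tilde, _, _ => .free
  | .hat, .two, .two => .bracket .two
  | .hat, .two, .one => .bracket .one
  | .hat, .one, .two => .bracket .one
  | .hat, .one, .one => .join
  | .hatF, .two, .two => .bracket .two
  | .hatF, .two, .one => .comm
  | .hatF, .one, .two => .comm
  | .hatF, .one, .one => .join

def koszul (g h : ℕ) : ℚ := (-1) ^ (g * h)

/-- The defining relations. -/
inductive Relator (T : Theory) : Comb → Prop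
  /-- The names of the edges do not matter. -/
  | relabel (r : Raw) (f : ℕ → ℕ) (hf : Function.Injective f) :
      Relator T (δ r - δ (r.relabel f))
  | joint_symm (r : Raw) (x y : ℕ) :
      Relator T (δ (r.add (.joint x y)) - δ (r.add (.joint y x)))
  /-- A joint of two different edges can be smoothed away. -/
  | smooth (r : Raw) (x y : ℕ) (hxy : x ≠ y) (hy : r.labels.count y = 1) :
      Relator T (δ (r.add (.joint x y)) - δ (r.relabel (Function.update id y x)))
  /-- Only the cyclic order at a trivalent vertex matters. -/
  | rotate (r : Raw) (x y z : ℕ) :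
      Relator T (δ (r.add (.tri x y z)) - δ (r.add (.tri y z x)))
  /-- The AS relation. -/
  | antisymm (r : Raw) (x y z : ℕ) :
      Relator T (δ (r.add (.tri x y z)) + δ (r.add (.tri y x z)))
  /-- The IHX relation. -/
  | ihx (r : Raw) (a b c d x : ℕ) :
      Relator T (δ ((r.add (.tri x c d)).add (.tri a b x))
        + δ ((r.add (.tri x a d)).add (.tri b c x))
        + δ ((r.add (.tri x b d)).add (.tri c a x)))
  /-- Operator legs can be moved about freely, up to sign. -/
  | ops (N : Multiset Node) (w : List (Kind × ℕ)) (p s : List (Par × ℕ)) (d e : Par × ℕ) :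
      Relator T (δ ⟨N, w, p ++ d :: e :: s⟩
        - koszul d.1.grade e.1.grade • δ ⟨N, w, p ++ e :: d :: s⟩)
  | comm (N : Multiset Node) (p s : List (Kind × ℕ)) (q : List (Par × ℕ)) (k l : Kind) (x y : ℕ)
      (h : T.exch k l = .comm) :
      Relator T (δ ⟨N, p ++ (k, x) :: (l, y) :: s, q⟩
        - koszul k.grade l.grade • δ ⟨N, p ++ (l, y) :: (k, x) :: s, q⟩)
  | bracket (N : Multiset Node) (p s : List (Kind × ℕ)) (q : List (Par × ℕ)) (k l m : Kind)
      (x y z : ℕ) (h : T.exch k l = .bracket m)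
      (hz : z ∉ (⟨N, p ++ (k, x) :: (l, y) :: s, q⟩ : Raw).labels) :
      Relator T (δ ⟨N, p ++ (k, x) :: (l, y) :: s, q⟩
        - koszul k.grade l.grade • δ ⟨N, p ++ (l, y) :: (k, x) :: s, q⟩
        - δ ⟨.tri x z y ::ₘ N, p ++ (m, z) :: s, q⟩)
  | join (N : Multiset Node) (p s : List (Kind × ℕ)) (q : List (Par × ℕ)) (k l : Kind) (x y : ℕ)
      (h : T.exch k l = .join) :
      Relator T (δ ⟨N, p ++ (k, x) :: (l, y) :: s, q⟩
        - koszul k.grade l.grade • δ ⟨N, p ++ (l, y) :: (k, x) :: s, q⟩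
        - δ ⟨.joint x y ::ₘ N, p ++ s, q⟩)

/-- The relations among diagrams of type `t`. -/
def relations (T : Theory) (t : ℕ × ℕ) : Submodule ℚ (diagrams t →₀ ℚ) :=
  Submodule.span ℚ {ρ | Relator T (ρ.mapDomain Subtype.val)}

/-- The space of formal linear combinations of operator Weil diagrams of type `t`, modulo the
relations. -/
abbrev Space (T : Theory) (t : ℕ × ℕ) : Type := (diagrams t →₀ ℚ) ⧸ relations T t

/-- The class of (the type `t` part of) a linear combination. -/
def cls (T : Theory) (t : ℕ × ℕ) : Comb →ₗ[ℚ] Space T t :=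
  (relations T t).mkQ ∘ₗ Finsupp.lsubtypeDomain (diagrams t)


/-! Helper facts: the relations are homogeneous, so that a relator always has class zero. -/

namespace Raw

theorem closed_iff (r : Raw) :
    r.Closed ↔ ∀ x, r.labels.count x = 0 ∨ r.labels.count x = 2 := by
  constructor
  · intro h x
    by_cases hx : x ∈ r.labels
    · exact Or.inr (h x hx)
    · exact Or.inl (Multiset.count_eq_zero_of_notMem hx)
  · intro h x hx
    rcases h x with h0 | h2
    · exact absurd (Multiset.count_eq_zero.mp h0) (by simpa using hx)
    · exact h2

theorem labels_add (n : Node) (r : Raw) : (r.add n).labels = n.labels + r.labels := by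
  simp [labels, add, add_assoc]

theorem type_add (n : Node) (r : Raw) : (r.add n).type = r.type := rfl

theorem node_labels_relabel (f : ℕ → ℕ) (n : Node) : (n.relabel f).labels = n.labels.map f := by
  cases n <;> simp [Node.relabel, Node.labels]

theorem labels_relabel (f : ℕ → ℕ) (r : Raw) : (r.relabel f).labels = r.labels.map f := by
  simp [labels, relabel, Multiset.bind_map, node_labels_relabel, Multiset.map_bind,
    Function.comp_def]

theorem type_relabel (f : ℕ → ℕ) (r : Raw) : (r.relabel f).type = r.type := by
  simp [type, relabel, Function.comp_def]

theorem mem_diagrams_of_labels_eq {r s : Raw} (h : r.labels = s.labels) (ht : r.type = s.type)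
    (t : ℕ × ℕ) : r ∈ diagrams t ↔ s ∈ diagrams t := by
  simp [diagrams, Closed, h, ht]

theorem relabel_mem_diagrams (r : Raw) {f : ℕ → ℕ} (hf : Function.Injective f) (t : ℕ × ℕ) :
    r.relabel f ∈ diagrams t ↔ r ∈ diagrams t := by
  simp only [diagrams, Set.mem_ofPred_eq, type_relabel, Closed, labels_relabel]
  refine and_congr_left fun _ => ?_
  simp [Multiset.count_map_eq_count' f _ hf]

theorem count_map_update (M : Multiset ℕ) {x y : ℕ} (hxy : x ≠ y) (z : ℕ) :
    (M.map (Function.update id y x)).count z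
      = if z = y then 0 else if z = x then M.count x + M.count y else M.count z := by
  induction M using Multiset.induction_on with
  | empty => simp
  | cons a M ih =>
    simp only [Multiset.map_cons, Multiset.count_cons, ih]
    by_cases ha : a = y
    · subst ha; simp only [Function.update_self]; split_ifs <;> omega
    · simp only [Function.update_of_ne ha, id]; split_ifs <;> omega

theorem smooth_mem_diagrams (r : Raw) {x y : ℕ} (hxy : x ≠ y) (hy : r.labels.count y = 1)
    (t : ℕ × ℕ) :
    r.relabel (Function.update id y x) ∈ diagrams t ↔ r.add (.joint x y) ∈ diagrams t := by
  simp only [diagrams, Set.mem_ofPred_eq, type_relabel, type_add, closed_iff, labels_relabel,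
    labels_add, count_map_update _ hxy, Multiset.count_add]
  refine and_congr_left fun _ => ?_
  have hn : ∀ z, (Node.joint x y).labels.count z
      = (if z = x then 1 else 0) + (if z = y then 1 else 0) := by
    intro z
    simp [Node.labels, Multiset.count_cons, Multiset.count_singleton]
    omega
  constructor
  · intro h z
    have := h z
    rw [hn]
    split_ifs at * <;> subst_vars <;> omega
  · intro h z
    have := h z
    rw [hn] at this
    split_ifs at * <;> subst_vars <;> omega

theorem labels_legs_append (N : Multiset Node) (p s : List (Kind × ℕ)) (q : List (Par × ℕ)) :
    (⟨N, p ++ s, q⟩ : Raw).labels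
      = (((p.map Prod.snd : List ℕ)) : Multiset ℕ) + (⟨N, s, q⟩ : Raw).labels := by
  simp only [labels, List.map_append, ← Multiset.coe_add]
  abel

theorem labels_legs_cons (N : Multiset Node) (l : Kind × ℕ) (s : List (Kind × ℕ))
    (q : List (Par × ℕ)) :
    (⟨N, l :: s, q⟩ : Raw).labels = {l.2} + (⟨N, s, q⟩ : Raw).labels := by
  simp only [labels, List.map_cons, ← Multiset.cons_coe, ← Multiset.singleton_add]
  abel

theorem labels_ops_append (N : Multiset Node) (w : List (Kind × ℕ)) (p s : List (Par × ℕ)) :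
    (⟨N, w, p ++ s⟩ : Raw).labels
      = (((p.map Prod.snd : List ℕ)) : Multiset ℕ) + (⟨N, w, s⟩ : Raw).labels := by
  simp only [labels, List.map_append, ← Multiset.coe_add]
  abel

theorem labels_ops_cons (N : Multiset Node) (w : List (Kind × ℕ)) (d : Par × ℕ)
    (s : List (Par × ℕ)) :
    (⟨N, w, d :: s⟩ : Raw).labels = {d.2} + (⟨N, w, s⟩ : Raw).labels := by
  simp only [labels, List.map_cons, ← Multiset.cons_coe, ← Multiset.singleton_add]
  abel

theorem labels_nodes_cons (n : Node) (N : Multiset Node) (w : List (Kind × ℕ))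
    (q : List (Par × ℕ)) :
    (⟨n ::ₘ N, w, q⟩ : Raw).labels = n.labels + (⟨N, w, q⟩ : Raw).labels :=
  labels_add n ⟨N, w, q⟩

end Raw

theorem cls_eq_zero_of_supported {T : Theory} {ρ : Comb} (h : Relator T ρ) (t : ℕ × ℕ)
    (hs : ρ ∈ Finsupp.supported ℚ ℚ (diagrams t) ∨ ρ ∈ Finsupp.supported ℚ ℚ (diagrams t)ᶜ) :
    cls T t ρ = 0 := by
  rcases hs with hs | hs
  · simp only [cls, LinearMap.comp_apply, Submodule.mkQ_apply, Submodule.Quotient.mk_eq_zero]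
    refine Submodule.subset_span ?_
    have : (Finsupp.lsubtypeDomain (R := ℚ) (diagrams t) ρ : diagrams t →₀ ℚ).mapDomain Subtype.val
        = ρ := by
      rw [Finsupp.mem_supported] at hs
      ext r
      by_cases hr : r ∈ diagrams t
      · exact Finsupp.mapDomain_apply Subtype.val_injective _ (⟨r, hr⟩ : diagrams t)
      · rw [Finsupp.mapDomain_of_notMem_range]
        · by_contra hne
          exact hr (hs (Finsupp.mem_support_iff.mpr (Ne.symm hne)))
        · rintro ⟨⟨r', hr'⟩, rfl⟩
          exact hr hr'
    simpa [this] using h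
  · have : Finsupp.lsubtypeDomain (R := ℚ) (diagrams t) ρ = 0 := by
      rw [Finsupp.mem_supported] at hs
      ext ⟨r, hr⟩
      by_contra hne
      exact hs (Finsupp.mem_support_iff.mpr hne) hr
    simp [cls, this]

theorem supported_two (D : Set Raw) {a b : Raw} (h : a ∈ D ↔ b ∈ D) (c : ℚ) :
    (δ a - c • δ b) ∈ Finsupp.supported ℚ ℚ D ∨ (δ a - c • δ b) ∈ Finsupp.supported ℚ ℚ Dᶜ := by
  by_cases ha : a ∈ D
  · exact Or.inl (sub_mem (Finsupp.single_mem_supported _ _ ha)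
      (Submodule.smul_mem _ _ (Finsupp.single_mem_supported _ _ (h.mp ha))))
  · exact Or.inr (sub_mem (Finsupp.single_mem_supported _ _ ha)
      (Submodule.smul_mem _ _ (Finsupp.single_mem_supported _ _ (fun hb => ha (h.mpr hb)))))

theorem supported_three (D : Set Raw) {a b d : Raw} (h : a ∈ D ↔ b ∈ D) (h' : a ∈ D ↔ d ∈ D)
    (c e : ℚ) :
    (δ a - c • δ b - e • δ d) ∈ Finsupp.supported ℚ ℚ D
      ∨ (δ a - c • δ b - e • δ d) ∈ Finsupp.supported ℚ ℚ Dᶜ := by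
  by_cases ha : a ∈ D
  · exact Or.inl (sub_mem (sub_mem (Finsupp.single_mem_supported _ _ ha)
      (Submodule.smul_mem _ _ (Finsupp.single_mem_supported _ _ (h.mp ha))))
      (Submodule.smul_mem _ _ (Finsupp.single_mem_supported _ _ (h'.mp ha))))
  · exact Or.inr (sub_mem (sub_mem (Finsupp.single_mem_supported _ _ ha)
      (Submodule.smul_mem _ _ (Finsupp.single_mem_supported _ _ (fun hb => ha (h.mpr hb)))))
      (Submodule.smul_mem _ _ (Finsupp.single_mem_supported _ _ (fun hb => ha (h'.mpr hb)))))

theorem exch_bracket {T : Theory} {k l m : Kind} (h : T.exch k l = .bracket m) :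
    k.parGrade = 0 ∧ l.parGrade = 0 ∧ m.parGrade = 0 ∧ (∀ p, k ≠ .par p) ∧ (∀ p, l ≠ .par p)
      ∧ (∀ p, m ≠ .par p)
      ∧ ∀ g, koszul g m.grade = koszul g k.grade * koszul g l.grade := by
  cases T <;> cases k <;> cases l <;> simp [Theory.exch] at h <;> subst h <;>
    refine ⟨rfl, rfl, rfl, by simp, by simp, by simp, fun g => ?_⟩ <;>
    rcases neg_one_pow_eq_or ℚ g with hg | hg <;>
    simp [koszul, Kind.grade, pow_mul, hg]

theorem exch_join {T : Theory} {k l : Kind} (h : T.exch k l = .join) :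
    k.parGrade = 0 ∧ l.parGrade = 0 ∧ (∀ p, k ≠ .par p) ∧ (∀ p, l ≠ .par p)
      ∧ ∀ g, koszul g k.grade * koszul g l.grade = 1 := by
  cases T <;> cases k <;> cases l <;> simp [Theory.exch] at h <;>
    simp [Kind.parGrade, koszul, Kind.grade, ← mul_pow]

theorem cls_relator {T : Theory} {ρ : Comb} (h : Relator T ρ) (t : ℕ × ℕ) : cls T t ρ = 0 := by
  apply cls_eq_zero_of_supported h
  cases h with
  | relabel r f hf =>
    simpa using supported_two (diagrams t) (r.relabel_mem_diagrams hf t).symm 1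
  | joint_symm r x y =>
    simpa using supported_two (diagrams t) (a := r.add (.joint x y)) (b := r.add (.joint y x))
      (Raw.mem_diagrams_of_labels_eq
      (by rw [Raw.labels_add, Raw.labels_add, Node.labels, Node.labels, Multiset.pair_comm]) (by simp [Raw.type_add]) t) 1
  | smooth r x y hxy hy =>
    simpa using supported_two (diagrams t) (r.smooth_mem_diagrams hxy hy t).symm 1
  | rotate r x y z =>
    simpa using supported_two (diagrams t) (a := r.add (.tri x y z)) (b := r.add (.tri y z x))
      (Raw.mem_diagrams_of_labels_eq (by
        simp only [Raw.labels_add, Node.labels, Multiset.insert_eq_cons,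
          ← Multiset.singleton_add]
        abel) (by simp [Raw.type_add]) t) 1
  | antisymm r x y z =>
    simpa using supported_two (diagrams t) (a := r.add (.tri x y z)) (b := r.add (.tri y x z))
      (Raw.mem_diagrams_of_labels_eq (by
        simp only [Raw.labels_add, Node.labels, Multiset.insert_eq_cons,
          ← Multiset.singleton_add]
        abel) (by simp [Raw.type_add]) t) (-1)
  | ihx r a b c d x =>
    simpa using supported_three (diagrams t)
      (a := (r.add (.tri x c d)).add (.tri a b x)) (b := (r.add (.tri x a d)).add (.tri b c x))
      (d := (r.add (.tri x b d)).add (.tri c a x))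
      (Raw.mem_diagrams_of_labels_eq (by
        simp only [Raw.labels_add, Node.labels, Multiset.insert_eq_cons,
          ← Multiset.singleton_add]
        abel) (by simp [Raw.type_add]) t)
      (Raw.mem_diagrams_of_labels_eq (by
        simp only [Raw.labels_add, Node.labels, Multiset.insert_eq_cons,
          ← Multiset.singleton_add]
        abel) (by simp [Raw.type_add]) t) (-1) (-1)
  | ops N w p s d e =>
    exact supported_two (diagrams t) (Raw.mem_diagrams_of_labels_eq (by
        simp only [Raw.labels_ops_append, Raw.labels_ops_cons]
        abel) (by simp [Raw.type]; omega) t) _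
  | comm N p s q k l x y h =>
    exact supported_two (diagrams t) (Raw.mem_diagrams_of_labels_eq (by
        simp only [Raw.labels_legs_append, Raw.labels_legs_cons]
        abel) (by simp [Raw.type]; omega) t) _
  | bracket N p s q k l m x y z h hz =>
    obtain ⟨hk, hl, hm, -⟩ := exch_bracket h
    have := supported_three (diagrams t)
      (a := ⟨N, p ++ (k, x) :: (l, y) :: s, q⟩) (b := ⟨N, p ++ (l, y) :: (k, x) :: s, q⟩)
      (d := ⟨.tri x z y ::ₘ N, p ++ (m, z) :: s, q⟩)
      (Raw.mem_diagrams_of_labels_eq (by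
        simp only [Raw.labels_legs_append, Raw.labels_legs_cons]
        abel) (by simp [Raw.type]; omega) t)
      (by
        simp only [diagrams, Set.mem_ofPred_eq]
        refine and_congr ?_ (by simp [Raw.type, hk, hl, hm])
        have e1 : (⟨.tri x z y ::ₘ N, p ++ (m, z) :: s, q⟩ : Raw).labels
            = {z, z} + (⟨N, p ++ (k, x) :: (l, y) :: s, q⟩ : Raw).labels := by
          simp only [Raw.labels_nodes_cons, Raw.labels_legs_append, Raw.labels_legs_cons]
          simp only [Node.labels, Multiset.insert_eq_cons, ← Multiset.singleton_add]
          abel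
        rw [Raw.closed_iff, Raw.closed_iff, e1]
        have hz0 := Multiset.count_eq_zero_of_notMem hz
        refine forall_congr' fun w => ?_
        by_cases hw : w = z
        · subst hw
          simp [hz0]
        · simp [hw])
      (koszul k.grade l.grade) 1
    simpa only [one_smul] using this
  | join N p s q k l x y h =>
    obtain ⟨hk, hl, -⟩ := exch_join h
    have := supported_three (diagrams t)
      (a := ⟨N, p ++ (k, x) :: (l, y) :: s, q⟩) (b := ⟨N, p ++ (l, y) :: (k, x) :: s, q⟩)
      (d := ⟨.joint x y ::ₘ N, p ++ s, q⟩)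
      (Raw.mem_diagrams_of_labels_eq (by
        simp only [Raw.labels_legs_append, Raw.labels_legs_cons]
        abel) (by simp [Raw.type]; omega) t)
      (Raw.mem_diagrams_of_labels_eq (by
        simp only [Raw.labels_nodes_cons, Raw.labels_legs_append, Raw.labels_legs_cons]
        simp only [Node.labels, Multiset.insert_eq_cons, ← Multiset.singleton_add]
        abel) (by simp [Raw.type, hk, hl]) t)
      (koszul k.grade l.grade) 1
    simpa only [one_smul] using this

/-- A linear map on combinations which kills the relators descends to the space of diagrams. -/
def lift {T : Theory} {M : Type} [AddCommGroup M] [Module ℚ M] (t : ℕ × ℕ) (g : Comb →ₗ[ℚ] M)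
    (hg : ∀ ρ, Relator T ρ → g ρ = 0) : Space T t →ₗ[ℚ] M :=
  (relations T t).liftQ (g ∘ₗ Finsupp.lmapDomain ℚ ℚ Subtype.val) <| by
    rw [relations, Submodule.span_le]
    intro ρ hρ
    exact hg _ hρ

/-! ### Operating with diagrams on diagrams -/

/-- Put the internal vertices and the non-operator legs of `d` in front of each diagram. -/
def pre (d : Raw) : Comb →ₗ[ℚ] Comb := Finsupp.lmapDomain ℚ ℚ d.prepend

/-- Rename the edges. -/
def ren (f : ℕ → ℕ) : Comb →ₗ[ℚ] Comb := Finsupp.lmapDomain ℚ ℚ (Raw.relabel f)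

/-- Push the operator leg `d`, standing at the left-hand end of the word `w` of non-operator legs,
to the right, until it joins the operator legs `q`.  When it meets a parameter leg for the same
parameter there is, besides the term where it passes, the term (multiplied by `c`) where the two
legs are joined.  It passes a leg with the sign `(-1)^(g₁ g₂)`. -/
def push (c : ℚ) (d : Par × ℕ) (q : List (Par × ℕ)) : List (Kind × ℕ) → Comb
  | [] => δ ⟨0, [], d :: q⟩
  | l :: w => (if l.1 = .par d.1 then c • δ ⟨{.joint d.2 l.2}, w, q⟩ else 0)
      + koszul d.1.grade l.1.grade • pre ⟨0, [l], []⟩ (push c d q w)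

/-- Place the operator leg `d` in front of a diagram and push it to the right. -/
def pushOp (c : ℚ) (d : Par × ℕ) : Comb →ₗ[ℚ] Comb :=
  Finsupp.linearCombination ℚ fun r => pre ⟨r.nodes, [], []⟩ (push c d r.ops r.legs)

/-- Place the diagram `d` in front of a diagram and push all the operator legs of `d` to the right,
beginning with the right-most one. -/
def act (c : ℚ) (d : Raw) : Comb →ₗ[ℚ] Comb :=
  pre d ∘ₗ d.ops.foldr (fun e F => pushOp c e ∘ₗ F) LinearMap.id

def evenName (n : ℕ) : ℕ := 2 * n

def oddName (n : ℕ) : ℕ := 2 * n + 1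

/-- `act`, after the names of the edges of the two diagrams have been made distinct. -/
def operate (c : ℚ) (d e : Raw) : Comb :=
  act c (d.relabel evenName) (δ (e.relabel oddName))

/-! Helper facts: the operation respects the relations. -/

theorem pre_single (d r : Raw) : pre d (δ r) = δ (d.prepend r) := by
  simp [pre, Finsupp.lmapDomain_apply, Finsupp.mapDomain_single]

theorem ren_single (f : ℕ → ℕ) (r : Raw) : ren f (δ r) = δ (r.relabel f) := by
  simp [ren, Finsupp.lmapDomain_apply, Finsupp.mapDomain_single]

theorem pushOp_single (c : ℚ) (d : Par × ℕ) (r : Raw) :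
    pushOp c d (δ r) = pre ⟨r.nodes, [], []⟩ (push c d r.ops r.legs) := by
  simp [pushOp, Finsupp.linearCombination_single]

theorem comb_ext {M : Type} [AddCommGroup M] [Module ℚ M] {f g : Comb →ₗ[ℚ] M}
    (h : ∀ r, f (δ r) = g (δ r)) : f = g :=
  Finsupp.lhom_ext' fun r => LinearMap.ext_ring (h r)

theorem comb_congr {M : Type} [AddCommGroup M] [Module ℚ M] (f g : Comb →ₗ[ℚ] M)
    (h : ∀ r, f (δ r) = g (δ r)) (m : Comb) : f m = g m := by
  rw [comb_ext h]

theorem pre_pre (d e : Raw) (m : Comb) :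
    pre d (pre e m) = pre ⟨d.nodes + e.nodes, d.legs ++ e.legs, []⟩ m := by
  refine comb_congr (pre d ∘ₗ pre e) (pre _) (fun r => ?_) m
  simp only [LinearMap.comp_apply, pre_single]
  simp [Raw.prepend, add_assoc]

theorem pre_congr {d e : Raw} (h : d.nodes = e.nodes) (h' : d.legs = e.legs) : pre d = pre e := by
  refine comb_ext fun r => ?_
  simp only [pre_single]
  simp [Raw.prepend, h, h']

theorem pre_nil (m : Comb) : pre ⟨0, [], []⟩ m = m := by
  refine comb_congr (pre _) LinearMap.id (fun r => ?_) m
  simp [pre_single, Raw.prepend]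

theorem ren_pre (f : ℕ → ℕ) (d : Raw) (m : Comb) :
    ren f (pre d m) = pre (d.relabel f) (ren f m) := by
  refine comb_congr (ren f ∘ₗ pre d) (pre (d.relabel f) ∘ₗ ren f)
    (fun r => ?_) m
  simp only [LinearMap.comp_apply, pre_single, ren_single]
  simp [Raw.prepend, Raw.relabel]

theorem pushOp_pre_nodes (c : ℚ) (d : Par × ℕ) (N : Multiset Node) (m : Comb) :
    pushOp c d (pre ⟨N, [], []⟩ m) = pre ⟨N, [], []⟩ (pushOp c d m) := by
  refine comb_congr (pushOp c d ∘ₗ pre ⟨N, [], []⟩)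
    (pre ⟨N, [], []⟩ ∘ₗ pushOp c d)
    (fun r => ?_) m
  simp only [LinearMap.comp_apply, pre_single, pushOp_single, pre_pre]
  simp [Raw.prepend]

theorem pushOp_pre_leg (c : ℚ) (d : Par × ℕ) (l : Kind × ℕ) (m : Comb) :
    pushOp c d (pre ⟨0, [l], []⟩ m)
      = (if l.1 = .par d.1 then c else 0) • pre ⟨{.joint d.2 l.2}, [], []⟩ m
        + koszul d.1.grade l.1.grade • pre ⟨0, [l], []⟩ (pushOp c d m) := by
  refine comb_congr (pushOp c d ∘ₗ pre ⟨0, [l], []⟩)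
    ((if l.1 = .par d.1 then c else 0) • pre ⟨{.joint d.2 l.2}, [], []⟩
        + koszul d.1.grade l.1.grade • pre ⟨0, [l], []⟩ ∘ₗ pushOp c d)
    (fun r => ?_) m
  simp only [LinearMap.comp_apply, pre_single, pushOp_single, pre_pre, LinearMap.add_apply,
    LinearMap.smul_apply]
  simp only [Raw.prepend, zero_add, List.cons_append, List.nil_append, push, map_add, map_smul,
    pre_pre, add_zero, List.append_nil]
  congr 1
  split_ifs with h
  · rw [map_smul, pre_single]
    simp [Raw.prepend, add_comm]
  · simp

theorem ren_push (f : ℕ → ℕ) (c : ℚ) (d : Par × ℕ) (q : List (Par × ℕ)) (w : List (Kind × ℕ)) :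
    ren f (push c d q w) = push c (Prod.map id f d) (q.map (Prod.map id f))
      (w.map (Prod.map id f)) := by
  induction w with
  | nil => simp only [push, ren_single]; simp [Raw.relabel, push]
  | cons l w ih =>
    simp only [push, map_add, map_smul, ren_pre, ih, List.map_cons]
    congr 1
    simp only [Prod.map_fst, id]
    split_ifs with h
    · rw [map_smul, ren_single]; simp [Raw.relabel, Node.relabel]
    · simp

theorem ren_pushOp (f : ℕ → ℕ) (c : ℚ) (d : Par × ℕ) (m : Comb) :
    ren f (pushOp c d m) = pushOp c (Prod.map id f d) (ren f m) := by
  refine comb_congr (ren f ∘ₗ pushOp c d)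
    (pushOp c (Prod.map id f d) ∘ₗ ren f)
    (fun r => ?_) m
  simp only [LinearMap.comp_apply, ren_single, pushOp_single, ren_pre, ren_push]
  simp [Raw.relabel]

theorem foldr_comp (c : ℚ) (p : List (Par × ℕ)) (F : Comb →ₗ[ℚ] Comb) (m : Comb) :
    p.foldr (fun e F => pushOp c e ∘ₗ F) F m
      = p.foldr (fun e F => pushOp c e ∘ₗ F) LinearMap.id (F m) := by
  induction p with
  | nil => rfl
  | cons e p ih => simp only [List.foldr_cons, LinearMap.comp_apply, ih]

theorem ren_act (f : ℕ → ℕ) (c : ℚ) (d : Raw) (m : Comb) :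
    ren f (act c d m) = act c (d.relabel f) (ren f m) := by
  obtain ⟨N, w, p⟩ := d
  simp only [act, LinearMap.comp_apply, ren_pre]
  congr 1
  simp only [Raw.relabel]
  induction p with
  | nil => simp
  | cons e p ih => simp only [List.foldr_cons, List.map_cons, LinearMap.comp_apply, ren_pushOp, ih]

theorem act_pre_nodes (c : ℚ) (d : Raw) (N : Multiset Node) (m : Comb) :
    act c d (pre ⟨N, [], []⟩ m) = pre ⟨N, [], []⟩ (act c d m) := by
  obtain ⟨M, w, p⟩ := d
  have : p.foldr (fun e F => pushOp c e ∘ₗ F) LinearMap.id (pre ⟨N, [], []⟩ m)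
      = pre ⟨N, [], []⟩ (p.foldr (fun e F => pushOp c e ∘ₗ F) LinearMap.id m) := by
    induction p with
    | nil => simp
    | cons e p ih => simp only [List.foldr_cons, LinearMap.comp_apply, ih, pushOp_pre_nodes]
  simp only [act, LinearMap.comp_apply, this, pre_pre]
  simp [add_comm]

theorem act_prepend_nodes (c : ℚ) (N : Multiset Node) (d : Raw) (m : Comb) :
    act c (Raw.prepend ⟨N, [], []⟩ d) m = pre ⟨N, [], []⟩ (act c d m) := by
  simp only [act, LinearMap.comp_apply, pre_pre]
  exact LinearMap.congr_fun (pre_congr (by simp [Raw.prepend]) (by simp [Raw.prepend])) _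

/-- Combinations of diagrams in which the ends of edges are named by `L`. -/
def lab (L : Multiset ℕ) : Submodule ℚ Comb := Finsupp.supported ℚ ℚ {r | r.labels = L}

theorem single_mem_lab {r : Raw} {L : Multiset ℕ} (h : r.labels = L) : δ r ∈ lab L :=
  Finsupp.single_mem_supported _ _ h

theorem lab_induction {L : Multiset ℕ} {S : Submodule ℚ Comb} (F : Comb →ₗ[ℚ] Comb)
    (h : ∀ r : Raw, r.labels = L → F (δ r) ∈ S) {m : Comb} (hm : m ∈ lab L) : F m ∈ S := by
  rw [lab, Finsupp.supported_eq_span_single] at hm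
  have : Submodule.span ℚ ((fun i => Finsupp.single i (1 : ℚ)) '' {r : Raw | r.labels = L})
      ≤ S.comap F := by
    rw [Submodule.span_le]
    rintro _ ⟨r, hr, rfl⟩
    exact h r hr
  exact this hm

theorem lab_zero {L : Multiset ℕ} {M : Type} [AddCommGroup M] [Module ℚ M] (F : Comb →ₗ[ℚ] M)
    (h : ∀ r : Raw, r.labels = L → F (δ r) = 0) {m : Comb} (hm : m ∈ lab L) : F m = 0 := by
  have := lab_induction (S := LinearMap.ker F) LinearMap.id (fun r hr => h r hr) hm
  simpa using this

theorem prepend_labels (N : Multiset Node) (w : List (Kind × ℕ)) (q : List (Par × ℕ)) (r : Raw) :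
    (Raw.prepend ⟨N, w, q⟩ r).labels = (⟨N, w, []⟩ : Raw).labels + r.labels := by
  simp only [Raw.labels, Raw.prepend, Multiset.add_bind, List.map_append, ← Multiset.coe_add,
    List.map_nil, Multiset.coe_nil]
  abel

theorem pre_mem_lab (d : Raw) {L : Multiset ℕ} {m : Comb} (hm : m ∈ lab L) :
    pre d m ∈ lab ((⟨d.nodes, d.legs, []⟩ : Raw).labels + L) := by
  refine lab_induction (pre d) (fun r hr => ?_) hm
  rw [pre_single]
  exact single_mem_lab (by rw [prepend_labels, hr])

theorem push_mem_lab (c : ℚ) (d : Par × ℕ) (q : List (Par × ℕ)) (w : List (Kind × ℕ)) :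
    push c d q w ∈ lab ({d.2} + (⟨0, w, q⟩ : Raw).labels) := by
  induction w with
  | nil => exact single_mem_lab (by rw [Raw.labels_ops_cons])
  | cons l w ih =>
    refine add_mem ?_ (Submodule.smul_mem _ _ ?_)
    · split_ifs
      · refine Submodule.smul_mem _ _ (single_mem_lab ?_)
        rw [Raw.labels_legs_cons]
        simp only [Raw.labels, Multiset.singleton_bind, Node.labels, Multiset.zero_bind,
          Multiset.insert_eq_cons, ← Multiset.singleton_add]
        abel
      · exact zero_mem _
    · have := pre_mem_lab ⟨0, [l], []⟩ ih
      convert this using 2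
      rw [Raw.labels_legs_cons, Raw.labels_legs_cons]
      simp only [Raw.labels, Multiset.zero_bind, List.map_nil, Multiset.coe_nil]
      abel

theorem labels_split (r : Raw) :
    r.labels = (⟨r.nodes, [], []⟩ : Raw).labels + (⟨0, r.legs, r.ops⟩ : Raw).labels := by
  simp only [Raw.labels, Multiset.zero_bind, List.map_nil, Multiset.coe_nil]
  abel

theorem pushOp_mem_lab (c : ℚ) (d : Par × ℕ) {L : Multiset ℕ} {m : Comb} (hm : m ∈ lab L) :
    pushOp c d m ∈ lab ({d.2} + L) := by
  refine lab_induction (pushOp c d) (fun r hr => ?_) hm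
  rw [pushOp_single]
  have := pre_mem_lab ⟨r.nodes, [], []⟩ (push_mem_lab c d r.ops r.legs)
  convert this using 2
  rw [← hr, labels_split r]
  abel

theorem pushes_mem_lab (c : ℚ) (p : List (Par × ℕ)) {L : Multiset ℕ} {m : Comb} (hm : m ∈ lab L) :
    p.foldr (fun e F => pushOp c e ∘ₗ F) LinearMap.id m
      ∈ lab (((p.map Prod.snd : List ℕ) : Multiset ℕ) + L) := by
  induction p with
  | nil => simpa using hm
  | cons e p ih =>
    have := pushOp_mem_lab c e ih
    simp only [List.foldr_cons, LinearMap.comp_apply]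
    convert this using 2
    simp only [List.map_cons, ← Multiset.cons_coe, ← Multiset.singleton_add]
    abel

theorem act_mem_lab (c : ℚ) (d : Raw) {L : Multiset ℕ} {m : Comb} (hm : m ∈ lab L) :
    act c d m ∈ lab (d.labels + L) := by
  have := pre_mem_lab d (pushes_mem_lab c d.ops hm)
  simp only [act, LinearMap.comp_apply]
  convert this using 2
  simp only [Raw.labels, List.map_nil, Multiset.coe_nil]
  abel

theorem prepend_node (n : Node) (r : Raw) : Raw.prepend ⟨{n}, [], []⟩ r = r.add n := by
  simp [Raw.prepend, Raw.add]

theorem prepend_node_two (n n' : Node) (r : Raw) :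
    Raw.prepend ⟨n ::ₘ {n'}, [], []⟩ r = (r.add n').add n := by
  simp [Raw.prepend, Raw.add]

/-- The difference of the two sides of the exchange relation for the legs `(k, x)`, `(l, y)` at the
left-hand end of the line. -/
def boxCorr (T : Theory) (k l : Kind) (x y z : ℕ) : Comb →ₗ[ℚ] Comb :=
  match T.exch k l with
  | .bracket m => pre ⟨{.tri x z y}, [(m, z)], []⟩
  | .join => pre ⟨{.joint x y}, [], []⟩
  | _ => 0

def box (T : Theory) (k l : Kind) (x y z : ℕ) : Comb →ₗ[ℚ] Comb :=
  pre ⟨0, [(k, x), (l, y)], []⟩ - koszul k.grade l.grade • pre ⟨0, [(l, y), (k, x)], []⟩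
    - boxCorr T k l x y z

/-- The exchange relations of non-operator legs for which the name `z` is new. -/
def legIdeal (T : Theory) (z : ℕ) : Submodule ℚ Comb :=
  Submodule.span ℚ {ρ | ∃ (P : Raw) (k l : Kind) (x y : ℕ) (r : Raw), T.exch k l ≠ .free ∧
    z ∉ P.labels ∧ z ≠ x ∧ z ≠ y ∧ z ∉ r.labels ∧ ρ = pre P (box T k l x y z (δ r))}

/-- The exchange relations of operator legs. -/
def opIdeal : Submodule ℚ Comb :=
  Submodule.span ℚ {ρ | ∃ (N : Multiset Node) (w : List (Kind × ℕ)) (p s : List (Par × ℕ))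
    (d e : Par × ℕ), ρ = δ ⟨N, w, p ++ d :: e :: s⟩
        - koszul d.1.grade e.1.grade • δ ⟨N, w, p ++ e :: d :: s⟩}

theorem cls_legIdeal {T : Theory} {z : ℕ} {ρ : Comb} (h : ρ ∈ legIdeal T z) (t : ℕ × ℕ) :
    cls T t ρ = 0 := by
  suffices legIdeal T z ≤ LinearMap.ker (cls T t) from this h
  rw [legIdeal, Submodule.span_le]
  rintro _ ⟨⟨N, p, q'⟩, k, l, x, y, ⟨M, s, q⟩, hf, hP, hx, hy, hr, rfl⟩
  have hz : z ∉ (⟨N + M, p ++ (k, x) :: (l, y) :: s, q⟩ : Raw).labels := by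
    simp only [Raw.labels, Multiset.mem_add, Multiset.mem_coe, not_or, Multiset.add_bind,
      List.map_append, List.map_cons, List.mem_append, List.mem_cons] at hP hr ⊢
    tauto
  rw [SetLike.mem_coe, LinearMap.mem_ker]
  cases he : T.exch k l with
  | free => exact absurd he hf
  | comm =>
    have := cls_relator (Relator.comm (N + M) p s q k l x y he) t
    simpa [-Finsupp.smul_single, box, boxCorr, he, pre_single, Raw.prepend] using this
  | bracket m =>
    have := cls_relator (Relator.bracket (N + M) p s q k l m x y z he hz) t
    simpa [-Finsupp.smul_single, box, boxCorr, he, pre_single, Raw.prepend] using this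
  | join =>
    have := cls_relator (Relator.join (N + M) p s q k l x y he) t
    simpa [-Finsupp.smul_single, box, boxCorr, he, pre_single, Raw.prepend] using this

theorem cls_opIdeal {T : Theory} {ρ : Comb} (h : ρ ∈ opIdeal) (t : ℕ × ℕ) :
    cls T t ρ = 0 := by
  suffices opIdeal ≤ LinearMap.ker (cls T t) from this h
  rw [opIdeal, Submodule.span_le]
  rintro _ ⟨N, w, p, s, d, e, rfl⟩
  exact cls_relator (Relator.ops N w p s d e) t

theorem box_mem {T : Theory} {P : Raw} {k l : Kind} {x y z : ℕ} {L : Multiset ℕ} {m : Comb}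
    (hf : T.exch k l ≠ .free) (hP : z ∉ P.labels) (hx : z ≠ x) (hy : z ≠ y) (hL : z ∉ L)
    (hm : m ∈ lab L) : pre P (box T k l x y z m) ∈ legIdeal T z := by
  refine lab_induction (pre P ∘ₗ box T k l x y z) (fun r hr => ?_) hm
  exact Submodule.subset_span ⟨P, k, l, x, y, r, hf, hP, hx, hy, hr ▸ hL, rfl⟩

theorem not_mem_nodes {z : ℕ} {r : Raw} (h : z ∉ r.labels) :
    z ∉ (⟨r.nodes, [], []⟩ : Raw).labels ∧ z ∉ (⟨r.nodes, r.legs, []⟩ : Raw).labels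
      ∧ z ∉ (⟨0, r.legs, r.ops⟩ : Raw).labels ∧ z ∉ (⟨0, r.legs, []⟩ : Raw).labels := by
  simp only [Raw.labels, Multiset.mem_add, Multiset.mem_coe, not_or, List.map_nil,
    Multiset.zero_bind, Multiset.notMem_zero, List.not_mem_nil] at h ⊢
  tauto

theorem pre_legIdeal {T : Theory} {z : ℕ} {m : Comb} (d : Raw)
    (hd : z ∉ (⟨d.nodes, d.legs, []⟩ : Raw).labels) (hm : m ∈ legIdeal T z) :
    pre d m ∈ legIdeal T z := by
  suffices legIdeal T z ≤ (legIdeal T z).comap (pre d) from this hm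
  conv_lhs => rw [legIdeal]
  rw [Submodule.span_le]
  rintro _ ⟨P, k, l, x, y, r, hf, hP, hx, hy, hr, rfl⟩
  rw [SetLike.mem_coe, Submodule.mem_comap, pre_pre]
  refine Submodule.subset_span ⟨_, k, l, x, y, r, hf, ?_, hx, hy, hr, rfl⟩
  simp only [Raw.labels, Multiset.mem_add, Multiset.mem_coe, not_or, Multiset.add_bind,
    List.map_append, List.mem_append] at hP hd ⊢
  tauto

theorem pre_opIdeal {m : Comb} (d : Raw) (hm : m ∈ opIdeal) : pre d m ∈ opIdeal := by
  suffices opIdeal ≤ opIdeal.comap (pre d) from this hm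
  conv_lhs => rw [opIdeal]
  rw [Submodule.span_le]
  rintro _ ⟨N, w, p, s, e, f, rfl⟩
  refine Submodule.subset_span ⟨d.nodes + N, d.legs ++ w, p, s, e, f, ?_⟩
  rw [map_sub, map_smul, pre_single, pre_single]
  rfl

theorem koszul_sq (g h : ℕ) : koszul g h * koszul g h = 1 := by
  simp [koszul, ← mul_pow]

theorem koszul_symm (g h : ℕ) : koszul g h = koszul h g := by
  simp [koszul, mul_comm]

theorem pushOp_box (T : Theory) (c : ℚ) (d : Par × ℕ) (k l : Kind) (x y z : ℕ) (m : Comb) :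
    pushOp c d (box T k l x y z m)
      = (koszul d.1.grade k.grade * koszul d.1.grade l.grade) • box T k l x y z (pushOp c d m) := by
  have e1 : ∀ (a b : Kind × ℕ) (m : Comb),
      pre ⟨0, [a, b], []⟩ m = pre ⟨0, [a], []⟩ (pre ⟨0, [b], []⟩ m) := by
    intro a b m; rw [pre_pre]; simp
  have e2 : ∀ (n : Node) (a : Kind × ℕ) (m : Comb),
      pre ⟨{n}, [a], []⟩ m = pre ⟨{n}, [], []⟩ (pre ⟨0, [a], []⟩ m) := by
    intro n a m; rw [pre_pre]; simp
  have e3 : ∀ (n : Node) (a : Kind × ℕ) (m : Comb),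
      pre ⟨0, [a], []⟩ (pre ⟨{n}, [], []⟩ m) = pre ⟨{n}, [], []⟩ (pre ⟨0, [a], []⟩ m) := by
    intro n a m; rw [pre_pre, pre_pre]; simp
  have hfirst : pushOp c d ((pre ⟨0, [(k, x), (l, y)], []⟩
        - koszul k.grade l.grade • pre ⟨0, [(l, y), (k, x)], []⟩) m)
      = (koszul d.1.grade k.grade * koszul d.1.grade l.grade) •
        (pre ⟨0, [(k, x), (l, y)], []⟩
        - koszul k.grade l.grade • pre ⟨0, [(l, y), (k, x)], []⟩) (pushOp c d m) := by
    simp only [LinearMap.sub_apply, LinearMap.smul_apply, map_sub, map_smul, e1, pushOp_pre_leg,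
      map_add, e3]
    have hk : (if k = .par d.1 then c else 0)
        = (if k = .par d.1 then c else 0) * (koszul k.grade l.grade * koszul d.1.grade l.grade) := by
      split_ifs with h
      · subst h; simp [Kind.grade, koszul_sq]
      · simp
    have hl : (if l = .par d.1 then c else 0) * koszul d.1.grade k.grade
        = (if l = .par d.1 then c else 0) * koszul k.grade l.grade := by
      split_ifs with h
      · subst h; simp [Kind.grade, koszul_symm]
      · simp
    generalize (if k = .par d.1 then c else 0) = ck at *
    generalize (if l = .par d.1 then c else 0) = cl at *
    linear_combination (norm := module)
      hk • pre ⟨{.joint d.2 x}, [], []⟩ (pre ⟨0, [(l, y)], []⟩ m)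
      + hl • pre ⟨{.joint d.2 y}, [], []⟩ (pre ⟨0, [(k, x)], []⟩ m)
  have hsecond : pushOp c d (boxCorr T k l x y z m)
      = (koszul d.1.grade k.grade * koszul d.1.grade l.grade) •
        boxCorr T k l x y z (pushOp c d m) := by
    unfold boxCorr
    cases he : T.exch k l with
    | free => simp
    | comm => simp
    | bracket n =>
      obtain ⟨-, -, -, -, -, hn, hg⟩ := exch_bracket he
      simp only [e2, pushOp_pre_nodes, pushOp_pre_leg]
      simp [hn, hg]
    | join =>
      obtain ⟨-, -, -, -, hg⟩ := exch_join he
      simp [pushOp_pre_nodes, hg]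
  rw [box, LinearMap.sub_apply, map_sub, hfirst, hsecond, LinearMap.sub_apply _ (boxCorr T k l x y z), smul_sub]

theorem pushOp_legIdeal {T : Theory} {z : ℕ} {m : Comb} (c : ℚ) (d : Par × ℕ) (hd : z ≠ d.2)
    (hm : m ∈ legIdeal T z) : pushOp c d m ∈ legIdeal T z := by
  suffices legIdeal T z ≤ (legIdeal T z).comap (pushOp c d) from this hm
  conv_lhs => rw [legIdeal]
  rw [Submodule.span_le]
  rintro _ ⟨⟨N, p, q⟩, k, l, x, y, r, hf, hP, hx, hy, hr, rfl⟩
  rw [SetLike.mem_coe, Submodule.mem_comap]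
  obtain ⟨hN, -, -, hp⟩ := not_mem_nodes hP
  have hsplit : ∀ m, pre ⟨N, p, q⟩ m = pre ⟨N, [], []⟩ (pre ⟨0, p, []⟩ m) := by
    intro m
    rw [pre_pre]
    exact LinearMap.congr_fun (pre_congr (by simp) (by simp)) _
  rw [hsplit, pushOp_pre_nodes]
  refine pre_legIdeal _ hN ?_
  clear hsplit hP hN
  have hzero : z ∉ (⟨0, [], []⟩ : Raw).labels := by simp [Raw.labels]
  have hr1 : δ r ∈ lab r.labels := single_mem_lab rfl
  induction p with
  | nil =>
    rw [pre_nil, pushOp_box, ← pre_nil (box _ _ _ _ _ _ _)]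
    refine Submodule.smul_mem _ _ (box_mem hf hzero hx hy ?_ (pushOp_mem_lab c d hr1))
    simp [hd, hr]
  | cons a p ih =>
    have hap : z ≠ a.2 ∧ z ∉ (⟨0, p, []⟩ : Raw).labels := by
      simpa [Raw.labels] using hp
    have e : ∀ m, pre ⟨0, a :: p, []⟩ m = pre ⟨0, [a], []⟩ (pre ⟨0, p, []⟩ m) := by
      intro m; rw [pre_pre]; simp
    have hA : pre ⟨0, p, []⟩ (box T k l x y z (δ r)) ∈ legIdeal T z :=
      box_mem hf hap.2 hx hy hr hr1
    rw [e, pushOp_pre_leg]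
    refine add_mem (Submodule.smul_mem _ _ (pre_legIdeal _ ?_ hA))
      (Submodule.smul_mem _ _ (pre_legIdeal _ ?_ (ih hap.2)))
    · simp [Raw.labels, Node.labels, hd, hap.1]
    · simp [Raw.labels, hap.1]

theorem pushOp_opIdeal {m : Comb} (c : ℚ) (d : Par × ℕ) (hm : m ∈ opIdeal) :
    pushOp c d m ∈ opIdeal := by
  suffices opIdeal ≤ opIdeal.comap (pushOp c d) from this hm
  conv_lhs => rw [opIdeal]
  rw [Submodule.span_le]
  rintro _ ⟨N, w, p, s, e, f, rfl⟩
  rw [SetLike.mem_coe, Submodule.mem_comap, map_sub, map_smul, pushOp_single, pushOp_single,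
    ← map_smul, ← map_sub]
  refine pre_opIdeal _ ?_
  simp only
  induction w with
  | nil => exact Submodule.subset_span ⟨0, [], d :: p, s, e, f, rfl⟩
  | cons a w ih =>
    have h1 : δ ⟨{.joint d.2 a.2}, w, p ++ e :: f :: s⟩
        - koszul e.1.grade f.1.grade • δ ⟨{.joint d.2 a.2}, w, p ++ f :: e :: s⟩ ∈ opIdeal :=
      Submodule.subset_span ⟨_, w, p, s, e, f, rfl⟩
    have h2 := pre_opIdeal ⟨0, [a], []⟩ ih
    have h3 := add_mem (Submodule.smul_mem _ (if a.1 = .par d.1 then c else 0) h1)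
      (Submodule.smul_mem _ (koszul d.1.grade a.1.grade) h2)
    simp only [push]
    convert h3 using 1
    simp only [map_sub, map_smul]
    split_ifs <;> module

theorem pushOp_pushOp (c : ℚ) (d e : Par × ℕ) (m : Comb) :
    pushOp c d (pushOp c e m) - koszul d.1.grade e.1.grade • pushOp c e (pushOp c d m)
      ∈ opIdeal := by
  let F : Comb →ₗ[ℚ] Comb :=
    pushOp c d ∘ₗ pushOp c e - koszul d.1.grade e.1.grade • pushOp c e ∘ₗ pushOp c d
  suffices h : (⊤ : Submodule ℚ Comb) ≤ opIdeal.comap F from h (x := m) trivial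
  have htop : (⊤ : Submodule ℚ Comb) = Submodule.span ℚ (Set.range δ) := by
    rw [← Finsupp.range_linearCombination, eq_comm, LinearMap.range_eq_top]
    intro m
    exact ⟨m, by simp [Finsupp.linearCombination_apply]⟩
  rw [htop, Submodule.span_le]
  rintro _ ⟨⟨N, w, q⟩, rfl⟩
  rw [SetLike.mem_coe, Submodule.mem_comap]
  have h0 : δ (⟨N, w, q⟩ : Raw) = pre ⟨N, [], []⟩ (δ ⟨0, w, q⟩) := by
    rw [pre_single]; simp [Raw.prepend]
  have h1 : F (δ ⟨N, w, q⟩) = pre ⟨N, [], []⟩ (F (δ ⟨0, w, q⟩)) := by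
    simp only [F, LinearMap.sub_apply, LinearMap.smul_apply, LinearMap.comp_apply, h0,
      pushOp_pre_nodes, map_sub, map_smul]
  rw [h1]
  refine pre_opIdeal _ ?_
  clear h0 h1 htop
  induction w with
  | nil =>
    have : ∀ d : Par × ℕ, ∀ q : List (Par × ℕ), pushOp c d (δ ⟨0, [], q⟩) = δ ⟨0, [], d :: q⟩ := by
      intro d q
      rw [pushOp_single, pre_nil, push]
    simp only [F, LinearMap.sub_apply, LinearMap.smul_apply, LinearMap.comp_apply, this]
    exact Submodule.subset_span ⟨0, [], [], q, d, e, rfl⟩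
  | cons a w ih =>
    have h0 : δ (⟨0, a :: w, q⟩ : Raw) = pre ⟨0, [a], []⟩ (δ ⟨0, w, q⟩) := by
      rw [pre_single]; simp [Raw.prepend]
    have e3 : ∀ (n : Node) (a : Kind × ℕ) (m : Comb),
        pre ⟨0, [a], []⟩ (pre ⟨{n}, [], []⟩ m) = pre ⟨{n}, [], []⟩ (pre ⟨0, [a], []⟩ m) := by
      intro n a m; rw [pre_pre, pre_pre]; simp
    have h2 := Submodule.smul_mem _ (koszul d.1.grade a.1.grade * koszul e.1.grade a.1.grade)
      (pre_opIdeal ⟨0, [a], []⟩ ih)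
    convert h2 using 1
    simp only [F, LinearMap.sub_apply, LinearMap.smul_apply, LinearMap.comp_apply, h0,
      pushOp_pre_leg, pushOp_pre_nodes, map_add, map_sub, map_smul]
    have hk : (if a.1 = .par e.1 then c else 0)
        = (if a.1 = .par e.1 then c else 0)
          * (koszul d.1.grade e.1.grade * koszul d.1.grade a.1.grade) := by
      split_ifs with h
      · rw [h]; simp [Kind.grade, koszul_sq]
      · simp
    have hl : (if a.1 = .par d.1 then c else 0) * koszul e.1.grade a.1.grade
        = (if a.1 = .par d.1 then c else 0) * koszul d.1.grade e.1.grade := by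
      split_ifs with h
      · rw [h]; simp [Kind.grade, koszul_symm]
      · simp
    generalize (if a.1 = .par e.1 then c else 0) = ce at *
    generalize (if a.1 = .par d.1 then c else 0) = cd at *
    linear_combination (norm := module)
      hk • pre ⟨{.joint e.2 a.2}, [], []⟩ (pushOp c d (δ ⟨0, w, q⟩))
      + hl • pre ⟨{.joint d.2 a.2}, [], []⟩ (pushOp c e (δ ⟨0, w, q⟩))

theorem pushes_legIdeal {T : Theory} {z : ℕ} (c : ℚ) (p : List (Par × ℕ))
    (hp : z ∉ p.map Prod.snd) {m : Comb} (hm : m ∈ legIdeal T z) :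
    p.foldr (fun e F => pushOp c e ∘ₗ F) LinearMap.id m ∈ legIdeal T z := by
  induction p with
  | nil => simpa using hm
  | cons e p ih =>
    simp only [List.map_cons, List.mem_cons, not_or] at hp
    exact pushOp_legIdeal c e hp.1 (ih hp.2)

theorem pushes_opIdeal (c : ℚ) (p : List (Par × ℕ)) {m : Comb} (hm : m ∈ opIdeal) :
    p.foldr (fun e F => pushOp c e ∘ₗ F) LinearMap.id m ∈ opIdeal := by
  induction p with
  | nil => simpa using hm
  | cons e p ih => exact pushOp_opIdeal c e ih

theorem act_legIdeal {T : Theory} {z : ℕ} (c : ℚ) (d : Raw) (hd : z ∉ d.labels) {m : Comb}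
    (hm : m ∈ legIdeal T z) : act c d m ∈ legIdeal T z := by
  refine pre_legIdeal d (not_mem_nodes hd).2.1 (pushes_legIdeal c d.ops ?_ hm)
  simp only [Raw.labels, Multiset.mem_add, Multiset.mem_coe, not_or] at hd
  exact hd.2

theorem act_opIdeal (c : ℚ) (d : Raw) {m : Comb} (hm : m ∈ opIdeal) : act c d m ∈ opIdeal :=
  pre_opIdeal d (pushes_opIdeal c d.ops hm)

theorem exists_new (L : Multiset ℕ) : ∃ z, z ∉ L := by
  obtain ⟨z, hz⟩ := Infinite.exists_notMem_finset L.toFinset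
  exact ⟨z, by simpa using hz⟩

/-- The relators other than those which come from exchanging legs are treated by renaming edges and
adding internal vertices. -/
theorem cls_ren {T : Theory} (t : ℕ × ℕ) {f : ℕ → ℕ} (hf : Function.Injective f) (m : Comb) :
    cls T t (ren f m) = cls T t m := by
  have h : cls T t ∘ₗ ren f = cls T t := comb_ext fun r => by
    have := cls_relator (T := T) (Relator.relabel r f hf) t
    rw [map_sub, sub_eq_zero] at this
    rw [LinearMap.comp_apply, ren_single, this]
  exact LinearMap.congr_fun h m

theorem cls_smooth {T : Theory} (t : ℕ × ℕ) {x y : ℕ} (hxy : x ≠ y) {L : Multiset ℕ}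
    (hL : L.count y = 1) {m : Comb} (hm : m ∈ lab L) :
    cls T t (pre ⟨{.joint x y}, [], []⟩ m) = cls T t (ren (Function.update id y x) m) := by
  rw [← sub_eq_zero, ← map_sub]
  have h := lab_induction (S := LinearMap.ker (cls T t)) (pre ⟨{.joint x y}, [], []⟩
    - ren (Function.update id y x)) (fun r hr => by
      have := cls_relator (T := T) (Relator.smooth r x y hxy (hr ▸ hL)) t
      rwa [LinearMap.sub_apply, pre_single, ren_single, prepend_node, LinearMap.mem_ker]) hm
  exact h

theorem cls_joint_symm {T : Theory} (t : ℕ × ℕ) (x y : ℕ) (m : Comb) :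
    cls T t (pre ⟨{.joint x y}, [], []⟩ m) = cls T t (pre ⟨{.joint y x}, [], []⟩ m) := by
  have h : cls T t ∘ₗ pre ⟨{.joint x y}, [], []⟩ = cls T t ∘ₗ pre ⟨{.joint y x}, [], []⟩ :=
    comb_ext fun r => by
      have := cls_relator (T := T) (Relator.joint_symm r x y) t
      rw [map_sub, sub_eq_zero] at this
      rw [LinearMap.comp_apply, LinearMap.comp_apply, pre_single, pre_single, prepend_node,
        prepend_node, this]
  exact LinearMap.congr_fun h m

theorem cls_rotate {T : Theory} (t : ℕ × ℕ) (x y z : ℕ) (m : Comb) :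
    cls T t (pre ⟨{.tri x y z}, [], []⟩ m) = cls T t (pre ⟨{.tri y z x}, [], []⟩ m) := by
  have h : cls T t ∘ₗ pre ⟨{.tri x y z}, [], []⟩ = cls T t ∘ₗ pre ⟨{.tri y z x}, [], []⟩ :=
    comb_ext fun r => by
      have := cls_relator (T := T) (Relator.rotate r x y z) t
      rw [map_sub, sub_eq_zero] at this
      rw [LinearMap.comp_apply, LinearMap.comp_apply, pre_single, pre_single, prepend_node,
        prepend_node, this]
  exact LinearMap.congr_fun h m

theorem cls_antisymm {T : Theory} (t : ℕ × ℕ) (x y z : ℕ) (m : Comb) :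
    cls T t (pre ⟨{.tri x y z}, [], []⟩ m) = - cls T t (pre ⟨{.tri y x z}, [], []⟩ m) := by
  have h : cls T t ∘ₗ pre ⟨{.tri x y z}, [], []⟩ = -(cls T t ∘ₗ pre ⟨{.tri y x z}, [], []⟩) :=
    comb_ext fun r => by
      have := cls_relator (T := T) (Relator.antisymm r x y z) t
      rw [map_add, ← eq_neg_iff_add_eq_zero] at this
      rw [LinearMap.neg_apply, LinearMap.comp_apply, LinearMap.comp_apply, pre_single, pre_single,
        prepend_node, prepend_node, this]
  exact LinearMap.congr_fun h m

theorem cls_ihx {T : Theory} (t : ℕ × ℕ) (a b c d x : ℕ) (m : Comb) :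
    cls T t (pre ⟨{.tri a b x, .tri x c d}, [], []⟩ m)
      + cls T t (pre ⟨{.tri b c x, .tri x a d}, [], []⟩ m)
      + cls T t (pre ⟨{.tri c a x, .tri x b d}, [], []⟩ m) = 0 := by
  have h : cls T t ∘ₗ (pre ⟨{.tri a b x, .tri x c d}, [], []⟩
      + pre ⟨{.tri b c x, .tri x a d}, [], []⟩
      + pre ⟨{.tri c a x, .tri x b d}, [], []⟩) = 0 := comb_ext fun r => by
    have := cls_relator (T := T) (Relator.ihx r a b c d x) t
    rw [LinearMap.comp_apply, LinearMap.add_apply, LinearMap.add_apply, pre_single, pre_single,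
      pre_single]
    simp only [Multiset.insert_eq_cons, prepend_node_two]
    rw [this, LinearMap.zero_apply]
  have h' := LinearMap.congr_fun h m
  rw [LinearMap.comp_apply, LinearMap.add_apply, LinearMap.add_apply, map_add, map_add] at h'
  exact h'

theorem relabel_relabel (f g : ℕ → ℕ) (r : Raw) : (r.relabel f).relabel g = r.relabel (g ∘ f) := by
  have : ∀ n : Node, (n.relabel f).relabel g = n.relabel (g ∘ f) := by
    intro n; cases n <;> rfl
  simp [Raw.relabel, Function.comp_def, this, Prod.map]

theorem relabel_add (f : ℕ → ℕ) (n : Node) (r : Raw) :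
    (r.add n).relabel f = (r.relabel f).add (n.relabel f) := by
  simp [Raw.relabel, Raw.add]

/-- Rename the even names by `f` and the odd names by `g`. -/
def mix (f g : ℕ → ℕ) (n : ℕ) : ℕ :=
  if n % 2 = 0 then evenName (f (n / 2)) else oddName (g (n / 2))

theorem mix_even (f g : ℕ → ℕ) : mix f g ∘ evenName = evenName ∘ f := by
  funext n
  simp [mix, evenName]

theorem mix_odd (f g : ℕ → ℕ) : mix f g ∘ oddName = oddName ∘ g := by
  funext n
  have h1 : (2 * n + 1) % 2 = 1 := by omega
  have h2 : (2 * n + 1) / 2 = n := by omega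
  simp [mix, oddName, h1, h2]

theorem evenName_injective : Function.Injective evenName := by
  intro m n h; simp only [evenName] at h; omega

theorem oddName_injective : Function.Injective oddName := by
  intro m n h; simp only [oddName] at h; omega

theorem mix_injective {f g : ℕ → ℕ} (hf : Function.Injective f) (hg : Function.Injective g) :
    Function.Injective (mix f g) := by
  intro m n h
  simp only [mix, evenName, oddName] at h
  split_ifs at h with h1 h2 h2
  · have := hf (show f (m / 2) = f (n / 2) by omega); omega
  · omega
  · omega
  · have := hg (show g (m / 2) = g (n / 2) by omega); omega

theorem mix_update_odd (x y : ℕ) :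
    Function.update id (oddName y) (oddName x) = mix id (Function.update id y x) := by
  funext n
  by_cases h : n = oddName y
  · subst h
    have := congrFun (mix_odd id (Function.update id y x)) y
    simp only [Function.comp_apply] at this
    simp [this]
  · rw [Function.update_of_ne h]
    simp only [mix, id, evenName, oddName] at h ⊢
    split_ifs with h1
    · omega
    · rw [Function.update_of_ne (by omega)]; simp only [id]; omega

theorem mix_update_even (x y : ℕ) :
    Function.update id (evenName y) (evenName x) = mix (Function.update id y x) id := by
  funext n
  by_cases h : n = evenName y
  · subst h
    have := congrFun (mix_even (Function.update id y x) id) y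
    simp only [Function.comp_apply] at this
    simp [this]
  · rw [Function.update_of_ne h]
    simp only [mix, id, evenName, oddName] at h ⊢
    split_ifs with h1
    · rw [Function.update_of_ne (by omega)]; simp only [id]; omega
    · omega

theorem leg_comm_mem {T : Theory} {N : Multiset Node} {p s : List (Kind × ℕ)}
    {q : List (Par × ℕ)} {k l : Kind} {x y : ℕ} (h : T.exch k l = .comm) :
    ∃ z, δ ⟨N, p ++ (k, x) :: (l, y) :: s, q⟩
        - koszul k.grade l.grade • δ ⟨N, p ++ (l, y) :: (k, x) :: s, q⟩ ∈ legIdeal T z := by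
  obtain ⟨z, hz⟩ := exists_new (⟨N, p ++ (k, x) :: (l, y) :: s, q⟩ : Raw).labels
  simp only [Raw.labels, Multiset.mem_add, Multiset.mem_coe, not_or, List.map_append,
    List.map_cons, List.mem_append, List.mem_cons] at hz
  refine ⟨z, Submodule.subset_span ⟨⟨N, p, []⟩, k, l, x, y, ⟨0, s, q⟩, by simp [h], ?_, by tauto,
    by tauto, ?_, ?_⟩⟩
  · simp [Raw.labels] at hz ⊢; tauto
  · simp [Raw.labels] at hz ⊢; tauto
  · simp [-Finsupp.smul_single, box, boxCorr, h, pre_single, Raw.prepend]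

theorem leg_bracket_mem {T : Theory} {N : Multiset Node} {p s : List (Kind × ℕ)}
    {q : List (Par × ℕ)} {k l m : Kind} {x y z : ℕ} (h : T.exch k l = .bracket m)
    (hz : z ∉ (⟨N, p ++ (k, x) :: (l, y) :: s, q⟩ : Raw).labels) :
    δ ⟨N, p ++ (k, x) :: (l, y) :: s, q⟩
        - koszul k.grade l.grade • δ ⟨N, p ++ (l, y) :: (k, x) :: s, q⟩
        - δ ⟨.tri x z y ::ₘ N, p ++ (m, z) :: s, q⟩ ∈ legIdeal T z := by
  simp only [Raw.labels, Multiset.mem_add, Multiset.mem_coe, not_or, List.map_append,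
    List.map_cons, List.mem_append, List.mem_cons] at hz
  refine Submodule.subset_span ⟨⟨N, p, []⟩, k, l, x, y, ⟨0, s, q⟩, by simp [h], ?_, by tauto,
    by tauto, ?_, ?_⟩
  · simp [Raw.labels] at hz ⊢; tauto
  · simp [Raw.labels] at hz ⊢; tauto
  · simp [-Finsupp.smul_single, box, boxCorr, h, pre_single, Raw.prepend, add_comm N]

theorem leg_join_mem {T : Theory} {N : Multiset Node} {p s : List (Kind × ℕ)}
    {q : List (Par × ℕ)} {k l : Kind} {x y : ℕ} (h : T.exch k l = .join) :
    ∃ z, δ ⟨N, p ++ (k, x) :: (l, y) :: s, q⟩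
        - koszul k.grade l.grade • δ ⟨N, p ++ (l, y) :: (k, x) :: s, q⟩
        - δ ⟨.joint x y ::ₘ N, p ++ s, q⟩ ∈ legIdeal T z := by
  obtain ⟨z, hz⟩ := exists_new (⟨N, p ++ (k, x) :: (l, y) :: s, q⟩ : Raw).labels
  simp only [Raw.labels, Multiset.mem_add, Multiset.mem_coe, not_or, List.map_append,
    List.map_cons, List.mem_append, List.mem_cons] at hz
  refine ⟨z, Submodule.subset_span ⟨⟨N, p, []⟩, k, l, x, y, ⟨0, s, q⟩, by simp [h], ?_, by tauto,
    by tauto, ?_, ?_⟩⟩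
  · simp [Raw.labels] at hz ⊢; tauto
  · simp [Raw.labels] at hz ⊢; tauto
  · simp [-Finsupp.smul_single, box, boxCorr, h, pre_single, Raw.prepend, add_comm N]

theorem ren_legIdeal {T : Theory} {z : ℕ} {f : ℕ → ℕ} (hf : Function.Injective f) {m : Comb}
    (hm : m ∈ legIdeal T z) : ren f m ∈ legIdeal T (f z) := by
  suffices legIdeal T z ≤ (legIdeal T (f z)).comap (ren f) from this hm
  conv_lhs => rw [legIdeal]
  rw [Submodule.span_le]
  rintro _ ⟨P, k, l, x, y, r, hne, hP, hx, hy, hr, rfl⟩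
  have hl : ∀ r : Raw, z ∉ r.labels → f z ∉ (r.relabel f).labels := by
    intro r hr
    rw [Raw.labels_relabel, Multiset.mem_map]
    rintro ⟨w, hw, he⟩
    exact hr (hf he ▸ hw)
  refine Submodule.subset_span ⟨P.relabel f, k, l, f x, f y, r.relabel f, hne, hl _ hP,
    hf.ne hx, hf.ne hy, hl _ hr, ?_⟩
  rw [ren_pre]
  congr 1
  simp only [box, LinearMap.sub_apply, LinearMap.smul_apply, map_sub, map_smul, ren_pre,
    ren_single]
  congr 1
  unfold boxCorr
  split
  · rw [ren_pre, ren_single]; simp [Raw.relabel, Node.relabel]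
  · rw [ren_pre, ren_single]; simp [Raw.relabel, Node.relabel]
  · simp

theorem ren_opIdeal (f : ℕ → ℕ) {m : Comb} (hm : m ∈ opIdeal) : ren f m ∈ opIdeal := by
  suffices opIdeal ≤ opIdeal.comap (ren f) from this hm
  conv_lhs => rw [opIdeal]
  rw [Submodule.span_le]
  rintro _ ⟨N, w, p, s, e, g, rfl⟩
  refine Submodule.subset_span ⟨N.map (Node.relabel f), w.map (Prod.map id f),
    p.map (Prod.map id f), s.map (Prod.map id f), Prod.map id f e, Prod.map id f g, ?_⟩
  rw [map_sub, map_smul, ren_single, ren_single]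
  simp [-Finsupp.smul_single, Raw.relabel]

theorem odd_notMem_even (r : Raw) (z : ℕ) : oddName z ∉ (r.relabel evenName).labels := by
  rw [Raw.labels_relabel, Multiset.mem_map]
  rintro ⟨w, -, he⟩
  simp only [evenName, oddName] at he
  omega

theorem even_notMem_odd (r : Raw) (z : ℕ) : evenName z ∉ (r.relabel oddName).labels := by
  rw [Raw.labels_relabel, Multiset.mem_map]
  rintro ⟨w, -, he⟩
  simp only [evenName, oddName] at he
  omega

theorem cls_act_right {T : Theory} (t : ℕ × ℕ) (c : ℚ) (d : Raw) {ρ : Comb} (h : Relator T ρ) :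
    cls T t (act c (d.relabel evenName) (ren oddName ρ)) = 0 := by
  have hadd : ∀ (n : Node) (m : Comb), act c (d.relabel evenName) (ren oddName (pre ⟨{n}, [], []⟩ m))
      = pre ⟨{n.relabel oddName}, [], []⟩ (act c (d.relabel evenName) (ren oddName m)) := by
    intro n m
    rw [ren_pre, ← act_pre_nodes]
    simp [Raw.relabel]
  have hmix : ∀ (r : Raw) (f : ℕ → ℕ), act c (d.relabel evenName) (ren oddName (δ (r.relabel f)))
      = ren (mix id f) (act c (d.relabel evenName) (ren oddName (δ r))) := by
    intro r f
    rw [ren_act, ren_single, ren_single, ren_single, relabel_relabel, relabel_relabel,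
      relabel_relabel, mix_even, mix_odd]
    rfl
  have hleg : ∀ z, ρ ∈ legIdeal T z →
      cls T t (act c (d.relabel evenName) (ren oddName ρ)) = 0 := fun z hz =>
    cls_legIdeal (act_legIdeal c _ (odd_notMem_even d z) (ren_legIdeal oddName_injective hz)) t
  cases h with
  | relabel r f hf =>
    rw [map_sub, map_sub, map_sub, hmix, cls_ren t (mix_injective Function.injective_id hf),
      sub_self]
  | joint_symm r x y =>
    simp only [← prepend_node, ← pre_single, map_sub, hadd, Node.relabel]
    rw [cls_joint_symm, sub_self]
  | smooth r x y hxy hy =>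
    simp only [← prepend_node, ← pre_single, map_sub, hadd, Node.relabel, hmix]
    rw [← mix_update_odd, ren_single, sub_eq_zero]
    refine cls_smooth t (oddName_injective.ne hxy) ?_
      (act_mem_lab c _ (single_mem_lab rfl))
    rw [Multiset.count_add, Multiset.count_eq_zero_of_notMem (odd_notMem_even d y),
      Raw.labels_relabel, Multiset.count_map_eq_count' _ _ oddName_injective, hy]
  | rotate r x y z =>
    simp only [← prepend_node, ← pre_single, map_sub, hadd, Node.relabel]
    rw [cls_rotate, sub_self]
  | antisymm r x y z =>
    simp only [← prepend_node, ← pre_single, map_add, hadd, Node.relabel]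
    rw [cls_antisymm, neg_add_cancel]
  | ihx r a b c d x =>
    simp only [← prepend_node, ← pre_single, map_add, hadd, Node.relabel]
    simp only [pre_pre]
    exact cls_ihx t _ _ _ _ _ _
  | ops N w p s d' e =>
    exact cls_opIdeal (act_opIdeal c _ (ren_opIdeal _ (Submodule.subset_span
      ⟨N, w, p, s, d', e, rfl⟩))) t
  | comm N p s q k l x y h =>
    obtain ⟨z, hz⟩ := leg_comm_mem (N := N) (p := p) (s := s) (q := q) (x := x) (y := y) h
    exact hleg z hz
  | bracket N p s q k l m x y z h hz => exact hleg z (leg_bracket_mem h hz)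
  | join N p s q k l x y h =>
    obtain ⟨z, hz⟩ := leg_join_mem (N := N) (p := p) (s := s) (q := q) (x := x) (y := y) h
    exact hleg z hz

/-- `act` as a linear function of its first argument. -/
def actOn (c : ℚ) (m : Comb) : Comb →ₗ[ℚ] Comb := Finsupp.linearCombination ℚ fun d => act c d m

theorem actOn_single (c : ℚ) (m : Comb) (d : Raw) : actOn c m (δ d) = act c d m := by
  simp [actOn, Finsupp.linearCombination_single]

theorem actOn_pre (c : ℚ) (m : Comb) (P : Raw) (x : Comb) :
    actOn c m (pre P x) = pre P (actOn c m x) := by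
  refine comb_congr (actOn c m ∘ₗ pre P) (pre P ∘ₗ actOn c m) (fun r => ?_) x
  simp only [LinearMap.comp_apply, pre_single, actOn_single, act, pre_pre]
  exact LinearMap.congr_fun (pre_congr rfl rfl) _

theorem actOn_legIdeal {T : Theory} {z : ℕ} (c : ℚ) {L : Multiset ℕ} {m ρ : Comb}
    (hm : m ∈ lab L) (hL : z ∉ L) (hρ : ρ ∈ legIdeal T z) : actOn c m ρ ∈ legIdeal T z := by
  suffices legIdeal T z ≤ (legIdeal T z).comap (actOn c m) from this hρ
  conv_lhs => rw [legIdeal]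
  rw [Submodule.span_le]
  rintro _ ⟨P, k, l, x, y, r, hf, hP, hx, hy, hr, rfl⟩
  have hb : actOn c m (box T k l x y z (δ r)) = box T k l x y z (actOn c m (δ r)) := by
    unfold box boxCorr
    split <;> simp only [LinearMap.sub_apply, LinearMap.smul_apply, map_sub, map_smul, actOn_pre,
      LinearMap.zero_apply, map_zero]
  rw [SetLike.mem_coe, Submodule.mem_comap, actOn_pre, hb, actOn_single]
  refine box_mem hf hP hx hy ?_ (act_mem_lab c r hm)
  simp [hr, hL]

theorem actOn_opIdeal (c : ℚ) (m : Comb) {ρ : Comb} (hρ : ρ ∈ opIdeal) :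
    actOn c m ρ ∈ opIdeal := by
  suffices opIdeal ≤ opIdeal.comap (actOn c m) from this hρ
  conv_lhs => rw [opIdeal]
  rw [Submodule.span_le]
  rintro _ ⟨N, w, p, s, d, e, rfl⟩
  rw [SetLike.mem_coe, Submodule.mem_comap, map_sub, map_smul, actOn_single, actOn_single]
  have h := pre_opIdeal ⟨N, w, []⟩ (pushes_opIdeal c p (pushOp_pushOp c d e
    (s.foldr (fun e F => pushOp c e ∘ₗ F) LinearMap.id m)))
  rw [map_sub, map_smul, map_sub, map_smul] at h
  convert h using 2
  · simp only [act, LinearMap.comp_apply, List.foldr_append, List.foldr_cons]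
    rw [foldr_comp]
    exact LinearMap.congr_fun (pre_congr rfl rfl) _
  · congr 1
    simp only [act, LinearMap.comp_apply, List.foldr_append, List.foldr_cons]
    rw [foldr_comp]
    exact LinearMap.congr_fun (pre_congr rfl rfl) _

theorem cls_act_left {T : Theory} (t : ℕ × ℕ) (c : ℚ) (e : Raw) {ρ : Comb} (h : Relator T ρ) :
    cls T t (actOn c (δ (e.relabel oddName)) (ren evenName ρ)) = 0 := by
  set m : Comb := δ (e.relabel oddName) with hm
  have hlab : m ∈ lab (e.relabel oddName).labels := single_mem_lab rfl
  have hadd : ∀ (n : Node) (x : Comb), actOn c m (ren evenName (pre ⟨{n}, [], []⟩ x))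
      = pre ⟨{n.relabel evenName}, [], []⟩ (actOn c m (ren evenName x)) := by
    intro n x
    rw [ren_pre, actOn_pre]
    simp [Raw.relabel]
  have hmix : ∀ (r : Raw) (f : ℕ → ℕ), actOn c m (ren evenName (δ (r.relabel f)))
      = ren (mix f id) (actOn c m (ren evenName (δ r))) := by
    intro r f
    rw [ren_single, ren_single, actOn_single, actOn_single, ren_act, hm, ren_single,
      relabel_relabel, relabel_relabel, relabel_relabel, mix_even, mix_odd]
    rfl
  have hleg : ∀ z, ρ ∈ legIdeal T z → cls T t (actOn c m (ren evenName ρ)) = 0 := fun z hz =>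
    cls_legIdeal (actOn_legIdeal c hlab (even_notMem_odd e z)
      (ren_legIdeal evenName_injective hz)) t
  cases h with
  | relabel r f hf =>
    rw [map_sub, map_sub, map_sub, hmix, cls_ren t (mix_injective hf Function.injective_id),
      sub_self]
  | joint_symm r x y =>
    simp only [← prepend_node, ← pre_single, map_sub, hadd, Node.relabel]
    rw [cls_joint_symm, sub_self]
  | smooth r x y hxy hy =>
    simp only [← prepend_node, ← pre_single, map_sub, hadd, Node.relabel, hmix]
    rw [← mix_update_even, ren_single, actOn_single, sub_eq_zero]
    refine cls_smooth t (evenName_injective.ne hxy) ?_ (act_mem_lab c _ hlab)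
    rw [Multiset.count_add, Multiset.count_eq_zero_of_notMem (even_notMem_odd e y),
      Raw.labels_relabel, Multiset.count_map_eq_count' _ _ evenName_injective, hy]
  | rotate r x y z =>
    simp only [← prepend_node, ← pre_single, map_sub, hadd, Node.relabel]
    rw [cls_rotate, sub_self]
  | antisymm r x y z =>
    simp only [← prepend_node, ← pre_single, map_add, hadd, Node.relabel]
    rw [cls_antisymm, neg_add_cancel]
  | ihx r a b c d x =>
    simp only [← prepend_node, ← pre_single, map_add, hadd, Node.relabel]
    simp only [pre_pre]
    exact cls_ihx t _ _ _ _ _ _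
  | ops N w p s d' e =>
    exact cls_opIdeal (actOn_opIdeal c _ (ren_opIdeal _ (Submodule.subset_span
      ⟨N, w, p, s, d', e, rfl⟩))) t
  | comm N p s q k l x y h =>
    obtain ⟨z, hz⟩ := leg_comm_mem (N := N) (p := p) (s := s) (q := q) (x := x) (y := y) h
    exact hleg z hz
  | bracket N p s q k l m x y z h hz => exact hleg z (leg_bracket_mem h hz)
  | join N p s q k l x y h =>
    obtain ⟨z, hz⟩ := leg_join_mem (N := N) (p := p) (s := s) (q := q) (x := x) (y := y) h
    exact hleg z hz

theorem lift_cls {T : Theory} {M : Type} [AddCommGroup M] [Module ℚ M] (t : ℕ × ℕ)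
    (g : Comb →ₗ[ℚ] M) (hg : ∀ ρ, Relator T ρ → g ρ = 0) (r : diagrams t) :
    lift t g hg (Submodule.Quotient.mk (Finsupp.single r 1)) = g (δ r.1) := by
  simp [lift, Submodule.liftQ_apply, Finsupp.lmapDomain_apply, Finsupp.mapDomain_single]

theorem space_ext {T : Theory} {t : ℕ × ℕ} {M : Type} [AddCommGroup M] [Module ℚ M]
    {f g : Space T t →ₗ[ℚ] M}
    (h : ∀ r : diagrams t, f (Submodule.Quotient.mk (Finsupp.single r 1))
      = g (Submodule.Quotient.mk (Finsupp.single r 1))) : f = g := by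
  refine Submodule.linearMap_qext _ (Finsupp.lhom_ext' fun r => LinearMap.ext_ring ?_)
  exact h r

theorem operateLeft_relator (T : Theory) (c : ℚ) (t : ℕ × ℕ) (d : Raw) (ρ : Comb)
    (h : Relator T ρ) :
    (Finsupp.linearCombination ℚ fun e => cls T t (operate c d e)) ρ = 0 := by
  rw [← cls_act_right t c d h]
  refine comb_congr _ (cls T t ∘ₗ act c (d.relabel evenName) ∘ₗ ren oddName) (fun r => ?_) ρ
  simp only [Finsupp.linearCombination_single, one_smul, LinearMap.comp_apply, ren_single]
  rfl

/-- For a diagram `d`, the map which sends a diagram `e` of type `t₂` to the type `t` part of the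
result of operating with `d` on `e`. -/
def operateLeft (T : Theory) (c : ℚ) (t₂ t : ℕ × ℕ) (d : Raw) : Space T t₂ →ₗ[ℚ] Space T t :=
  lift t₂ (Finsupp.linearCombination ℚ fun e => cls T t (operate c d e))
    (operateLeft_relator T c t d)

theorem operateBilin_relator (T : Theory) (c : ℚ) (t₂ t : ℕ × ℕ) (ρ : Comb)
    (h : Relator T ρ) : Finsupp.linearCombination ℚ (operateLeft T c t₂ t) ρ = 0 := by
  refine space_ext fun e => ?_
  rw [LinearMap.zero_apply, ← cls_act_left t c e.1 h]
  refine comb_congr (LinearMap.applyₗ (Submodule.Quotient.mk (Finsupp.single e 1)) ∘ₗ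
    Finsupp.linearCombination ℚ (operateLeft T c t₂ t))
    (cls T t ∘ₗ actOn c (δ (e.1.relabel oddName)) ∘ₗ ren evenName) (fun r => ?_) ρ
  simp only [LinearMap.comp_apply, Finsupp.linearCombination_single, one_smul,
    LinearMap.applyₗ_apply_apply, operateLeft, lift_cls, ren_single, actOn_single]
  rfl

/-- The bilinear map which sends a diagram `d` of type `t₁` and a diagram `e` of type `t₂` to the
type `t` part of the result of operating with `d` on `e`. -/
def operateBilin (T : Theory) (c : ℚ) (t₁ t₂ t : ℕ × ℕ) :
    Space T t₁ →ₗ[ℚ] Space T t₂ →ₗ[ℚ] Space T t :=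
  lift t₁ (Finsupp.linearCombination ℚ (operateLeft T c t₂ t)) (operateBilin_relator T c t₂ t)

/-! ### Formal power series of diagrams -/

/-- Formal power series of operator Weil diagrams: one vector for each type. -/
abbrev Series (T : Theory) : Type := ∀ t : ℕ × ℕ, Space T t

/-- The type `t` part of `v ⊢ w`, for `v` and `w` homogeneous. -/
def operateOn (T : Theory) (t₁ t₂ t : ℕ × ℕ) (v : Space T t₁) (w : Space T t₂) : Space T t :=
  operateBilin T 1 t₁ t₂ t v w

/-- The product `v ⊢ w` is convergent. -/
def Converges {T : Theory} (v w : Series T) : Prop :=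
  ∀ t : ℕ × ℕ, {p : (ℕ × ℕ) × (ℕ × ℕ) | operateOn T p.1 p.2 t (v p.1) (w p.2) ≠ 0}.Finite

/-- The product `v ⊢ w`, meaningful if it is convergent. -/
def vdash {T : Theory} (v w : Series T) : Series T := fun t =>
  ∑ᶠ p : (ℕ × ℕ) × (ℕ × ℕ), operateOn T p.1 p.2 t (v p.1) (w p.2)

/-- The juxtaposition product `v # w`: the diagrams are placed next to each other, and operator
legs are moved to the far right without operating on anything.  Types add up. -/
def hash {T : Theory} (v w : Series T) : Series T := fun t =>
  ∑ i ∈ Finset.HasAntidiagonal.antidiagonal t.1, ∑ j ∈ Finset.HasAntidiagonal.antidiagonal t.2,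
    operateBilin T 0 (i.1, j.1) (i.2, j.2) t (v (i.1, j.1)) (w (i.2, j.2))

/-- The power series with a single diagram. -/
def diagram (T : Theory) (r : Raw) : Series T := fun t => cls T t (δ r)

def hashPow {T : Theory} (v : Series T) : ℕ → Series T
  | 0 => diagram T ⟨0, [], []⟩
  | n + 1 => hash (hashPow v n) v

/-- The series `exp_# v` is well defined: every type occurs in finitely many powers only. -/
def ExpConverges {T : Theory} (v : Series T) : Prop :=
  ∀ t : ℕ × ℕ, {n : ℕ | hashPow v n t ≠ 0}.Finite

/-- The exponential for the juxtaposition product. -/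
def expHash {T : Theory} (v : Series T) : Series T := fun t =>
  ∑ᶠ n : ℕ, (1 / (n.factorial : ℚ)) • hashPow v n t

/-- `[·]` with all parameters set to zero: the type `(0, 0)` part of a power series. -/
def setZero {T : Theory} (v : Series T) : Space T (0, 0) := v (0, 0)

/-! ### The spaces of Weil diagrams -/

/-- The space `𝒲` of symmetric Weil diagrams. -/
abbrev W : Type := Space .sym (0, 0)

/-- The space `𝒲~` of non-commutative Weil diagrams. -/
abbrev WTilde : Type := Space .tilde (0, 0)

/-- The space `𝒲^`. -/
abbrev WHat : Type := Space .hat (0, 0)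

/-- The space `𝒲^_F`, with curvature legs. -/
abbrev WHatF : Type := Space .hatF (0, 0)

/-! ### Maps which turn diagrams into combinations of diagrams -/

theorem cls_smooth' {T : Theory} (t : ℕ × ℕ) {x y : ℕ} (hxy : x ≠ y) {m : Comb}
    (hm : m ∈ Finsupp.supported ℚ ℚ {r : Raw | r.labels.count y = 1}) :
    cls T t (pre ⟨{.joint x y}, [], []⟩ m) = cls T t (ren (Function.update id y x) m) := by
  rw [← sub_eq_zero, ← map_sub]
  rw [Finsupp.supported_eq_span_single] at hm
  have : Submodule.span ℚ ((fun i => Finsupp.single i (1 : ℚ)) '' {r : Raw | r.labels.count y = 1})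
      ≤ (LinearMap.ker (cls T t)).comap
        (pre ⟨{.joint x y}, [], []⟩ - ren (Function.update id y x)) := by
    rw [Submodule.span_le]
    rintro _ ⟨r, hr, rfl⟩
    have := cls_relator (T := T) (Relator.smooth r x y hxy hr) t
    rw [SetLike.mem_coe, Submodule.mem_comap]
    rwa [LinearMap.sub_apply, pre_single, ren_single, prepend_node, LinearMap.mem_ker]
  exact this hm

/-- Helper fact: a criterion for a map to respect the relations. -/
theorem descend {T T' : Theory} (t : ℕ × ℕ) (G : Comb →ₗ[ℚ] Comb) (e : ℕ → ℕ)
    (he : Function.Injective e) (ext : (ℕ → ℕ) → (ℕ → ℕ))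
    (hext : ∀ f, Function.Injective f → Function.Injective (ext f))
    (hupd : ∀ x y, ext (Function.update id y x) = Function.update id (e y) (e x))
    (hren : ∀ r f, G (δ (Raw.relabel f r)) = ren (ext f) (G (δ r)))
    (hadd : ∀ r n, G (δ (Raw.add n r)) = pre ⟨{n.relabel e}, [], []⟩ (G (δ r)))
    (hlab : ∀ (r : Raw) (y : ℕ), G (δ r)
      ∈ Finsupp.supported ℚ ℚ {r' : Raw | r'.labels.count (e y) = r.labels.count y})
    (hops : ∀ (N : Multiset Node) (w : List (Kind × ℕ)) (p s : List (Par × ℕ)) (d e : Par × ℕ),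
      cls T' t (G (δ ⟨N, w, p ++ d :: e :: s⟩
        - koszul d.1.grade e.1.grade • δ ⟨N, w, p ++ e :: d :: s⟩)) = 0)
    (hcomm : ∀ (N : Multiset Node) (p s : List (Kind × ℕ)) (q : List (Par × ℕ)) (k l : Kind)
      (x y : ℕ), T.exch k l = .comm → cls T' t (G (δ ⟨N, p ++ (k, x) :: (l, y) :: s, q⟩
        - koszul k.grade l.grade • δ ⟨N, p ++ (l, y) :: (k, x) :: s, q⟩)) = 0)
    (hbracket : ∀ (N : Multiset Node) (p s : List (Kind × ℕ)) (q : List (Par × ℕ)) (k l m : Kind)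
      (x y z : ℕ), T.exch k l = .bracket m →
      z ∉ (⟨N, p ++ (k, x) :: (l, y) :: s, q⟩ : Raw).labels →
      cls T' t (G (δ ⟨N, p ++ (k, x) :: (l, y) :: s, q⟩
        - koszul k.grade l.grade • δ ⟨N, p ++ (l, y) :: (k, x) :: s, q⟩
        - δ ⟨.tri x z y ::ₘ N, p ++ (m, z) :: s, q⟩)) = 0)
    (hjoin : ∀ (N : Multiset Node) (p s : List (Kind × ℕ)) (q : List (Par × ℕ)) (k l : Kind)
      (x y : ℕ), T.exch k l = .join → cls T' t (G (δ ⟨N, p ++ (k, x) :: (l, y) :: s, q⟩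
        - koszul k.grade l.grade • δ ⟨N, p ++ (l, y) :: (k, x) :: s, q⟩
        - δ ⟨.joint x y ::ₘ N, p ++ s, q⟩)) = 0)
    (ρ : Comb) (h : Relator T ρ) : (cls T' t ∘ₗ G) ρ = 0 := by
  rw [LinearMap.comp_apply]
  cases h with
  | relabel r f hf => rw [map_sub, map_sub, hren, cls_ren t (hext f hf), sub_self]
  | joint_symm r x y =>
    rw [map_sub, map_sub, hadd, hadd, Node.relabel, Node.relabel, cls_joint_symm, sub_self]
  | smooth r x y hxy hy =>
    rw [map_sub, map_sub, hadd, hren, hupd, Node.relabel, sub_eq_zero]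
    exact cls_smooth' t (he.ne hxy) (hy ▸ hlab r y)
  | rotate r x y z =>
    rw [map_sub, map_sub, hadd, hadd, Node.relabel, Node.relabel, cls_rotate, sub_self]
  | antisymm r x y z =>
    rw [map_add, map_add, hadd, hadd, Node.relabel, Node.relabel, cls_antisymm, neg_add_cancel]
  | ihx r a b c d x =>
    simp only [map_add, hadd, Node.relabel, pre_pre]
    exact cls_ihx t _ _ _ _ _ _
  | ops N w p s d' e => exact hops N w p s d' e
  | comm N p s q k l x y h => exact hcomm N p s q k l x y h
  | bracket N p s q k l m x y z h hz => exact hbracket N p s q k l m x y z h hz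
  | join N p s q k l x y h => exact hjoin N p s q k l x y h

/-! ### The map `π` -/

theorem quotientMap_relator (t : ℕ × ℕ) (ρ : Comb) (h : Relator .tilde ρ) : cls .hat t ρ = 0 := by
  refine descend (T := .tilde) t LinearMap.id id Function.injective_id id (fun _ h => h)
    (fun _ _ => rfl) (fun r f => ?_) (fun r n => ?_) (fun r y => ?_) ?_ ?_ ?_ ?_ ρ h
  · simp [ren_single]
  · have : n.relabel id = n := by cases n <;> rfl
    simp [pre_single, prepend_node, this]
  · exact Finsupp.single_mem_supported _ _ rfl
  · intro N w p s d e
    exact cls_relator (Relator.ops N w p s d e) t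
  · intro N p s q k l x y h
    refine cls_relator (Relator.comm N p s q k l x y ?_) t
    revert h
    cases k <;> cases l <;> simp [Theory.exch]
  · intro N p s q k l m x y z h
    revert h
    cases k <;> cases l <;> simp [Theory.exch]
  · intro N p s q k l x y h
    revert h
    cases k <;> cases l <;> simp [Theory.exch]

/-- The map `π : 𝒲~ → 𝒲^`, which has no effect on a diagram. -/
def quotientMap : WTilde →ₗ[ℚ] WHat := lift (0, 0) (cls .hat (0, 0)) (quotientMap_relator (0, 0))

/-! ### Turning a diagram into an operator diagram -/

/-- The label of the operator leg which replaces an ordinary leg.  (Diagrams in `𝒲` have no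
parameter legs.) -/
def Kind.toPar : Kind → Par
  | .two => .a
  | .one => .b
  | .par p => p

/-- Replace the legs of grade 2 by legs labelled `∂_a` and the legs of grade 1 by legs labelled
`∂_b`.  (Diagrams in `𝒲` have no operator legs to begin with.) -/
def toOperator (r : Raw) : Raw :=
  ⟨r.nodes, [], r.legs.map (fun l => (l.1.toPar, l.2)) ++ r.ops⟩

theorem toPar_grade (k : Kind) : k.toPar.grade = k.grade := by
  cases k <;> rfl

theorem intoOp_relator (T : Theory) (t : ℕ × ℕ) (ρ : Comb) (h : Relator .sym ρ) :
    (cls T t ∘ₗ Finsupp.lmapDomain ℚ ℚ toOperator) ρ = 0 := by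
  have hs : ∀ r, Finsupp.lmapDomain ℚ ℚ toOperator (δ r) = δ (toOperator r) := by
    intro r; simp [Finsupp.lmapDomain_apply, Finsupp.mapDomain_single]
  refine descend (T := .sym) t _ id Function.injective_id id (fun _ h => h)
    (fun _ _ => rfl) (fun r f => ?_) (fun r n => ?_) (fun r y => ?_) ?_ ?_ ?_ ?_ ρ h
  · rw [hs, hs, ren_single]; simp [toOperator, Raw.relabel, Function.comp_def, Prod.map]
  · have : n.relabel id = n := by cases n <;> rfl
    rw [hs, hs, pre_single, this]; simp [toOperator, Raw.prepend, Raw.add]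
  · rw [hs]
    refine Finsupp.single_mem_supported _ _ ?_
    simp [toOperator, Raw.labels, Function.comp_def, add_assoc]
  · intro N w p s d e
    rw [map_sub, map_smul, hs, hs]
    have := cls_relator (T := T) (Relator.ops N [] (w.map (fun l => (l.1.toPar, l.2)) ++ p) s d e) t
    simpa only [toOperator, List.append_assoc] using this
  · intro N p s q k l x y h
    rw [map_sub, map_smul, hs, hs]
    have := cls_relator (T := T) (Relator.ops N [] (p.map (fun l => (l.1.toPar, l.2)))
      (s.map (fun l => (l.1.toPar, l.2)) ++ q) (k.toPar, x) (l.toPar, y)) t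
    simpa only [toOperator, List.append_assoc, List.map_append, List.map_cons, List.cons_append,
      toPar_grade] using this
  · intro N p s q k l m x y z h
    revert h
    cases k <;> cases l <;> simp [Theory.exch]
  · intro N p s q k l x y h
    revert h
    cases k <;> cases l <;> simp [Theory.exch]

/-- The map which turns a symmetric Weil diagram into an operator diagram. -/
def intoOp (T : Theory) : W →ₗ[ℚ] Series T :=
  LinearMap.pi fun t => lift (0, 0) (cls T t ∘ₗ Finsupp.lmapDomain ℚ ℚ toOperator)
    (intoOp_relator T t)

/-! ### The graded averaging map -/

/-- The sign which arises when legs of grades `g` are rearranged, the leg in position `i` of the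
new arrangement being the old leg `σ i`. -/
def koszulSign {n : ℕ} (g : Fin n → ℕ) (σ : Equiv.Perm (Fin n)) : ℚ :=
  ∏ i, ∏ j, if i < j ∧ σ j < σ i then koszul (g (σ i)) (g (σ j)) else 1

/-- The average of the diagrams obtained by rearranging the legs `f`, with signs. -/
def averageWord (N : Multiset Node) (q : List (Par × ℕ)) {n : ℕ} (f : Fin n → Kind × ℕ) : Comb :=
  (1 / (n.factorial : ℚ)) • ∑ σ : Equiv.Perm (Fin n),
    koszulSign (fun i => (f i).1.grade) σ • δ ⟨N, List.ofFn (fun i => f (σ i)), q⟩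

def average (r : Raw) : Comb := averageWord r.nodes r.ops r.legs.get

theorem average_ofFn (N : Multiset Node) (q : List (Par × ℕ)) {n : ℕ} (f : Fin n → Kind × ℕ)
    (w : List (Kind × ℕ)) (h : List.ofFn f = w) : average ⟨N, w, q⟩ = averageWord N q f := by
  obtain rfl : n = w.length := by simp [← h]
  have : f = w.get := List.ofFn_injective (h.trans (List.ofFn_get w).symm)
  subst this
  rfl

theorem koszulSign_swap {n : ℕ} (g : Fin n → ℕ) (k k' : Fin n) (hk : k'.val = k.val + 1)
    (σ : Equiv.Perm (Fin n)) :
    koszulSign (fun i => g (Equiv.swap k k' i)) σ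
      = koszul (g k) (g k') * koszulSign g (Equiv.swap k k' * σ) := by
  obtain ⟨c, d, hcd, hσ⟩ : ∃ c d : Fin n, c < d ∧
      ((σ c = k ∧ σ d = k') ∨ (σ c = k' ∧ σ d = k)) := by
    rcases lt_trichotomy (σ.symm k) (σ.symm k') with h | h | h
    · exact ⟨_, _, h, Or.inl (by simp)⟩
    · exact absurd (congrArg Fin.val (σ.symm.injective h)) (by omega)
    · exact ⟨_, _, h, Or.inr (by simp)⟩
  have hcorr : (∏ i : Fin n, ∏ j : Fin n, if i = c ∧ j = d then koszul (g k) (g k') else 1)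
      = koszul (g k) (g k') := by
    simp [ite_and, Finset.prod_ite_eq']
  rw [← hcorr, koszulSign, koszulSign]
  simp only [← Finset.prod_mul_distrib]
  refine Finset.prod_congr rfl fun i _ => Finset.prod_congr rfl fun j _ => ?_
  simp only [Equiv.Perm.coe_mul, Function.comp_apply]
  by_cases hij : i = c ∧ j = d
  · obtain ⟨rfl, rfl⟩ := hij
    have hlt : k < k' := by rw [Fin.lt_def]; omega
    rcases hσ with ⟨h1, h2⟩ | ⟨h1, h2⟩
    · simp [h1, h2, hcd, hlt, hlt.not_gt, koszul_symm (g k') (g k), koszul_sq]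
    · simp [h1, h2, hcd, hlt, hlt.not_gt]
  · rw [if_neg hij, one_mul]
    refine if_congr ?_ rfl rfl
    refine and_congr_right fun hlt => ?_
    have hne : σ i ≠ σ j := fun h => hlt.ne (σ.injective h)
    have hno : ¬ ((σ i = k ∧ σ j = k') ∨ (σ i = k' ∧ σ j = k)) := by
      rintro (⟨h1, h2⟩ | ⟨h1, h2⟩) <;> rcases hσ with ⟨h3, h4⟩ | ⟨h3, h4⟩
      · exact hij ⟨σ.injective (h1.trans h3.symm), σ.injective (h2.trans h4.symm)⟩
      · have := σ.injective (h1.trans h4.symm); have := σ.injective (h2.trans h3.symm)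
        subst_vars; exact absurd hlt hcd.not_gt
      · have := σ.injective (h1.trans h4.symm); have := σ.injective (h2.trans h3.symm)
        subst_vars; exact absurd hlt hcd.not_gt
      · exact hij ⟨σ.injective (h1.trans h3.symm), σ.injective (h2.trans h4.symm)⟩
    generalize σ i = u at *
    generalize σ j = v at *
    simp only [Equiv.swap_apply_def, Fin.ext_iff] at *
    split_ifs <;> simp only [Fin.lt_def] <;> omega

theorem averageWord_swap (N : Multiset Node) (q : List (Par × ℕ)) {n : ℕ} (f : Fin n → Kind × ℕ)
    (k k' : Fin n) (hk : k'.val = k.val + 1) :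
    averageWord N q (fun i => f (Equiv.swap k k' i))
      = koszul (f k).1.grade (f k').1.grade • averageWord N q f := by
  rw [averageWord, averageWord, smul_comm]
  congr 1
  rw [Finset.smul_sum]
  refine Fintype.sum_equiv (Equiv.mulLeft (Equiv.swap k k')) _ _ fun σ => ?_
  rw [smul_smul]
  rw [koszulSign_swap (fun i => (f i).1.grade) k k' hk σ]
  rfl

theorem average_exchange (N : Multiset Node) (q : List (Par × ℕ)) (p s : List (Kind × ℕ))
    (a b : Kind × ℕ) :
    average ⟨N, p ++ a :: b :: s, q⟩
      = koszul a.1.grade b.1.grade • average ⟨N, p ++ b :: a :: s, q⟩ := by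
  set w := p ++ b :: a :: s with hw
  have hlen : w.length = p.length + s.length + 2 := by simp [hw]; omega
  let k : Fin w.length := ⟨p.length, by omega⟩
  let k' : Fin w.length := ⟨p.length + 1, by omega⟩
  have h1 : w.get k = b := by simp [k, hw]
  have h2 : w.get k' = a := by simp [k', hw, List.getElem_append_right]
  have h3 : List.ofFn (fun i => w.get (Equiv.swap k k' i)) = p ++ a :: b :: s := by
    apply List.ext_getElem
    · simp [hlen]; omega
    · intro i hi hi'
      simp only [List.getElem_ofFn, Equiv.swap_apply_def, Fin.ext_iff, k, k']
      split_ifs with c1 c2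
      · subst c1
        rw [h2.symm.trans rfl |>.symm]
        simp [List.getElem_append_right]
      · subst c2
        simp [hw, List.getElem_append_right]
      · simp only [hw, List.get_eq_getElem]
        by_cases hp : i < p.length
        · simp [List.getElem_append_left hp]
        · rw [List.getElem_append_right (by omega), List.getElem_append_right (by omega)]
          obtain ⟨j, hj⟩ : ∃ j, i - p.length = j + 2 := ⟨i - p.length - 2, by omega⟩
          simp [hj]
  rw [average_ofFn N q _ _ h3, averageWord_swap N q w.get k k' rfl, h1, h2, koszul_symm]
  rfl

theorem averageWord_mem {N : Multiset Node} {q : List (Par × ℕ)} {n : ℕ} {f : Fin n → Kind × ℕ} :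
    averageWord N q f ∈ lab (⟨N, List.ofFn f, q⟩ : Raw).labels := by
  refine Submodule.smul_mem _ _ (sum_mem fun σ _ => Submodule.smul_mem _ _ (single_mem_lab ?_))
  have h : (List.ofFn (fun i => f (σ i))).Perm (List.ofFn f) := Equiv.Perm.ofFn_comp_perm σ f
  simp only [Raw.labels]
  rw [Multiset.coe_eq_coe.mpr (h.map Prod.snd)]

/-- Extend `average` linearly. -/
def averageLin : Comb →ₗ[ℚ] Comb := Finsupp.linearCombination ℚ average

theorem averageMap_relator (t : ℕ × ℕ) (ρ : Comb) (h : Relator .sym ρ) :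
    (cls .tilde t ∘ₗ averageLin) ρ = 0 := by
  have hs : ∀ r, averageLin (δ r) = average r := by
    intro r; simp [averageLin, Finsupp.linearCombination_single]
  refine descend (T := .sym) t _ id Function.injective_id id (fun _ h => h)
    (fun _ _ => rfl) (fun r f => ?_) (fun r n => ?_) (fun r y => ?_) ?_ ?_ ?_ ?_ ρ h
  · rw [hs, hs, Raw.relabel, average_ofFn _ _ (fun i => Prod.map id f (r.legs.get i)), average]
    · simp only [averageWord, map_smul, map_sum, ren_single, id]
      simp [Raw.relabel, List.map_ofFn, Function.comp_def, Prod.map]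
    · rw [← Function.comp_def, ← List.map_ofFn, List.ofFn_get]
  · have : n.relabel id = n := by cases n <;> rfl
    rw [hs, hs, average, average, this]
    simp only [averageWord, map_smul, map_sum, pre_single]
    simp [Raw.prepend, Raw.add]
    rfl
  · rw [hs]
    have := averageWord_mem (N := r.nodes) (q := r.ops) (f := r.legs.get)
    rw [List.ofFn_get] at this
    refine Finsupp.supported_mono ?_ this
    intro r' hr'
    exact congrArg (Multiset.count y) hr'
  · intro N w p s d e
    rw [map_sub, map_smul, hs, hs]
    simp only [average, averageWord, map_sub, map_smul, map_sum]
    rw [smul_comm (koszul _ _), ← smul_sub, Finset.smul_sum, ← Finset.sum_sub_distrib]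
    rw [Finset.sum_eq_zero, smul_zero]
    intro σ _
    have := cls_relator (T := .tilde) (Relator.ops N (List.ofFn fun i => w.get (σ i)) p s d e) t
    rw [map_sub, map_smul] at this
    rw [smul_comm (koszul _ _), ← smul_sub, this, smul_zero]
  · intro N p s q k l x y h
    rw [map_sub, map_smul, hs, hs, average_exchange, sub_self, map_zero]
  · intro N p s q k l m x y z h
    revert h
    cases k <;> cases l <;> simp [Theory.exch]
  · intro N p s q k l x y h
    revert h
    cases k <;> cases l <;> simp [Theory.exch]

/-- The graded averaging map `χ_𝒲 : 𝒲 → 𝒲~`. -/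
def averageMap : W →ₗ[ℚ] WTilde :=
  lift (0, 0) (cls .tilde (0, 0) ∘ₗ averageLin) (averageMap_relator (0, 0))

/-! ### The change of basis map -/

/-- What a leg `l` of grade 2 contributes besides a curvature leg: half a fork, the edges of the new
legs having the names `p` and `q`. -/
def forkPart (l : Kind × ℕ) (p q : ℕ) : Comb →ₗ[ℚ] Comb :=
  if l.1 = .two then
    (1 / 2 : ℚ) • pre ⟨{.tri l.2 p q}, [(.one, p), (.one, q)], []⟩
  else 0

/-- Put, in front of a diagram, what replaces the leg `l`. -/
def replaceLeg (l : Kind × ℕ) (p q : ℕ) : Comb →ₗ[ℚ] Comb := pre ⟨0, [l], []⟩ + forkPart l p q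

/-- Replace all the legs of grade 2 in a word.  New edges have odd names, beginning with the `n`-th
odd number. -/
def replaceLegs (o : List (Par × ℕ)) : ℕ → List (Kind × ℕ) → Comb
  | _, [] => δ ⟨0, [], o⟩
  | n, l :: w => replaceLeg l (oddName n) (oddName (n + 1)) (replaceLegs o (n + 2) w)

/-- Replace each leg of grade 2 by a curvature leg plus half a fork.  The old edges are given even
names. -/
def toCurvature (r : Raw) : Comb :=
  pre ⟨(r.relabel evenName).nodes, [], []⟩
    (replaceLegs (r.relabel evenName).ops 0 (r.relabel evenName).legs)

theorem relabel_eq_self {f : ℕ → ℕ} {r : Raw} (h : ∀ d ∈ r.labels, f d = d) : r.relabel f = r := by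
  obtain ⟨N, w, q⟩ := r
  simp only [Raw.labels, Multiset.mem_add, Multiset.mem_coe, Multiset.mem_bind, List.mem_map] at h
  have hn : ∀ n ∈ N, n.relabel f = n := by
    intro n hn
    have : ∀ d ∈ n.labels, f d = d := fun d hd => h d (Or.inl (Or.inl ⟨n, hn, hd⟩))
    cases n <;> simp [Node.labels] at this <;> simp [Node.relabel, this]
  have hw : ∀ l ∈ w, Prod.map id f l = l := fun l hl =>
    Prod.ext rfl (h l.2 (Or.inl (Or.inr ⟨l, hl, rfl⟩)))
  have hq : ∀ l ∈ q, Prod.map id f l = l := fun l hl =>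
    Prod.ext rfl (h l.2 (Or.inr ⟨l, hl, rfl⟩))
  simp only [Raw.relabel, Raw.mk.injEq]
  refine ⟨?_, ?_, ?_⟩
  · conv_rhs => rw [← Multiset.map_id N]
    exact Multiset.map_congr rfl hn
  · conv_rhs => rw [← List.map_id w]
    exact List.map_congr_left hw
  · conv_rhs => rw [← List.map_id q]
    exact List.map_congr_left hq

/-- Combinations of diagrams all of whose edges have names satisfying `S`. -/
def named (S : ℕ → Prop) : Submodule ℚ Comb :=
  Finsupp.supported ℚ ℚ {r : Raw | ∀ d ∈ r.labels, S d}

theorem named_induction {S : ℕ → Prop} {U : Submodule ℚ Comb} (F : Comb →ₗ[ℚ] Comb)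
    (h : ∀ r : Raw, (∀ d ∈ r.labels, S d) → F (δ r) ∈ U) {m : Comb} (hm : m ∈ named S) :
    F m ∈ U := by
  rw [named, Finsupp.supported_eq_span_single] at hm
  have : Submodule.span ℚ ((fun i => Finsupp.single i (1 : ℚ)) ''
      {r : Raw | ∀ d ∈ r.labels, S d}) ≤ U.comap F := by
    rw [Submodule.span_le]
    rintro _ ⟨r, hr, rfl⟩
    exact h r hr
  exact this hm

theorem ren_eq_self {f : ℕ → ℕ} {S : ℕ → Prop} (h : ∀ d, S d → f d = d) {m : Comb}
    (hm : m ∈ named S) : ren f m = m := by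
  have := named_induction (U := ⊥) (ren f - LinearMap.id) (fun r hr => by
    simp [ren_single, relabel_eq_self (fun d hd => h d (hr d hd))]) hm
  simpa [sub_eq_zero] using this

theorem pre_mem_named {S : ℕ → Prop} {d : Raw}
    (hd : ∀ z ∈ (⟨d.nodes, d.legs, []⟩ : Raw).labels, S z)
    {m : Comb} (hm : m ∈ named S) : pre d m ∈ named S := by
  refine named_induction (pre d) (fun r hr => ?_) hm
  rw [pre_single]
  refine Finsupp.single_mem_supported _ _ ?_
  intro z hz
  rw [prepend_labels, Multiset.mem_add] at hz
  exact hz.elim (hd z) (hr z)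

section Local

variable (t : ℕ × ℕ) (P : Raw) (m : Comb)

/-- The class of the diagram with `F` between the fixed diagram `P` and the fixed `m`. -/
def between (F : Raw) : Space .hatF t := cls .hatF t (pre P (pre F m))

theorem between_comm (N : Multiset Node) (u v : List (Kind × ℕ)) (a b : Kind × ℕ)
    (h : Theory.exch .hatF a.1 b.1 = .comm) :
    between t P m ⟨N, u ++ a :: b :: v, []⟩
      = koszul a.1.grade b.1.grade • between t P m ⟨N, u ++ b :: a :: v, []⟩ := by
  obtain ⟨k, x⟩ := a
  obtain ⟨l, y⟩ := b
  have h' : cls .hatF t ∘ₗ (pre ⟨P.nodes + N, P.legs ++ (u ++ (k, x) :: (l, y) :: v), []⟩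
      - koszul k.grade l.grade • pre ⟨P.nodes + N, P.legs ++ (u ++ (l, y) :: (k, x) :: v), []⟩) = 0 :=
    comb_ext fun r => by
      have := cls_relator (T := .hatF) (Relator.comm (P.nodes + N + r.nodes) (P.legs ++ u)
        (v ++ r.legs) r.ops k l x y h) t
      rw [LinearMap.comp_apply, LinearMap.sub_apply, LinearMap.smul_apply, pre_single, pre_single,
        LinearMap.zero_apply]
      simpa only [Raw.prepend, List.append_assoc, List.cons_append] using this
  have h2 := LinearMap.congr_fun h' m
  rw [LinearMap.comp_apply, LinearMap.sub_apply, map_sub, LinearMap.zero_apply, sub_eq_zero,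
    LinearMap.smul_apply, map_smul] at h2
  rw [between, between, pre_pre, pre_pre]
  exact h2

theorem between_join (N : Multiset Node) (u v : List (Kind × ℕ)) (x y : ℕ) :
    between t P m ⟨N, u ++ (.one, x) :: (.one, y) :: v, []⟩
      = between t P m ⟨.joint x y ::ₘ N, u ++ v, []⟩
        - between t P m ⟨N, u ++ (.one, y) :: (.one, x) :: v, []⟩ := by
  have h' : cls .hatF t ∘ₗ (pre ⟨P.nodes + N, P.legs ++ (u ++ (.one, x) :: (.one, y) :: v), []⟩
      + pre ⟨P.nodes + N, P.legs ++ (u ++ (.one, y) :: (.one, x) :: v), []⟩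
      - pre ⟨P.nodes + (.joint x y ::ₘ N), P.legs ++ (u ++ v), []⟩) = 0 :=
    comb_ext fun r => by
      have := cls_relator (T := .hatF) (Relator.join (P.nodes + N + r.nodes) (P.legs ++ u)
        (v ++ r.legs) r.ops .one .one x y rfl) t
      rw [LinearMap.comp_apply, LinearMap.sub_apply, LinearMap.add_apply, pre_single, pre_single,
        pre_single, LinearMap.zero_apply]
      have hk : koszul Kind.one.grade Kind.one.grade = -1 := by simp [koszul, Kind.grade]
      rw [hk, neg_smul, one_smul, sub_neg_eq_add] at this
      simpa only [Raw.prepend, List.append_assoc, List.cons_append, Multiset.add_cons,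
        Multiset.cons_add] using this
  have h2 := LinearMap.congr_fun h' m
  rw [LinearMap.comp_apply, LinearMap.sub_apply, map_sub, LinearMap.zero_apply, sub_eq_zero,
    LinearMap.add_apply, map_add] at h2
  rw [between, between, between, pre_pre, pre_pre, pre_pre]
  exact eq_sub_of_add_eq h2

theorem between_bracket (x y z : ℕ) (hx : z ≠ x) (hy : z ≠ y)
    (hP : z ∉ P.labels) (hm : m ∈ named (· ≠ z)) :
    between t P m ⟨0, [(.two, x), (.two, y)], []⟩
      = between t P m ⟨0, [(.two, y), (.two, x)], []⟩
        + between t P m ⟨{.tri x z y}, [(.two, z)], []⟩ := by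
  have h := named_induction (S := fun d => d ≠ z) (U := legIdeal .hatF z)
    (pre P ∘ₗ box .hatF .two .two x y z)
    (fun r hr => Submodule.subset_span ⟨P, .two, .two, x, y, r, by simp [Theory.exch], hP, hx, hy,
      fun hz => hr z hz rfl, rfl⟩) hm
  have h2 := cls_legIdeal h t
  have hk : koszul Kind.two.grade Kind.two.grade = 1 := by norm_num [koszul, Kind.grade]
  simp only [LinearMap.comp_apply, box, boxCorr, Theory.exch, LinearMap.sub_apply, hk, one_smul,
    map_sub] at h2
  rw [sub_sub, sub_eq_zero] at h2
  exact h2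

theorem between_node_eq {c : ℚ} {N₁ N₂ : Multiset Node}
    (h : ∀ m, cls .hatF t (pre ⟨N₁, [], []⟩ m) = c • cls .hatF t (pre ⟨N₂, [], []⟩ m))
    (N : Multiset Node) (w : List (Kind × ℕ)) :
    between t P m ⟨N₁ + N, w, []⟩ = c • between t P m ⟨N₂ + N, w, []⟩ := by
  have e : ∀ M : Multiset Node, between t P m ⟨M + N, w, []⟩
      = cls .hatF t (pre ⟨M, [], []⟩ (pre P (pre ⟨N, w, []⟩ m))) := by
    intro M
    rw [between, pre_pre, pre_pre, pre_pre]
    simp [add_left_comm, add_assoc]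
  rw [e, e, h]

theorem between_joint_symm (N : Multiset Node) (w : List (Kind × ℕ)) (x y : ℕ) :
    between t P m ⟨.joint x y ::ₘ N, w, []⟩ = between t P m ⟨.joint y x ::ₘ N, w, []⟩ := by
  simpa using between_node_eq t P m (c := 1) (N₁ := {.joint x y}) (N₂ := {.joint y x})
    (fun m => by rw [one_smul, cls_joint_symm]) N w

theorem between_rotate (N : Multiset Node) (w : List (Kind × ℕ)) (x y z : ℕ) :
    between t P m ⟨.tri x y z ::ₘ N, w, []⟩ = between t P m ⟨.tri y z x ::ₘ N, w, []⟩ := by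
  simpa using between_node_eq t P m (c := 1) (N₁ := {.tri x y z}) (N₂ := {.tri y z x})
    (fun m => by rw [one_smul, cls_rotate]) N w

theorem between_antisymm (N : Multiset Node) (w : List (Kind × ℕ)) (x y z : ℕ) :
    between t P m ⟨.tri x y z ::ₘ N, w, []⟩ = -between t P m ⟨.tri y x z ::ₘ N, w, []⟩ := by
  simpa using between_node_eq t P m (c := -1) (N₁ := {.tri x y z}) (N₂ := {.tri y x z})
    (fun m => by rw [neg_smul, one_smul, cls_antisymm]) N w

theorem between_ihx (w : List (Kind × ℕ)) (a b c d x : ℕ) :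
    between t P m ⟨{.tri a b x, .tri x c d}, w, []⟩
      + between t P m ⟨{.tri b c x, .tri x a d}, w, []⟩
      + between t P m ⟨{.tri c a x, .tri x b d}, w, []⟩ = 0 := by
  have e : ∀ M : Multiset Node, between t P m ⟨M, w, []⟩
      = cls .hatF t (pre ⟨M, [], []⟩ (pre P (pre ⟨0, w, []⟩ m))) := by
    intro M
    rw [between, pre_pre, pre_pre, pre_pre]
    simp [add_comm]
  rw [e, e, e]
  exact cls_ihx t _ _ _ _ _ _

theorem between_smooth (N : Multiset Node) (w : List (Kind × ℕ)) (a b : ℕ) (hab : a ≠ b)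
    (hP : b ∉ P.labels) (hm : m ∈ named (· ≠ b))
    (hc : (⟨N, w, []⟩ : Raw).labels.count b = 1) :
    between t P m ⟨.joint a b ::ₘ N, w, []⟩
      = between t P m ((⟨N, w, []⟩ : Raw).relabel (Function.update id b a)) := by
  have e : between t P m ⟨.joint a b ::ₘ N, w, []⟩
      = cls .hatF t (pre ⟨{.joint a b}, [], []⟩ (pre P (pre ⟨N, w, []⟩ m))) := by
    rw [between, pre_pre, pre_pre, pre_pre]
    simp
  have hP' := (not_mem_nodes hP).2.1
  rw [e, cls_smooth' t hab, ren_pre, ren_pre, between]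
  · rw [ren_eq_self (S := (· ≠ b)) (fun d hd => Function.update_of_ne hd _ _) hm]
    rw [relabel_eq_self (r := P)]
    intro d hd
    exact Function.update_of_ne (fun h => hP (by rw [← h]; exact hd)) _ _
  · rw [pre_pre]
    refine named_induction (pre _) (fun r hr => ?_) hm
    rw [pre_single]
    refine Finsupp.single_mem_supported _ _ ?_
    have hr0 : b ∉ r.labels := fun h => hr b h rfl
    have e1 : (⟨P.nodes + N, P.legs ++ w, []⟩ : Raw).labels
        = (⟨P.nodes, P.legs, []⟩ : Raw).labels + (⟨N, w, []⟩ : Raw).labels := by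
      rw [← prepend_labels]; rfl
    simp only [Set.mem_ofPred_eq]
    rw [prepend_labels, e1, Multiset.count_add, Multiset.count_add, hc,
      Multiset.count_eq_zero_of_notMem hP', Multiset.count_eq_zero_of_notMem hr0]

theorem between_ren (F : Raw) {f : ℕ → ℕ} (hf : Function.Injective f)
    (hP : ∀ d ∈ P.labels, f d = d) (hm : m ∈ named (fun d => f d = d)) :
    between t P m (F.relabel f) = between t P m F := by
  have := cls_ren (T := .hatF) t hf (pre P (pre F m))
  rwa [ren_pre, ren_pre, relabel_eq_self hP, ren_eq_self (fun d hd => hd) hm] at this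

theorem named_mono {S S' : ℕ → Prop} (h : ∀ d, S d → S' d) {m : Comb} (hm : m ∈ named S) :
    m ∈ named S' := by
  have h' : {r : Raw | ∀ d ∈ r.labels, S d} ⊆ {r : Raw | ∀ d ∈ r.labels, S' d} :=
    fun r (hr : ∀ d ∈ r.labels, S d) d hd => h d (hr d hd)
  exact Finsupp.supported_mono h' hm

/-- A fork commutes with a leg of grade 1 up to a trivalent vertex. -/
theorem between_fork_one (x y z p q : ℕ) (hpq : p ≠ q)
    (hpx : p ≠ x) (hpy : p ≠ y) (hqx : q ≠ x) (hqy : q ≠ y) (hzx : z ≠ x) (hzy : z ≠ y)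
    (hP : ∀ d ∈ P.labels, d ≠ z ∧ d ≠ p ∧ d ≠ q)
    (hm : m ∈ named (fun d => d ≠ z ∧ d ≠ p ∧ d ≠ q)) :
    between t P m ⟨{.tri x p q}, [(.one, p), (.one, q), (.one, y)], []⟩
      = between t P m ⟨{.tri x p q}, [(.one, y), (.one, p), (.one, q)], []⟩
        + (2 : ℚ) • between t P m ⟨{.tri x z y}, [(.one, z)], []⟩ := by
  have h1 := between_join t P m {.tri x p q} [(.one, p)] [] q y
  have h2 := between_join t P m {.tri x p q} [] [(.one, q)] p y
  have h3 := between_smooth t P m {.tri x p q} [(.one, p)] y q hqy.symm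
    (fun h => (hP q h).2.2 rfl) (named_mono (fun d hd => hd.2.2) hm)
    (by simp [Raw.labels, Node.labels, hpq.symm,
      hqx])
  have h4 := between_smooth t P m {.tri x p q} [(.one, q)] y p hpy.symm
    (fun h => (hP p h).2.1 rfl) (named_mono (fun d hd => hd.2.1) hm)
    (by simp [Raw.labels, Node.labels, hpq,
      hpx])
  have h5 := between_ren t P m ⟨{.tri x p y}, [(.one, p)], []⟩ (Equiv.swap p z).injective
    (fun d hd => Equiv.swap_apply_of_ne_of_ne (hP d hd).2.1 (hP d hd).1)
    (named_mono (fun d hd => Equiv.swap_apply_of_ne_of_ne hd.2.1 hd.1) hm)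
  have h6 := between_ren t P m ⟨{.tri x y q}, [(.one, q)], []⟩ (Equiv.swap q z).injective
    (fun d hd => Equiv.swap_apply_of_ne_of_ne (hP d hd).2.2 (hP d hd).1)
    (named_mono (fun d hd => Equiv.swap_apply_of_ne_of_ne hd.2.2 hd.1) hm)
  have h7 := between_antisymm t P m 0 [(.one, z)] z x y
  have h8 := between_rotate t P m 0 [(.one, z)] z x y
  have h9 := between_rotate t P m 0 [(.one, z)] x y z
  have h10 := between_rotate t P m 0 [(.one, z)] z y x
  have h11 := between_rotate t P m 0 [(.one, z)] x z y
  rw [between_joint_symm] at h1 h2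
  simp only [List.cons_append, List.nil_append] at h1 h2
  rw [h3] at h1
  rw [h4] at h2
  simp [Raw.relabel, Node.relabel, hpq, hpq.symm, hpx.symm, hqx.symm, hpy.symm, hqy.symm, hzx.symm,
    hzy.symm, Equiv.swap_apply_of_ne_of_ne, Function.update_apply] at h1 h2 h5 h6 h7 h8 h9 h10 h11
  rw [h1, ← h5, h2, ← h6]
  rw [← h8, h7]
  module

/-- The commutator of two forks. -/
theorem between_fork_fork (x y z p q r s : ℕ) (hpq : p ≠ q) (hpr : p ≠ r) (hps : p ≠ s)
    (hqr : q ≠ r) (hqs : q ≠ s) (hrs : r ≠ s) (hzp : z ≠ p) (hzq : z ≠ q) (hzr : z ≠ r)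
    (hzs : z ≠ s) (hpx : p ≠ x) (hpy : p ≠ y) (hqx : q ≠ x) (hqy : q ≠ y) (hrx : r ≠ x)
    (hry : r ≠ y) (hsx : s ≠ x) (hsy : s ≠ y) (hzx : z ≠ x) (hzy : z ≠ y)
    (hP : ∀ d ∈ P.labels, d ≠ z ∧ d ≠ p ∧ d ≠ q ∧ d ≠ r ∧ d ≠ s)
    (hm : m ∈ named (fun d => d ≠ z ∧ d ≠ p ∧ d ≠ q ∧ d ≠ r ∧ d ≠ s)) :
    between t P m ⟨{.tri x p q, .tri y r s}, [(.one, p), (.one, q), (.one, r), (.one, s)], []⟩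
      = between t P m ⟨{.tri x p q, .tri y r s}, [(.one, r), (.one, s), (.one, p), (.one, q)], []⟩
        + (2 : ℚ) • between t P m ⟨{.tri x z y, .tri z p q}, [(.one, p), (.one, q)], []⟩ := by
  have j1 := between_join t P m {.tri x p q, .tri y r s} [(.one, p)] [(.one, s)] q r
  have j2 := between_join t P m {.tri x p q, .tri y r s} [(.one, p), (.one, r)] [] q s
  have j3 := between_join t P m {.tri x p q, .tri y r s} [] [(.one, s), (.one, q)] p r
  have j4 := between_join t P m {.tri x p q, .tri y r s} [(.one, r)] [(.one, q)] p s
  have nr := named_mono (S' := fun d => d ≠ r) (fun d hd => hd.2.2.2.1) hm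
  have ns := named_mono (S' := fun d => d ≠ s) (fun d hd => hd.2.2.2.2) hm
  have s1 := between_smooth t P m {.tri x p q, .tri y r s} [(.one, p), (.one, s)] q r hqr
    (fun h => (hP r h).2.2.2.1 rfl) nr
    (by simp [Raw.labels, Node.labels, hpr, hqr, hrs.symm, hry.symm, hrx.symm])
  have s2 := between_smooth t P m {.tri x p q, .tri y r s} [(.one, p), (.one, r)] q s hqs
    (fun h => (hP s h).2.2.2.2 rfl) ns
    (by simp [Raw.labels, Node.labels, hps, hqs, hrs, hsy.symm, hsx.symm])
  have s3 := between_smooth t P m {.tri x p q, .tri y r s} [(.one, s), (.one, q)] p r hpr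
    (fun h => (hP r h).2.2.2.1 rfl) nr
    (by simp [Raw.labels, Node.labels, hpr, hqr, hrs.symm, hry.symm, hrx.symm])
  have s4 := between_smooth t P m {.tri x p q, .tri y r s} [(.one, r), (.one, q)] p s hps
    (fun h => (hP s h).2.2.2.2 rfl) ns
    (by simp [Raw.labels, Node.labels, hps, hqs, hrs, hsy.symm, hsx.symm])
  -- rename the edges: the inner edge becomes `z`, the legs become `p`, `q`
  have key : ∀ (F : Raw) (u w : ℕ), (u = p ∨ u = q) → (w = r ∨ w = s) →
      between t P m (F.relabel (fun d => Equiv.swap w u (Equiv.swap u z d))) = between t P m F := by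
    intro F u w hu hw
    have hfix : ∀ d, (d ≠ z ∧ d ≠ p ∧ d ≠ q ∧ d ≠ r ∧ d ≠ s) →
        Equiv.swap w u (Equiv.swap u z d) = d := by
      intro d hd
      have h1 : d ≠ u := by rcases hu with rfl | rfl <;> tauto
      have h2 : d ≠ w := by rcases hw with rfl | rfl <;> tauto
      rw [Equiv.swap_apply_of_ne_of_ne h1 hd.1, Equiv.swap_apply_of_ne_of_ne h2 h1]
    exact between_ren t P m F ((Equiv.swap w u).injective.comp (Equiv.swap u z).injective)
      (fun d hd => hfix d (hP d hd)) (named_mono hfix hm)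
  have k1 := key ⟨{.tri x p q, .tri y q s}, [(.one, p), (.one, s)], []⟩ q s (Or.inr rfl) (Or.inr rfl)
  have k2 := key ⟨{.tri x p q, .tri y r q}, [(.one, p), (.one, r)], []⟩ q r (Or.inr rfl) (Or.inl rfl)
  have k3 := key ⟨{.tri x p q, .tri y p s}, [(.one, s), (.one, q)], []⟩ p s (Or.inl rfl) (Or.inr rfl)
  have k4 := key ⟨{.tri x p q, .tri y r p}, [(.one, r), (.one, q)], []⟩ p r (Or.inl rfl) (Or.inl rfl)
  have i1 := between_ihx t P m [(.one, p), (.one, q)] y x p q z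
  simp only [List.cons_append, List.nil_append] at j1 j2 j3 j4
  rw [s1] at j1
  rw [s2] at j2
  rw [s3] at j3
  rw [s4] at j4
  have hne := And.intro hpq.symm (And.intro hpr.symm (And.intro hps.symm (And.intro hqr.symm
    (And.intro hqs.symm hrs.symm))))
  simp [Raw.relabel, Node.relabel, Function.update_apply, Equiv.swap_apply_def, *, hzx.symm,
    hpx.symm, hqx.symm, hrx.symm, hsx.symm, hzy.symm, hpy.symm, hqy.symm, hry.symm, hsy.symm,
    hzp.symm, hzq.symm, hzr.symm, hzs.symm, -key]
    at j1 j2 j3 j4 k1 k2 k3 k4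
  simp only [Multiset.insert_eq_cons] at i1 ⊢
  have hc : ∀ a b : Node, (a ::ₘ {b} : Multiset Node) = b ::ₘ {a} := Multiset.pair_comm
  rw [j1, j2, j3, j4, ← k1, ← k2, ← k3, ← k4]
  have g1 : ∀ w, between t P m ⟨.tri x z y ::ₘ {.tri z p q}, w, []⟩
      = between t P m ⟨.tri y x z ::ₘ {.tri z p q}, w, []⟩ := by
    intro w
    rw [between_rotate, between_rotate]
  have a1 : ∀ w, between t P m ⟨.tri x p z ::ₘ {.tri y z q}, w, []⟩
      = -between t P m ⟨.tri x p z ::ₘ {.tri z y q}, w, []⟩ := by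
    intro w
    rw [hc, between_antisymm, hc]
  have a2 : ∀ w, between t P m ⟨.tri x p z ::ₘ {.tri y q z}, w, []⟩
      = between t P m ⟨.tri x p z ::ₘ {.tri z y q}, w, []⟩ := by
    intro w
    rw [hc, between_rotate, between_rotate, hc]
  have b1 : ∀ w, between t P m ⟨.tri x z q ::ₘ {.tri y z p}, w, []⟩
      = -between t P m ⟨.tri p y z ::ₘ {.tri z x q}, w, []⟩ := by
    intro w
    rw [between_antisymm, hc, between_rotate, between_rotate]
  have b2 : ∀ w, between t P m ⟨.tri x z q ::ₘ {.tri y p z}, w, []⟩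
      = between t P m ⟨.tri p y z ::ₘ {.tri z x q}, w, []⟩ := by
    intro w
    rw [between_antisymm, hc, between_antisymm, neg_neg]
  rw [g1, a1, a2, b1, b2]
  linear_combination (norm := module) (-2 : ℚ) • i1

theorem between_fork_comm (N : Multiset Node) (k : Kind) (y p q : ℕ)
    (h : Theory.exch .hatF .one k = .comm) :
    between t P m ⟨N, [(.one, p), (.one, q), (k, y)], []⟩
      = between t P m ⟨N, [(k, y), (.one, p), (.one, q)], []⟩ := by
  have h1 := between_comm t P m N [(.one, p)] [] (.one, q) (k, y) h
  have h2 := between_comm t P m N [] [(.one, q)] (.one, p) (k, y) h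
  simp only [List.cons_append, List.nil_append] at h1 h2
  rw [h1, h2, smul_smul, koszul_sq, one_smul]

/-- What replaces two adjacent legs satisfies the exchange relations.  The legs are `k`, `l` at the
edges `x`, `y`; all the other names are new. -/
theorem replaceLeg_exchange (k l : Kind) (x y z p q r s : ℕ) (hpq : p ≠ q) (hpr : p ≠ r)
    (hps : p ≠ s) (hqr : q ≠ r) (hqs : q ≠ s) (hrs : r ≠ s) (hzp : z ≠ p) (hzq : z ≠ q)
    (hzr : z ≠ r) (hzs : z ≠ s) (hpx : p ≠ x) (hpy : p ≠ y) (hqx : q ≠ x) (hqy : q ≠ y)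
    (hrx : r ≠ x) (hry : r ≠ y) (hsx : s ≠ x) (hsy : s ≠ y) (hzx : z ≠ x) (hzy : z ≠ y)
    (hP : ∀ d ∈ P.labels, d ≠ z ∧ d ≠ p ∧ d ≠ q ∧ d ≠ r ∧ d ≠ s)
    (hm : m ∈ named (fun d => d ≠ z ∧ d ≠ p ∧ d ≠ q ∧ d ≠ r ∧ d ≠ s)) :
    cls .hatF t (pre P (replaceLeg (k, x) p q (replaceLeg (l, y) r s m)))
      = koszul k.grade l.grade
          • cls .hatF t (pre P (replaceLeg (l, y) p q (replaceLeg (k, x) r s m)))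
        + match Theory.exch .hat k l with
          | .bracket n => cls .hatF t (pre P (pre ⟨{.tri x z y}, [], []⟩ (replaceLeg (n, z) p q m)))
          | .join => cls .hatF t (pre P (pre ⟨{.joint x y}, [], []⟩ m))
          | _ => 0 := by
  obtain ⟨K, hK⟩ : ∃ K : Comb →ₗ[ℚ] Space .hatF t, ∀ n, cls .hatF t (pre P n) = K n :=
    ⟨cls .hatF t ∘ₗ pre P, fun _ => rfl⟩
  have hb : ∀ F, K (pre F m) = between t P m F := fun F => (hK _).symm
  -- renaming of the new edges
  have key : ∀ F : Raw,
      between t P m (F.relabel (fun d => Equiv.swap p r (Equiv.swap q s d))) = between t P m F := by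
    intro F
    have hfix : ∀ d, (d ≠ z ∧ d ≠ p ∧ d ≠ q ∧ d ≠ r ∧ d ≠ s) →
        Equiv.swap p r (Equiv.swap q s d) = d := by
      intro d hd
      rw [Equiv.swap_apply_of_ne_of_ne hd.2.2.1 hd.2.2.2.2,
        Equiv.swap_apply_of_ne_of_ne hd.2.1 hd.2.2.2.1]
    exact between_ren t P m F ((Equiv.swap p r).injective.comp (Equiv.swap q s).injective)
      (fun d hd => hfix d (hP d hd)) (named_mono hfix hm)
  have k1 : ∀ (j : Kind) (u w : ℕ), (u = x ∨ u = y) → (w = x ∨ w = y) →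
      between t P m ⟨{.tri u r s}, [(j, w), (.one, r), (.one, s)], []⟩
        = between t P m ⟨{.tri u p q}, [(j, w), (.one, p), (.one, q)], []⟩ := by
    intro j u w hu hw
    have e : ∀ v, (v = x ∨ v = y) → Equiv.swap p r (Equiv.swap q s v) = v := by
      intro v hv
      have h1 : v ≠ p ∧ v ≠ q ∧ v ≠ r ∧ v ≠ s := by
        rcases hv with rfl | rfl
        exacts [⟨hpx.symm, hqx.symm, hrx.symm, hsx.symm⟩, ⟨hpy.symm, hqy.symm, hry.symm, hsy.symm⟩]
      rw [Equiv.swap_apply_of_ne_of_ne h1.2.1 h1.2.2.2, Equiv.swap_apply_of_ne_of_ne h1.1 h1.2.2.1]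
    have e4 : Equiv.swap p r (Equiv.swap q s r) = p := by
      rw [Equiv.swap_apply_of_ne_of_ne hqr.symm hrs, Equiv.swap_apply_right]
    have e5 : Equiv.swap p r q = q := Equiv.swap_apply_of_ne_of_ne hpq.symm hqr
    have := key ⟨{.tri u r s}, [(j, w), (.one, r), (.one, s)], []⟩
    simp [Raw.relabel, Node.relabel, e u hu, e w hw, e4, e5] at this
    exact this.symm
  have k2 : between t P m ⟨{.tri y p q, .tri x r s}, [(.one, p), (.one, q), (.one, r), (.one, s)], []⟩
      = between t P m ⟨{.tri x p q, .tri y r s}, [(.one, r), (.one, s), (.one, p), (.one, q)], []⟩ := by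
    have e1 : Equiv.swap p r (Equiv.swap q s x) = x := by
      rw [Equiv.swap_apply_of_ne_of_ne hqx.symm hsx.symm,
        Equiv.swap_apply_of_ne_of_ne hpx.symm hrx.symm]
    have e2 : Equiv.swap p r (Equiv.swap q s y) = y := by
      rw [Equiv.swap_apply_of_ne_of_ne hqy.symm hsy.symm,
        Equiv.swap_apply_of_ne_of_ne hpy.symm hry.symm]
    have e4 : Equiv.swap p r (Equiv.swap q s r) = p := by
      rw [Equiv.swap_apply_of_ne_of_ne hqr.symm hrs, Equiv.swap_apply_right]
    have e6 : Equiv.swap p r (Equiv.swap q s p) = r := by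
      rw [Equiv.swap_apply_of_ne_of_ne hpq hps, Equiv.swap_apply_left]
    have e7 : Equiv.swap p r q = q := Equiv.swap_apply_of_ne_of_ne hpq.symm hqr
    have e8 : Equiv.swap p r s = s := Equiv.swap_apply_of_ne_of_ne hps.symm hrs.symm
    have := key ⟨{.tri y p q, .tri x r s}, [(.one, p), (.one, q), (.one, r), (.one, s)], []⟩
    simp [Raw.relabel, Node.relabel, e1, e2, e4, e6, e7, e8] at this
    simp only [Multiset.insert_eq_cons]
    rw [← this]
    congr 2
    exact Multiset.pair_comm _ _
  have hPz : z ∉ P.labels := fun h => (hP z h).1 rfl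
  have hmz : m ∈ named (fun d => d ≠ z) := named_mono (fun d hd => hd.1) hm
  have t2 : ∀ g, koszul 2 g = 1 := fun g => by simp [koszul, pow_mul]
  have t2' : ∀ g, koszul g 2 = 1 := fun g => by simp [koszul, pow_mul']
  have hc : ∀ a b : Kind × ℕ, Theory.exch .hatF a.1 b.1 = .comm →
      between t P m ⟨0, [a, b], []⟩ = koszul a.1.grade b.1.grade • between t P m ⟨0, [b, a], []⟩ :=
    fun a b h => between_comm t P m 0 [] [] a b h
  have hP3 : ∀ d ∈ P.labels, d ≠ z ∧ d ≠ p ∧ d ≠ q := fun d hd =>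
    ⟨(hP d hd).1, (hP d hd).2.1, (hP d hd).2.2.1⟩
  have hm3 : m ∈ named (fun d => d ≠ z ∧ d ≠ p ∧ d ≠ q) :=
    named_mono (fun d hd => ⟨hd.1, hd.2.1, hd.2.2.1⟩) hm
  cases k <;> cases l <;> simp only [hK] <;>
    simp [replaceLeg, forkPart, pre_pre, hb, Theory.exch, Kind.grade, t2, t2', -Finsupp.smul_single]
  case two.two =>
    have h1 := between_bracket t P m x y z hzx hzy hPz hmz
    have h2 := between_fork_fork t P m x y z p q r s hpq hpr hps hqr hqs hrs hzp hzq hzr hzs hpx hpy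
      hqx hqy hrx hry hsx hsy hzx hzy hP hm
    simp only [Multiset.insert_eq_cons] at h2 k2
    rw [between_fork_comm t P m _ .two y p q rfl, between_fork_comm t P m _ .two x p q rfl,
      k1 _ _ _ (Or.inl rfl) (Or.inr rfl), k1 _ _ _ (Or.inr rfl) (Or.inl rfl), h1, h2, k2]
    module
  case two.one =>
    have h1 := hc (.two, x) (.one, y) rfl
    have h2 := between_fork_one t P m x y z p q hpq hpx hpy hqx hqy hzx hzy hP3 hm3
    simp only [Kind.grade, t2] at h1
    rw [k1 _ _ _ (Or.inl rfl) (Or.inr rfl), h1, h2]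
    module
  case two.par g =>
    have h1 := hc (.two, x) (.par g, y) rfl
    simp only [Kind.grade, t2] at h1
    rw [between_fork_comm t P m _ (.par g) y p q rfl, k1 _ _ _ (Or.inl rfl) (Or.inr rfl), h1]
    module
  case one.two =>
    have h1 := hc (.one, x) (.two, y) rfl
    have h2 := between_fork_one t P m y x z p q hpq hpy hpx hqy hqx hzy hzx hP3 hm3
    have h3 : between t P m ⟨{.tri y z x}, [(.one, z)], []⟩
        = -between t P m ⟨{.tri x z y}, [(.one, z)], []⟩ := by
      have := between_antisymm t P m 0 [(.one, z)] x z y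
      rw [between_rotate t P m 0 _ z x y, between_rotate t P m 0 _ x y z] at this
      simp only [Multiset.cons_zero] at this
      rw [this, neg_neg]
    simp only [Kind.grade, t2'] at h1
    rw [k1 _ _ _ (Or.inr rfl) (Or.inl rfl), h1, h2, h3]
    module
  case one.one =>
    have h1 := between_join t P m 0 [] [] x y
    simp only [List.nil_append, Multiset.cons_zero] at h1
    rw [h1, show koszul 1 1 = -1 by norm_num [koszul]]
    module
  case one.par g => exact hc (.one, x) (.par g, y) rfl
  case par.two g =>
    have h1 := hc (.par g, x) (.two, y) rfl
    simp only [Kind.grade, t2'] at h1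
    rw [between_fork_comm t P m _ (.par g) x p q rfl, k1 _ _ _ (Or.inr rfl) (Or.inl rfl), h1]
    module
  case par.one g => exact hc (.par g, x) (.one, y) rfl
  case par.par g g' => exact hc (.par g, x) (.par g', y) rfl

end Local
theorem mix_even_apply (f g : ℕ → ℕ) (n : ℕ) : mix f g (evenName n) = evenName (f n) :=
  congrFun (mix_even f g) n

theorem mix_odd_apply (f g : ℕ → ℕ) (n : ℕ) : mix f g (oddName n) = oddName (g n) :=
  congrFun (mix_odd f g) n

theorem even_ne_odd (m n : ℕ) : evenName m ≠ oddName n := by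
  simp only [evenName, oddName]; omega

theorem ren_replaceLeg (f : ℕ → ℕ) (l : Kind × ℕ) (p q : ℕ) (m : Comb) :
    ren f (replaceLeg l p q m) = replaceLeg (Prod.map id f l) (f p) (f q) (ren f m) := by
  simp only [replaceLeg, forkPart, LinearMap.add_apply, map_add, ren_pre, Prod.map_fst, id]
  split_ifs
  · simp [ren_pre, Raw.relabel, Node.relabel]
  · simp [Raw.relabel]

theorem ren_replaceLegs (f : ℕ → ℕ) (o : List (Par × ℕ)) (j : ℕ) (w : List (Kind × ℕ)) :
    ∀ i, (∀ k, i ≤ k → f (oddName k) = oddName (k + j)) →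
      ren f (replaceLegs o i w)
        = replaceLegs (o.map (Prod.map id f)) (i + j) (w.map (Prod.map id f)) := by
  induction w with
  | nil => intro i _; simp [replaceLegs, ren_single, Raw.relabel]
  | cons l w ih =>
    intro i h
    rw [replaceLegs, ren_replaceLeg, ih (i + 2) (fun k hk => h k (by omega)), h i le_rfl,
      h (i + 1) (by omega), List.map_cons, replaceLegs]
    rw [show i + 1 + j = i + j + 1 by omega, show i + 2 + j = i + j + 2 by omega]

/-- Give even names to the edges of a word of legs. -/
def evenLegs (w : List (Kind × ℕ)) : List (Kind × ℕ) := w.map (Prod.map id evenName)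

def evenOps (o : List (Par × ℕ)) : List (Par × ℕ) := o.map (Prod.map id evenName)

/-- Move the odd names, from the `n`-th on, by `j`. -/
def shift (n j : ℕ) : ℕ → ℕ := mix id (fun i => if n ≤ i then i + j else i)

theorem shift_injective (n j : ℕ) : Function.Injective (shift n j) := by
  refine mix_injective Function.injective_id ?_
  intro a b h
  simp only at h
  split_ifs at h <;> omega

theorem ren_shift (o : List (Par × ℕ)) (n j : ℕ) (w : List (Kind × ℕ)) :
    ren (shift n j) (replaceLegs (evenOps o) n (evenLegs w))
      = replaceLegs (evenOps o) (n + j) (evenLegs w) := by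
  rw [ren_replaceLegs _ _ j]
  · congr 1 <;> simp [evenOps, evenLegs, shift, mix_even_apply]
  · intro k hk
    simp [shift, mix_odd_apply, hk]

theorem replaceLegs_named {S : ℕ → Prop} (o : List (Par × ℕ)) (w : List (Kind × ℕ))
    (ho : ∀ l ∈ o, S l.2) (hw : ∀ l ∈ w, S l.2) :
    ∀ n, (∀ k, n ≤ k → S (oddName k)) → replaceLegs o n w ∈ named S := by
  induction w with
  | nil =>
    intro n _
    refine Finsupp.single_mem_supported _ _ ?_
    simp only [Set.mem_ofPred_eq, Raw.labels, Multiset.zero_bind, List.map_nil, Multiset.coe_nil,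
      zero_add, Multiset.mem_coe, List.mem_map]
    rintro d ⟨l, hl, rfl⟩
    exact ho l hl
  | cons l w ih =>
    intro n h
    have h1 := ih (fun l hl => hw l (List.mem_cons_of_mem _ hl)) (n + 2) (fun k hk => h k (by omega))
    have h2 := h n le_rfl
    have h3 := h (n + 1) (by omega)
    have h4 := hw l (List.mem_cons_self ..)
    rw [replaceLegs, replaceLeg, LinearMap.add_apply, forkPart]
    refine add_mem (pre_mem_named ?_ h1) ?_
    · simpa [Raw.labels] using h4
    · split_ifs
      · refine Submodule.smul_mem _ _ (pre_mem_named ?_ h1)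
        intro z hz
        simp [Raw.labels, Node.labels] at hz
        rcases hz with rfl | rfl | rfl | rfl | rfl <;> assumption
      · exact zero_mem _

theorem replaceLegs_exchange (t : ℕ × ℕ) (o : List (Par × ℕ)) (k l : Kind) (x y z : ℕ)
    (s : List (Kind × ℕ)) (hs : ∀ a ∈ s, z ≠ a.2) (ho : ∀ a ∈ o, z ≠ a.2) (hzx : z ≠ x)
    (hzy : z ≠ y) (p : List (Kind × ℕ)) (hp : ∀ a ∈ p, z ≠ a.2) :
    ∀ (n : ℕ) (P : Raw),
      (∀ d ∈ P.labels, (∃ e, d = evenName e ∧ e ≠ z) ∨ ∃ i, i < n ∧ d = oddName i) →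
      cls .hatF t (pre P (replaceLegs (evenOps o) n (evenLegs (p ++ (k, x) :: (l, y) :: s))))
        = koszul k.grade l.grade • cls .hatF t
            (pre P (replaceLegs (evenOps o) n (evenLegs (p ++ (l, y) :: (k, x) :: s))))
          + match Theory.exch .hat k l with
            | .bracket m => cls .hatF t (pre ⟨{.tri (evenName x) (evenName z) (evenName y)}, [], []⟩
                (pre P (replaceLegs (evenOps o) n (evenLegs (p ++ (m, z) :: s)))))
            | .join => cls .hatF t (pre ⟨{.joint (evenName x) (evenName y)}, [], []⟩
                (pre P (replaceLegs (evenOps o) n (evenLegs (p ++ s)))))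
            | _ => 0 := by
  induction p with
  | nil =>
    intro n P hP
    have hP' : ∀ d ∈ P.labels, d ≠ evenName z ∧ d ≠ oddName n ∧ d ≠ oddName (n + 1)
        ∧ d ≠ oddName (n + 2) ∧ d ≠ oddName (n + 2 + 1) := by
      intro d hd
      rcases hP d hd with ⟨e, rfl, he⟩ | ⟨i, hi, rfl⟩
      · exact ⟨evenName_injective.ne he, even_ne_odd _ _, even_ne_odd _ _, even_ne_odd _ _,
          even_ne_odd _ _⟩
      · refine ⟨(even_ne_odd _ _).symm, ?_, ?_, ?_, ?_⟩ <;> simp only [oddName] <;> omega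
    have hm : replaceLegs (evenOps o) (n + 2 + 2) (evenLegs s) ∈ named (fun d => d ≠ evenName z ∧
        d ≠ oddName n ∧ d ≠ oddName (n + 1) ∧ d ≠ oddName (n + 2) ∧ d ≠ oddName (n + 2 + 1)) := by
      refine replaceLegs_named _ _ ?_ ?_ _ ?_
      · intro a ha
        simp only [evenOps, List.mem_map] at ha
        obtain ⟨b, hb, rfl⟩ := ha
        exact ⟨evenName_injective.ne (ho b hb).symm, even_ne_odd _ _, even_ne_odd _ _,
          even_ne_odd _ _, even_ne_odd _ _⟩
      · intro a ha
        simp only [evenLegs, List.mem_map] at ha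
        obtain ⟨b, hb, rfl⟩ := ha
        exact ⟨evenName_injective.ne (hs b hb).symm, even_ne_odd _ _, even_ne_odd _ _,
          even_ne_odd _ _, even_ne_odd _ _⟩
      · intro i hi
        refine ⟨(even_ne_odd _ _).symm, ?_, ?_, ?_, ?_⟩ <;> simp only [oddName] <;> omega
    have hlt : ∀ i j, i < j → oddName i ≠ oddName j := fun i j h => by simp only [oddName]; omega
    have h := replaceLeg_exchange t P _ k l (evenName x) (evenName y) (evenName z) (oddName n)
      (oddName (n + 1)) (oddName (n + 2)) (oddName (n + 2 + 1)) (hlt _ _ (by omega))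
      (hlt _ _ (by omega)) (hlt _ _ (by omega)) (hlt _ _ (by omega)) (hlt _ _ (by omega))
      (hlt _ _ (by omega)) (even_ne_odd _ _) (even_ne_odd _ _) (even_ne_odd _ _) (even_ne_odd _ _)
      (even_ne_odd _ _).symm (even_ne_odd _ _).symm (even_ne_odd _ _).symm (even_ne_odd _ _).symm
      (even_ne_odd _ _).symm (even_ne_odd _ _).symm (even_ne_odd _ _).symm (even_ne_odd _ _).symm
      (evenName_injective.ne hzx) (evenName_injective.ne hzy) hP' hm
    simp only [List.nil_append, evenLegs, List.map_cons, Prod.map, id, replaceLegs] at h ⊢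
    refine h.trans ?_
    congr 1
    have hfix : ∀ j i, n ≤ i → P.relabel (shift i j) = P := by
      intro j i hi
      refine relabel_eq_self fun d hd => ?_
      rcases hP d hd with ⟨e, rfl, he⟩ | ⟨i', hi', rfl⟩
      · simp [shift, mix_even_apply]
      · rw [shift, mix_odd_apply, if_neg (by omega)]
    have hcomm : ∀ (N : Node) (Z : Comb), pre P (pre ⟨{N}, [], []⟩ Z) = pre ⟨{N}, [], []⟩ (pre P Z) := by
      intro N Z
      rw [pre_pre, pre_pre]
      simp [add_comm]
    cases Theory.exch .hat k l with
    | free => rfl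
    | comm => rfl
    | bracket m =>
      simp only
      rw [hcomm, ← cls_ren t (shift_injective (n + 2) 2) (pre _ (pre P (replaceLeg _ _ _
        (replaceLegs _ (n + 2) _))))]
      rw [ren_pre, ren_pre, ren_replaceLeg, hfix 2 (n + 2) (by omega)]
      have := ren_shift o (n + 2) 2 s
      rw [evenLegs] at this
      change _ = cls .hatF t (pre _ (pre P (replaceLeg _ _ _ (ren (shift (n + 2) 2)
        (replaceLegs (evenOps o) (n + 2) (List.map (Prod.map id evenName) s))))))
      rw [this]
      simp [Raw.relabel, Node.relabel, shift, mix_even_apply, mix_odd_apply, Prod.map]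
    | join =>
      simp only
      rw [hcomm, ← cls_ren t (shift_injective n 4) (pre _ (pre P (replaceLegs _ n _)))]
      rw [ren_pre, ren_pre, hfix 4 n le_rfl]
      have := ren_shift o n 4 s
      rw [evenLegs] at this
      change _ = cls .hatF t (pre _ (pre P (ren (shift n 4)
        (replaceLegs (evenOps o) n (List.map (Prod.map id evenName) s)))))
      rw [this]
      simp [Raw.relabel, Node.relabel, shift, mix_even_apply]
  | cons a p ih =>
    intro n P hP
    have ih' := ih (fun b hb => hp b (List.mem_cons_of_mem _ hb))
    have ha := hp a (List.mem_cons_self ..)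
    have c1 := ih' (n + 2) ⟨P.nodes + 0, P.legs ++ [(a.1, evenName a.2)], []⟩ (by
      intro d hd
      have : d ∈ P.labels ∨ d = evenName a.2 := by
        simp only [Raw.labels, Multiset.mem_add, Multiset.mem_coe, List.map_append, add_zero,
          List.mem_append, List.map_cons, List.map_nil, List.mem_singleton,
          List.not_mem_nil, or_false] at hd ⊢
        tauto
      rcases this with h | h
      · rcases hP d h with h' | ⟨i, hi, rfl⟩
        · exact Or.inl h'
        · exact Or.inr ⟨i, by omega, rfl⟩
      · exact Or.inl ⟨a.2, h, ha.symm⟩)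
    have c2 := ih' (n + 2) ⟨P.nodes + {.tri (evenName a.2) (oddName n) (oddName (n + 1))},
        P.legs ++ [(.one, oddName n), (.one, oddName (n + 1))], []⟩ (by
      intro d hd
      have : d ∈ P.labels ∨ d = evenName a.2 ∨ d = oddName n ∨ d = oddName (n + 1) := by
        simp only [Raw.labels, Multiset.mem_add, Multiset.mem_coe, List.map_append,
          List.mem_append, List.map_cons, List.map_nil, List.mem_cons, Multiset.add_bind,
          Multiset.singleton_bind, Node.labels, Multiset.insert_eq_cons, Multiset.mem_cons,
          Multiset.mem_singleton, List.not_mem_nil, or_false] at hd ⊢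
        tauto
      rcases this with h | h | h | h
      · rcases hP d h with h' | ⟨i, hi, rfl⟩
        · exact Or.inl h'
        · exact Or.inr ⟨i, by omega, rfl⟩
      · exact Or.inl ⟨a.2, h, ha.symm⟩
      · exact Or.inr ⟨n, by omega, h⟩
      · exact Or.inr ⟨n + 1, by omega, h⟩)
    have e : ∀ w, pre P (replaceLegs (evenOps o) n (evenLegs (a :: w)))
        = pre ⟨P.nodes + 0, P.legs ++ [(a.1, evenName a.2)], []⟩
            (replaceLegs (evenOps o) (n + 2) (evenLegs w))
          + (if a.1 = .two then (1 / 2 : ℚ) else 0) •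
            pre ⟨P.nodes + {.tri (evenName a.2) (oddName n) (oddName (n + 1))},
              P.legs ++ [(.one, oddName n), (.one, oddName (n + 1))], []⟩
            (replaceLegs (evenOps o) (n + 2) (evenLegs w)) := by
      intro w
      rw [evenLegs, List.map_cons, replaceLegs, replaceLeg, forkPart, LinearMap.add_apply, map_add,
        pre_pre]
      congr 1
      simp only [Prod.map_fst, id, Prod.map_snd]
      split_ifs
      · rw [LinearMap.smul_apply, map_smul, pre_pre]
        rfl
      · simp
    simp only [List.cons_append]
    generalize (if a.1 = .two then (1 / 2 : ℚ) else 0) = c at e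
    rw [e, e]
    cases hx : Theory.exch .hat k l with
    | free =>
      simp only [hx] at c1 c2 ⊢
      rw [map_add, map_add, map_smul, map_smul, c1, c2]
      module
    | comm =>
      simp only [hx] at c1 c2 ⊢
      rw [map_add, map_add, map_smul, map_smul, c1, c2]
      module
    | bracket m =>
      simp only [hx] at c1 c2 ⊢
      rw [e, map_add, map_add, map_add, map_add, map_smul, map_smul, map_smul, map_smul, c1, c2]
      module
    | join =>
      simp only [hx] at c1 c2 ⊢
      rw [e, map_add, map_add, map_add, map_add, map_smul, map_smul, map_smul, map_smul, c1, c2]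
      module

theorem replaceLegs_ops (o o' : List (Par × ℕ)) (c : ℚ)
    (h : δ ⟨0, [], o⟩ - c • δ ⟨0, [], o'⟩ ∈ opIdeal) (w : List (Kind × ℕ)) :
    ∀ n, replaceLegs o n w - c • replaceLegs o' n w ∈ opIdeal := by
  induction w with
  | nil => intro n; exact h
  | cons l w ih =>
    intro n
    rw [replaceLegs, replaceLegs, ← map_smul, ← map_sub, replaceLeg, LinearMap.add_apply, forkPart]
    refine add_mem (pre_opIdeal _ (ih _)) ?_
    split_ifs
    · exact Submodule.smul_mem _ _ (pre_opIdeal _ (ih _))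
    · exact zero_mem _

theorem pre_count (d : Raw) (y c : ℕ) {m : Comb}
    (hm : m ∈ Finsupp.supported ℚ ℚ {r : Raw | r.labels.count y = c}) :
    pre d m ∈ Finsupp.supported ℚ ℚ
      {r : Raw | r.labels.count y = (⟨d.nodes, d.legs, []⟩ : Raw).labels.count y + c} := by
  rw [Finsupp.supported_eq_span_single] at hm
  have : Submodule.span ℚ ((fun i => Finsupp.single i (1 : ℚ)) '' {r : Raw | r.labels.count y = c})
      ≤ (Finsupp.supported ℚ ℚ {r : Raw | r.labels.count y
        = (⟨d.nodes, d.legs, []⟩ : Raw).labels.count y + c}).comap (pre d) := by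
    rw [Submodule.span_le]
    rintro _ ⟨r, hr, rfl⟩
    rw [SetLike.mem_coe, Submodule.mem_comap, pre_single]
    refine Finsupp.single_mem_supported _ _ ?_
    rw [Set.mem_ofPred_eq] at hr ⊢
    rw [prepend_labels, Multiset.count_add, hr]
  exact this hm

theorem replaceLegs_count (o : List (Par × ℕ)) (y : ℕ) (w : List (Kind × ℕ)) :
    ∀ n, replaceLegs o n w ∈ Finsupp.supported ℚ ℚ
      {r : Raw | r.labels.count (evenName y) = (⟨0, w, o⟩ : Raw).labels.count (evenName y)} := by
  induction w with
  | nil => intro n; exact Finsupp.single_mem_supported _ _ rfl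
  | cons l w ih =>
    intro n
    rw [replaceLegs, replaceLeg, LinearMap.add_apply, forkPart, Raw.labels_legs_cons,
      Multiset.count_add]
    refine add_mem ?_ ?_
    · have := pre_count ⟨0, [l], []⟩ (evenName y) _ (ih (n + 2))
      convert this using 6
      simp [Raw.labels]
    · split_ifs
      · have := pre_count ⟨{.tri l.2 (oddName n) (oddName (n + 1))},
          [(.one, oddName n), (.one, oddName (n + 1))], []⟩ (evenName y) _ (ih (n + 2))
        refine Submodule.smul_mem _ _ ?_
        convert this using 6
        have h' : ∀ k, oddName k ≠ evenName y := fun k => (even_ne_odd y k).symm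
        simp [Raw.labels, Node.labels, Multiset.count_singleton, h', List.count_cons]
        exact if_congr eq_comm rfl rfl
      · exact zero_mem _

/-- Extend `toCurvature` linearly. -/
def toCurvatureLin : Comb →ₗ[ℚ] Comb := Finsupp.linearCombination ℚ toCurvature

theorem toCurvature_eq (N : Multiset Node) (w : List (Kind × ℕ)) (o : List (Par × ℕ)) :
    toCurvature ⟨N, w, o⟩
      = pre ⟨N.map (Node.relabel evenName), [], []⟩ (replaceLegs (evenOps o) 0 (evenLegs w)) := rfl

theorem toCurvature_exchange (t : ℕ × ℕ) (N : Multiset Node) (p s : List (Kind × ℕ))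
    (q : List (Par × ℕ)) (k l : Kind) (x y z : ℕ)
    (hz : z ∉ (⟨N, p ++ (k, x) :: (l, y) :: s, q⟩ : Raw).labels) :
    cls .hatF t (toCurvature ⟨N, p ++ (k, x) :: (l, y) :: s, q⟩)
      = koszul k.grade l.grade • cls .hatF t (toCurvature ⟨N, p ++ (l, y) :: (k, x) :: s, q⟩)
        + match Theory.exch .hat k l with
          | .bracket m => cls .hatF t (toCurvature ⟨.tri x z y ::ₘ N, p ++ (m, z) :: s, q⟩)
          | .join => cls .hatF t (toCurvature ⟨.joint x y ::ₘ N, p ++ s, q⟩)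
          | _ => 0 := by
  simp only [Raw.labels, Multiset.mem_add, Multiset.mem_coe, List.map_append, List.map_cons,
    List.mem_append, List.mem_cons, not_or, List.mem_map, Multiset.mem_bind, not_exists,
    not_and] at hz
  obtain ⟨⟨hN, hp, hx, hy, hs⟩, hq⟩ := hz
  have h := replaceLegs_exchange t q k l x y z s (fun a ha h => hs a ha h.symm)
    (fun a ha h => hq a ha h.symm) hx hy p (fun a ha h => hp a ha h.symm) 0
    ⟨N.map (Node.relabel evenName), [], []⟩ (by
      intro d hd
      left
      simp only [Raw.labels, List.map_nil, Multiset.coe_nil, add_zero, Multiset.bind_map,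
        Raw.node_labels_relabel, Multiset.mem_bind, Multiset.mem_map] at hd
      obtain ⟨n, hn, e, he, rfl⟩ := hd
      exact ⟨e, rfl, fun h => hN n hn (h ▸ he)⟩)
  simp only [toCurvature_eq]
  rw [h]
  congr 1
  cases Theory.exch .hat k l with
  | free => rfl
  | comm => rfl
  | bracket m => simp [pre_pre, Node.relabel]
  | join => simp [pre_pre, Node.relabel]

theorem toCurvature_relator (t : ℕ × ℕ) (ρ : Comb) (h : Relator .hat ρ) :
    (cls .hatF t ∘ₗ toCurvatureLin) ρ = 0 := by
  have hs : ∀ r, toCurvatureLin (δ r) = toCurvature r := by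
    intro r; simp [toCurvatureLin, Finsupp.linearCombination_single]
  have hrel : ∀ f r, Raw.relabel evenName (Raw.relabel f r)
      = Raw.relabel (mix f id) (Raw.relabel evenName r) := by
    intro f r
    rw [relabel_relabel, relabel_relabel, mix_even]
  refine descend (T := .hat) t _ evenName evenName_injective (fun f => mix f id)
    (fun f hf => mix_injective hf Function.injective_id)
    (fun x y => (mix_update_even x y).symm) (fun r f => ?_) (fun r n => ?_) (fun r y => ?_)
    ?_ ?_ ?_ ?_ ρ h
  · rw [hs, hs, toCurvature, hrel, toCurvature, ren_pre,
      ren_replaceLegs _ _ 0 _ 0 (fun k _ => by simp [mix_odd_apply])]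
    rfl
  · obtain ⟨N, w, o⟩ := r
    rw [hs, hs, Raw.add, toCurvature_eq, toCurvature_eq, pre_pre]
    simp
  · obtain ⟨N, w, o⟩ := r
    rw [hs, toCurvature_eq]
    have := pre_count ⟨N.map (Node.relabel evenName), [], []⟩ (evenName y) _
      (replaceLegs_count (evenOps o) y (evenLegs w) 0)
    convert this using 6
    have e : (⟨N, w, o⟩ : Raw).labels.count y
        = ((⟨N, w, o⟩ : Raw).relabel evenName).labels.count (evenName y) := by
      rw [Raw.labels_relabel, Multiset.count_map_eq_count' _ _ evenName_injective]
    rw [e, labels_split, Multiset.count_add]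
    rfl
  · intro N w p s d e
    rw [map_sub, map_smul, hs, hs, toCurvature_eq, toCurvature_eq, ← map_smul, ← map_sub]
    refine cls_opIdeal (pre_opIdeal _ (replaceLegs_ops _ _ _ ?_ _ _)) t
    simp only [evenOps, List.map_append, List.map_cons, Prod.map, id]
    exact Submodule.subset_span ⟨0, [], evenOps p, evenOps s, (d.1, evenName d.2),
      (e.1, evenName e.2), rfl⟩
  · intro N p s q k l x y hk
    obtain ⟨z, hz⟩ := exists_new (⟨N, p ++ (k, x) :: (l, y) :: s, q⟩ : Raw).labels
    have := toCurvature_exchange t N p s q k l x y z hz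
    simp only [hk, add_zero] at this
    rw [map_sub, map_sub, map_smul, map_smul, hs, hs, this, sub_self]
  · intro N p s q k l m x y z hk hz
    have := toCurvature_exchange t N p s q k l x y z hz
    simp only [hk] at this
    rw [map_sub, map_sub, map_sub, map_sub, map_smul, map_smul, hs, hs, hs, this]
    module
  · intro N p s q k l x y hk
    obtain ⟨z, hz⟩ := exists_new (⟨N, p ++ (k, x) :: (l, y) :: s, q⟩ : Raw).labels
    have := toCurvature_exchange t N p s q k l x y z hz
    simp only [hk] at this
    rw [map_sub, map_sub, map_sub, map_sub, map_smul, map_smul, hs, hs, hs, this]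
    module

/-- The map `B : 𝒲^ → 𝒲^_F` which replaces each leg of grade 2 by a curvature leg plus half a
fork. -/
def curvatureMap : WHat →ₗ[ℚ] WHatF :=
  lift (0, 0) (cls .hatF (0, 0) ∘ₗ toCurvatureLin) (toCurvature_relator (0, 0))

/-! ### The exponents -/

/-- An edge joining a parameter leg `a` to a leg of grade 2 on its right, plus an edge joining a
parameter leg `b` to a leg of grade 1 on its right. -/
def generator : Series .hat :=
  diagram .hat ⟨0, [(.par .a, 0), (.two, 0)], []⟩ + diagram .hat ⟨0, [(.par .b, 0), (.one, 0)], []⟩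

/-- An edge joining a parameter leg `a` to a curvature leg on its right, plus half a fork, with a
parameter leg `a` at its stem and two legs of grade 1 on the right of it, plus an edge joining a
parameter leg `b` to a leg of grade 1 on its right. -/
def generatorF : Series .hatF :=
  diagram .hatF ⟨0, [(.par .a, 0), (.two, 0)], []⟩
    + (1 / 2 : ℚ) • diagram .hatF ⟨{.tri 0 1 2}, [(.par .a, 0), (.one, 1), (.one, 2)], []⟩
    + diagram .hatF ⟨0, [(.par .b, 0), (.one, 0)], []⟩

end Weil

end

/-!
The idea is that `P` has even grade and that its only reaction to an operator leg is to release the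
leg which the operator leg stands for.  Hence an operator leg `d`, pushed through `P # ⋯ # P`, acts
as a graded derivation: it passes each factor without a sign, and from each factor there is a term
in which the parameter leg of the factor is joined to `d`, so that an ordinary leg on the edge of
`d` takes the place of the factor (`pushOp_factor`).  The new leg has the grade of `d` and is passed
by later operator legs with the corresponding sign (`pushOp_contracted`).

Pushing the operator legs of `Op(v)`, beginning with the right-most one, through the `m`-th power of
`P` therefore inserts them, one by one and with the Koszul signs, in all possible ways
(`pushOp_shuffle`).  Inserting one letter after another in all ways produces every permutation
exactly once, with its Koszul sign (`sum_perm_succ`), which gives `pushes_shuffle`.  Once parameters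
and operator legs are set to zero, the number `n` of operator legs must equal `m`, and the factor
`1/n!` of the exponential turns the sum over permutations into the average (`setZero_single`).

The two exponents are treated together: in `factor c` the leg of grade 2 comes with `c` times a
fork, so that `c = 0` is `P` and `c = 1/2` is `P^F`.  In the second case the leg released is
precisely what the change of basis map puts in place of a leg of grade 2 (`cls_opLegs_half`).

The names of the edges need care, because the smoothing relation applies only to edges whose names
are fresh.  The powers of the exponent are therefore represented by explicit words with explicit
distinct names (`hashPow_exponent`), the joints are kept during all the pushing, and they are
smoothed away at the end (`cls_fullyContracted`).  Convergence follows from the fact that pushing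
operator legs conserves the difference of parameter grade and operator grade (`operate_weight`).
-/

noncomputable section

namespace Weil

/-! ### Graded insertions and permutations -/

/-- The sum of the values of `φ` at the words obtained by inserting the letter `d` into a word, with
the sign which arises when `d`, standing at first at the left-hand end, is moved to its place. -/
def insertSum {A M : Type} [AddCommGroup M] [Module ℚ M] (g : A → ℕ) (d : A) :
    List A → (List A → M) → M
  | [], φ => φ [d]
  | e :: u, φ => φ (d :: e :: u) + koszul (g d) (g e) • insertSum g d u fun v => φ (e :: v)

theorem insertSum_add {A M : Type} [AddCommGroup M] [Module ℚ M] (g : A → ℕ) (d : A) (u : List A)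
    (φ ψ : List A → M) :
    insertSum g d u (fun v => φ v + ψ v) = insertSum g d u φ + insertSum g d u ψ := by
  induction u generalizing φ ψ with
  | nil => rfl
  | cons e u ih => simp only [insertSum, ih]; module

theorem map_insertSum {A M M' : Type} [AddCommGroup M] [Module ℚ M] [AddCommGroup M']
    [Module ℚ M'] (F : M →ₗ[ℚ] M') (g : A → ℕ) (d : A) (u : List A) (φ : List A → M) :
    F (insertSum g d u φ) = insertSum g d u fun v => F (φ v) := by
  induction u generalizing φ with
  | nil => rfl
  | cons e u ih => simp only [insertSum, map_add, map_smul, ih]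

theorem insertSum_ofFn {A M : Type} [AddCommGroup M] [Module ℚ M] (g : A → ℕ) (d : A) {n : ℕ}
    (h : Fin n → A) (φ : List A → M) :
    insertSum g d (List.ofFn h) φ
      = ∑ i : Fin (n + 1), (∏ j : Fin n, if j.castSucc < i then koszul (g d) (g (h j)) else 1)
        • φ (List.ofFn (i.insertNth d h : Fin (n + 1) → A)) := by
  induction n generalizing φ with
  | zero =>
    simp [insertSum]
  | succ n ih =>
    rw [List.ofFn_succ, insertSum, ih, Fin.sum_univ_succ (n := n + 1), Finset.smul_sum]
    congr 1
    · simp [Fin.insertNth_zero', List.ofFn_succ]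
    · refine Finset.sum_congr rfl fun i _ => ?_
      rw [Fin.prod_univ_succ, smul_smul]
      congr 1
      · simp only [Fin.castSucc_zero, Fin.succ_pos, if_true, ← Fin.succ_castSucc,
          Fin.succ_lt_succ_iff]
      · have := Fin.insertNth_succ_cons i d (h 0) fun k => h k.succ
        rw [show (Fin.cons (h 0) fun k => h k.succ : Fin (n + 1) → A) = h from
          Fin.cons_self_tail h] at this
        rw [this, List.ofFn_cons]

/-- The permutation of `n + 1` letters which moves the first letter to the place `i` and arranges
the others according to `τ`. -/
def permInsert {n : ℕ} (i : Fin (n + 1)) (τ : Equiv.Perm (Fin n)) : Equiv.Perm (Fin (n + 1)) :=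
  (finSuccEquiv' i).trans ((Equiv.optionCongr τ).trans (finSuccEquiv' 0).symm)

theorem permInsert_self {n : ℕ} (i : Fin (n + 1)) (τ : Equiv.Perm (Fin n)) :
    permInsert i τ i = 0 := by
  simp [permInsert]

theorem permInsert_succAbove {n : ℕ} (i : Fin (n + 1)) (τ : Equiv.Perm (Fin n)) (j : Fin n) :
    permInsert i τ (i.succAbove j) = (τ j).succ := by
  simp [permInsert]

theorem permInsert_bijective (n : ℕ) :
    Function.Bijective fun p : Fin (n + 1) × Equiv.Perm (Fin n) => permInsert p.1 p.2 := by
  rw [Fintype.bijective_iff_injective_and_card]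
  constructor
  · rintro ⟨i, τ⟩ ⟨j, τ'⟩ h
    simp only at h
    obtain rfl : i = j := by
      apply (permInsert i τ).injective
      rw [permInsert_self, h, permInsert_self]
    congr
    ext k : 1
    apply Fin.succ_injective
    rw [← permInsert_succAbove i, h, permInsert_succAbove]
  · simp [Fintype.card_perm, Nat.factorial_succ]

theorem comp_permInsert {A : Type} {n : ℕ} (f : Fin (n + 1) → A) (i : Fin (n + 1))
    (τ : Equiv.Perm (Fin n)) :
    (fun k => f (permInsert i τ k)) = i.insertNth (f 0) fun k => f (τ k).succ := by
  rw [Fin.eq_insertNth_iff]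
  refine ⟨by rw [permInsert_self], ?_⟩
  funext k
  simp [Fin.removeNth, permInsert_succAbove]

theorem koszulSign_permInsert {n : ℕ} (g : Fin (n + 1) → ℕ) (i : Fin (n + 1))
    (τ : Equiv.Perm (Fin n)) :
    koszulSign g (permInsert i τ) = koszulSign (fun k => g k.succ) τ
      * ∏ j : Fin n, if j.castSucc < i then koszul (g 0) (g (τ j).succ) else 1 := by
  have h : ∀ j : Fin n, (i.succAbove j < i) = (j.castSucc < i) := fun j =>
    propext (Fin.succAbove_lt_iff_castSucc_lt i j)
  -- The first letter, at the place `i`, has changed places with exactly those to the left of it.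
  rw [koszulSign, Fin.prod_univ_succAbove _ i]
  simp only [Fin.prod_univ_succAbove _ i, permInsert_self, permInsert_succAbove, Fin.not_lt_zero,
    and_false, if_false, Fin.succAbove_lt_succAbove_iff, Fin.succ_lt_succ_iff, Finset.prod_const_one,
    mul_one, Fin.succ_pos, and_true, h, Finset.prod_mul_distrib, one_mul, koszulSign]
  rw [mul_comm]
  congr 1
  exact Finset.prod_congr rfl fun j _ => by rw [koszul_symm]

/-- Every arrangement of `n + 1` letters arises exactly once from an arrangement of the last `n` of
them by inserting the first one, and the signs agree. -/
theorem sum_perm_succ {A M : Type} [AddCommGroup M] [Module ℚ M] (g : A → ℕ) {n : ℕ}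
    (f : Fin (n + 1) → A) (φ : List A → M) :
    ∑ σ : Equiv.Perm (Fin (n + 1)), koszulSign (fun k => g (f k)) σ
        • φ (List.ofFn fun k => f (σ k))
      = ∑ τ : Equiv.Perm (Fin n), koszulSign (fun k => g (f k.succ)) τ
        • insertSum g (f 0) (List.ofFn fun k => f (τ k).succ) φ := by
  rw [← (permInsert_bijective n).sum_comp, Fintype.sum_prod_type_right]
  refine Finset.sum_congr rfl fun τ _ => ?_
  rw [insertSum_ofFn, Finset.smul_sum]
  refine Finset.sum_congr rfl fun i _ => ?_
  rw [koszulSign_permInsert, comp_permInsert, smul_smul]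

/-! ### The factors of a power of the exponent, and their contraction with operator legs -/

/-- The kind of the leg for which an operator leg stands: the inverse of `Kind.toPar`. -/
def Par.toKind : Par → Kind
  | .a => .two
  | .b => .one

/-- Put in front of a diagram the leg `l` and, if it has grade 2, also `c` times a fork, the edges
of the new legs having the names `p` and `q`.  For `c = 1/2` this is `replaceLeg`. -/
def legFork (c : ℚ) (l : Kind × ℕ) (p q : ℕ) : Comb →ₗ[ℚ] Comb :=
  pre ⟨0, [l], []⟩
    + (if l.1 = .two then c else 0) • pre ⟨{.tri l.2 p q}, [(.one, p), (.one, q)], []⟩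

/-- Put in front of a diagram what takes the place of a factor `P` or `P^F` when `d` is joined to
it: the leg for which `d` stands, with its fork. -/
def opLeg (c : ℚ) (d : Par × ℕ) (p q : ℕ) : Comb →ₗ[ℚ] Comb := legFork c (d.1.toKind, d.2) p q

/-- Put in front of a diagram one factor `P` (for `c = 0`) or `P^F` (for `c = 1/2`).  The names of
its edges are `X = (x, p, q)`; the edge `x` ends in the parameter leg. -/
def factor (c : ℚ) (X : ℕ × ℕ × ℕ) : Comb →ₗ[ℚ] Comb :=
  pre ⟨0, [(.par .a, X.1)], []⟩ ∘ₗ opLeg c (.a, X.1) X.2.1 X.2.2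
    + pre ⟨0, [(.par .b, X.1)], []⟩ ∘ₗ opLeg c (.b, X.1) X.2.1 X.2.2

/-- Put in front of a diagram what becomes of the factor with the edges `X` when the operator leg
`d` is joined to its parameter leg.  The joint is not yet smoothed away. -/
def contracted (c : ℚ) (d : Par × ℕ) (X : ℕ × ℕ × ℕ) : Comb →ₗ[ℚ] Comb :=
  pre ⟨{.joint d.2 X.1}, [], []⟩ ∘ₗ opLeg c (d.1, X.1) X.2.1 X.2.2

theorem pushOp_legFork (c : ℚ) (d : Par × ℕ) (l : Kind × ℕ) (hl : ∀ p, l.1 ≠ .par p) (p q : ℕ)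
    (m : Comb) :
    pushOp 1 d (legFork c l p q m)
      = koszul d.1.grade l.1.grade • legFork c l p q (pushOp 1 d m) := by
  have e : ∀ m, pre ⟨{.tri l.2 p q}, [(.one, p), (.one, q)], []⟩ m
      = pre ⟨{.tri l.2 p q}, [], []⟩ (pre ⟨0, [(.one, p)], []⟩ (pre ⟨0, [(.one, q)], []⟩ m)) := by
    intro m; rw [pre_pre, pre_pre]; simp
  simp only [legFork, LinearMap.add_apply, LinearMap.smul_apply, map_add, map_smul, e,
    pushOp_pre_nodes, pushOp_pre_leg, hl, if_false, zero_smul, zero_add, reduceCtorEq, smul_add,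
    smul_smul, koszul_sq]
  congr 1
  split_ifs with h
  · rw [h]; simp [koszul, Kind.grade, pow_mul']
  · simp

theorem toKind_grade (p : Par) : p.toKind.grade = p.grade := by
  cases p <;> rfl

theorem pushOp_opLeg (c : ℚ) (d e : Par × ℕ) (p q : ℕ) (m : Comb) :
    pushOp 1 d (opLeg c e p q m)
      = koszul d.1.grade e.1.grade • opLeg c e p q (pushOp 1 d m) := by
  rw [opLeg, pushOp_legFork, toKind_grade]
  intro p
  cases e.1 <;> simp [Par.toKind]

/-- Since `P` has even grade, an operator leg passes it without a sign, apart from the term where it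
is joined to the parameter leg. -/
theorem pushOp_factor (c : ℚ) (d : Par × ℕ) (X : ℕ × ℕ × ℕ) (m : Comb) :
    pushOp 1 d (factor c X m) = contracted c d X m + factor c X (pushOp 1 d m) := by
  obtain ⟨d, y⟩ := d
  simp only [factor, contracted, LinearMap.add_apply, LinearMap.comp_apply, map_add,
    pushOp_pre_leg, pushOp_opLeg, map_smul, smul_smul, Kind.grade, koszul_sq, one_smul]
  cases d <;> simp <;> abel

theorem pushOp_contracted (c : ℚ) (d e : Par × ℕ) (X : ℕ × ℕ × ℕ) (m : Comb) :
    pushOp 1 d (contracted c e X m)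
      = koszul d.1.grade e.1.grade • contracted c e X (pushOp 1 d m) := by
  simp only [contracted, LinearMap.comp_apply, pushOp_pre_nodes, pushOp_opLeg, map_smul]

/-- The sum, over all ways to choose as many of the factors with the edges `Xs` as there are operator
legs in `u`, of the diagrams in which the legs `u` are joined, in this order from left to right, to
the chosen factors. -/
def shuffle (c : ℚ) : List (Par × ℕ) → List (ℕ × ℕ × ℕ) → Comb
  | [], [] => δ ⟨0, [], []⟩
  | _ :: _, [] => 0
  | [], X :: Xs => factor c X (shuffle c [] Xs)
  | d :: u, X :: Xs => contracted c d X (shuffle c u Xs) + factor c X (shuffle c (d :: u) Xs)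

/-- Combinations of diagrams which have operator legs. -/
def withOps : Submodule ℚ Comb := Finsupp.supported ℚ ℚ {r | r.ops ≠ []}

theorem supported_le {M : Type} [AddCommGroup M] [Module ℚ M] {S : Set Raw} {U : Submodule ℚ M}
    (F : Comb →ₗ[ℚ] M) (h : ∀ r ∈ S, F (δ r) ∈ U) {m : Comb} (hm : m ∈ Finsupp.supported ℚ ℚ S) :
    F m ∈ U := by
  rw [Finsupp.supported_eq_span_single] at hm
  have : Submodule.span ℚ ((fun i => Finsupp.single i (1 : ℚ)) '' S) ≤ U.comap F := by
    rw [Submodule.span_le]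
    rintro _ ⟨r, hr, rfl⟩
    exact h r hr
  exact this hm

theorem supported_congr {M : Type} [AddCommGroup M] [Module ℚ M] {S : Set Raw}
    (F G : Comb →ₗ[ℚ] M) (h : ∀ r ∈ S, F (δ r) = G (δ r)) {m : Comb}
    (hm : m ∈ Finsupp.supported ℚ ℚ S) : F m = G m := by
  have := supported_le (U := ⊥) (F - G) (fun r hr => by simp [h r hr]) hm
  simpa [sub_eq_zero] using this

theorem pre_withOps (d : Raw) {m : Comb} (hm : m ∈ withOps) : pre d m ∈ withOps :=
  supported_le (pre d) (fun r hr => by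
    rw [pre_single]; exact Finsupp.single_mem_supported _ _ hr) hm

theorem legFork_withOps (c : ℚ) (l : Kind × ℕ) (p q : ℕ) {m : Comb} (hm : m ∈ withOps) :
    legFork c l p q m ∈ withOps :=
  add_mem (pre_withOps _ hm) (Submodule.smul_mem _ _ (pre_withOps _ hm))

theorem factor_withOps (c : ℚ) (X : ℕ × ℕ × ℕ) {m : Comb} (hm : m ∈ withOps) :
    factor c X m ∈ withOps :=
  add_mem (pre_withOps _ (legFork_withOps _ _ _ _ hm))
    (pre_withOps _ (legFork_withOps _ _ _ _ hm))

theorem contracted_withOps (c : ℚ) (d : Par × ℕ) (X : ℕ × ℕ × ℕ) {m : Comb} (hm : m ∈ withOps) :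
    contracted c d X m ∈ withOps :=
  pre_withOps _ (legFork_withOps _ _ _ _ hm)

theorem push_withOps (c : ℚ) (d : Par × ℕ) (q : List (Par × ℕ)) (hq : q ≠ [])
    (w : List (Kind × ℕ)) : push c d q w ∈ withOps := by
  induction w with
  | nil => exact Finsupp.single_mem_supported _ _ (by simp)
  | cons l w ih =>
    refine add_mem ?_ (Submodule.smul_mem _ _ (pre_withOps _ ih))
    split_ifs
    · exact Submodule.smul_mem _ _ (Finsupp.single_mem_supported _ _ hq)
    · exact zero_mem _

theorem pushOp_withOps (c : ℚ) (d : Par × ℕ) {m : Comb} (hm : m ∈ withOps) :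
    pushOp c d m ∈ withOps :=
  supported_le (pushOp c d) (fun r hr => by
    rw [pushOp_single]; exact pre_withOps _ (push_withOps c d _ hr _)) hm

/-- Joining `d` to one of the remaining factors amounts to inserting `d` into `u`. -/
theorem pushOp_shuffle (c : ℚ) (d : Par × ℕ) (u : List (Par × ℕ)) (Xs : List (ℕ × ℕ × ℕ)) :
    pushOp 1 d (shuffle c u Xs)
      - insertSum (fun e => e.1.grade) d u (fun v => shuffle c v Xs) ∈ withOps := by
  induction Xs generalizing u with
  | nil =>
    cases u with
    | nil =>
      simp only [shuffle, insertSum, pushOp_single, push, pre_nil, sub_zero]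
      exact Finsupp.single_mem_supported _ _ (by simp)
    | cons e u =>
      have : ∀ u : List (Par × ℕ),
          insertSum (fun e : Par × ℕ => e.1.grade) d u (fun _ => (0 : Comb)) = 0 := fun u => by
        simpa using (map_insertSum (0 : Comb →ₗ[ℚ] Comb) (fun e : Par × ℕ => e.1.grade) d u
          (fun _ => 0)).symm
      simp [shuffle, insertSum, this]
  | cons X Xs ih =>
    cases u with
    | nil =>
      have h := factor_withOps c X (ih [])
      simp only [shuffle, insertSum, map_sub, pushOp_factor] at h ⊢
      convert h using 1
      abel
    | cons e u =>
      have h := add_mem (factor_withOps c X (ih (e :: u)))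
        (Submodule.smul_mem _ (koszul d.1.grade e.1.grade) (contracted_withOps c e X (ih u)))
      simp only [shuffle, insertSum, map_sub, map_add, map_smul, pushOp_factor, pushOp_contracted,
        insertSum_add, map_insertSum] at h ⊢
      convert h using 1
      module

/-- Joining the operator legs `f` to factors of `P`, one after the other, produces all arrangements
of `f`, each with its sign; the other terms still have operator legs. -/
theorem pushes_shuffle (c : ℚ) (Xs : List (ℕ × ℕ × ℕ)) {n : ℕ} (f : Fin n → Par × ℕ) :
    (List.ofFn f).foldr (fun e F => pushOp 1 e ∘ₗ F) LinearMap.id (shuffle c [] Xs)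
      - ∑ σ : Equiv.Perm (Fin n), koszulSign (fun i => (f i).1.grade) σ
        • shuffle c (List.ofFn fun i => f (σ i)) Xs ∈ withOps := by
  induction n with
  | zero => simp [koszulSign]
  | succ n ih =>
    rw [sum_perm_succ (fun e : Par × ℕ => e.1.grade) f (fun v => shuffle c v Xs), List.ofFn_succ,
      List.foldr_cons, LinearMap.comp_apply]
    have h1 := pushOp_withOps 1 (f 0) (ih fun i => f i.succ)
    have h2 := sum_mem fun (τ : Equiv.Perm (Fin n)) (_ : τ ∈ Finset.univ) =>
      Submodule.smul_mem _ (koszulSign (fun i => (f i.succ).1.grade) τ)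
        (pushOp_shuffle c (f 0) (List.ofFn fun i => f (τ i).succ) Xs)
    convert add_mem h1 h2 using 1
    simp only [map_sub, map_sum, map_smul, smul_sub, Finset.sum_sub_distrib]
    abel

/-! ### Setting the parameters and the operator legs to zero -/

/-- The names of all edges in a list of triples `(x, p, q)`. -/
def edgeNames (Xs : List (ℕ × ℕ × ℕ)) : List ℕ := Xs.flatMap fun X => [X.1, X.2.1, X.2.2]

/-- The diagrams in which every operator leg of `u` is joined to the factor at the same place; zero
if there are not as many factors as operator legs. -/
def fullyContracted (c : ℚ) : List (Par × ℕ) → List (ℕ × ℕ × ℕ) → Comb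
  | [], [] => δ ⟨0, [], []⟩
  | d :: u, X :: Xs => contracted c d X (fullyContracted c u Xs)
  | _, _ => 0

/-- The product of the `opLeg c` for the letters of `u`, the forks having edges from `Xs`.  Only lists
of equal length are of interest. -/
def opLegs (c : ℚ) : List (Par × ℕ) → List (ℕ × ℕ × ℕ) → Comb
  | d :: u, X :: Xs => opLeg c d X.2.1 X.2.2 (opLegs c u Xs)
  | _, _ => δ ⟨0, [], []⟩

/-- Combinations of diagrams with parameter or operator legs. -/
def positive : Submodule ℚ Comb := Finsupp.supported ℚ ℚ {r | r.type ≠ (0, 0)}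

/-- `cls T t` picks out the diagrams of type `t` without loose ends. -/
theorem cls_eq_zero {T : Theory} {t : ℕ × ℕ} {S : Set Raw} (hS : ∀ r ∈ S, r ∉ diagrams t)
    {m : Comb} (hm : m ∈ Finsupp.supported ℚ ℚ S) : cls T t m = 0 := by
  have h : Finsupp.lsubtypeDomain (R := ℚ) (diagrams t) m = 0 := by
    rw [Finsupp.mem_supported] at hm
    ext ⟨r, hr⟩
    by_contra hne
    exact hS r (hm (Finsupp.mem_support_iff.mpr hne)) hr
  simp [cls, h]

theorem cls_positive {T : Theory} {m : Comb} (hm : m ∈ positive) : cls T (0, 0) m = 0 :=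
  cls_eq_zero (S := {r | r.type ≠ (0, 0)}) (fun _ hr h => hr h.2) hm

theorem type_prepend (d r : Raw) :
    (d.prepend r).type = ((d.legs.map fun l => l.1.parGrade).sum + r.type.1, r.type.2) := by
  simp [Raw.type, Raw.prepend]

theorem pre_positive (d : Raw) {m : Comb} (hm : m ∈ positive) : pre d m ∈ positive :=
  supported_le (pre d) (fun r hr => by
    rw [pre_single]
    refine Finsupp.single_mem_supported _ _ fun h => hr ?_
    rw [type_prepend, Prod.mk.injEq] at h
    exact Prod.ext (by simp only; omega) h.2) hm

theorem withOps_le_positive : withOps ≤ positive := by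
  refine Finsupp.supported_mono fun r hr h => hr ?_
  cases hq : r.ops with
  | nil => rfl
  | cons d q =>
    have := congrArg Prod.snd h
    simp only [Raw.type, hq, List.map_cons, List.sum_cons] at this
    cases hd : d.1 <;> simp [hd, Par.grade] at this

theorem pre_par_positive (p : Par) (x : ℕ) (m : Comb) :
    pre ⟨0, [(.par p, x)], []⟩ m ∈ positive := by
  refine supported_le (S := Set.univ) _ (fun r _ => ?_) (by simp)
  rw [pre_single]
  refine Finsupp.single_mem_supported _ _ fun h => ?_
  rw [type_prepend, Prod.mk.injEq] at h
  have := h.1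
  cases p <;> simp [Kind.parGrade, Par.grade] at this

theorem contracted_positive (c : ℚ) (d : Par × ℕ) (X : ℕ × ℕ × ℕ) {m : Comb}
    (hm : m ∈ positive) : contracted c d X m ∈ positive :=
  pre_positive _ (add_mem (pre_positive _ hm) (Submodule.smul_mem _ _ (pre_positive _ hm)))

theorem factor_positive (c : ℚ) (X : ℕ × ℕ × ℕ) (m : Comb) : factor c X m ∈ positive :=
  add_mem (pre_par_positive _ _ _) (pre_par_positive _ _ _)

/-- A term in which some factor is not joined to an operator leg has a parameter leg. -/
theorem shuffle_sub_fullyContracted (c : ℚ) (u : List (Par × ℕ)) (Xs : List (ℕ × ℕ × ℕ)) :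
    shuffle c u Xs - fullyContracted c u Xs ∈ positive := by
  induction Xs generalizing u with
  | nil => cases u <;> simp [shuffle, fullyContracted]
  | cons X Xs ih =>
    cases u with
    | nil => simpa [shuffle, fullyContracted] using factor_positive c X _
    | cons d u =>
      rw [shuffle, fullyContracted, add_sub_right_comm, ← map_sub]
      exact add_mem (contracted_positive c d X (ih u)) (factor_positive c X _)

theorem fullyContracted_eq_zero (c : ℚ) (u : List (Par × ℕ)) (Xs : List (ℕ × ℕ × ℕ))
    (h : u.length ≠ Xs.length) : fullyContracted c u Xs = 0 := by
  induction Xs generalizing u with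
  | nil => cases u <;> simp_all [fullyContracted]
  | cons X Xs ih =>
    cases u with
    | nil => rfl
    | cons d u => rw [fullyContracted, ih u (by simpa using h), map_zero]

theorem legFork_named {S : ℕ → Prop} (c : ℚ) (l : Kind × ℕ) (p q : ℕ) (hl : S l.2) (hp : S p)
    (hq : S q) {m : Comb} (hm : m ∈ named S) : legFork c l p q m ∈ named S := by
  refine add_mem (pre_mem_named ?_ hm) (Submodule.smul_mem _ _ (pre_mem_named ?_ hm))
  · simpa [Raw.labels] using hl
  · intro z hz
    simp [Raw.labels, Node.labels] at hz
    rcases hz with rfl | rfl | rfl | rfl | rfl <;> assumption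

theorem fullyContracted_named {S : ℕ → Prop} (c : ℚ) (u : List (Par × ℕ))
    (Xs : List (ℕ × ℕ × ℕ)) (hu : ∀ d ∈ u, S d.2) (hX : ∀ z ∈ edgeNames Xs, S z) :
    fullyContracted c u Xs ∈ named S := by
  induction Xs generalizing u with
  | nil =>
    cases u with
    | nil => exact Finsupp.single_mem_supported _ _ (by simp [Raw.labels])
    | cons d u => exact zero_mem _
  | cons X Xs ih =>
    cases u with
    | nil => exact zero_mem _
    | cons d u =>
      simp only [edgeNames, List.flatMap_cons, List.mem_append, List.mem_cons,
        List.not_mem_nil, or_false] at hX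
      simp only [List.mem_cons, forall_eq_or_imp] at hu
      have hx := hX X.1 (by simp)
      refine pre_mem_named ?_ (legFork_named _ _ _ _ hx (hX X.2.1 (by simp)) (hX X.2.2 (by simp))
        (ih u hu.2 fun z hz => hX z (Or.inr hz)))
      intro z hz
      simp [Raw.labels, Node.labels] at hz
      rcases hz with rfl | rfl
      · exact hu.1
      · exact hx

theorem ren_legFork (f : ℕ → ℕ) (c : ℚ) (l : Kind × ℕ) (p q : ℕ) (m : Comb) :
    ren f (legFork c l p q m) = legFork c (Prod.map id f l) (f p) (f q) (ren f m) := by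
  simp only [legFork, LinearMap.add_apply, LinearMap.smul_apply, map_add, map_smul, ren_pre]
  simp [Raw.relabel, Node.relabel]

/-- The joint of an operator leg with the edge of a leg can be smoothed away. -/
theorem cls_smooth_legFork {T : Theory} (t : ℕ × ℕ) (c : ℚ) (P : Raw) (k : Kind) (x y p q : ℕ)
    (hxy : x ≠ y) (hyp : y ≠ p) (hyq : y ≠ q) (hP : y ∉ P.labels) {m : Comb}
    (hm : m ∈ named (· ≠ y)) :
    cls T t (pre P (pre ⟨{.joint x y}, [], []⟩ (legFork c (k, y) p q m)))
      = cls T t (pre P (legFork c (k, x) p q m)) := by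
  have e : pre P (pre ⟨{.joint x y}, [], []⟩ (legFork c (k, y) p q m))
      = pre ⟨{.joint x y}, [], []⟩ (pre P (legFork c (k, y) p q m)) := by
    rw [pre_pre, pre_pre]
    simp [add_comm]
  have h1 : legFork c (k, y) p q m
      ∈ Finsupp.supported ℚ ℚ {r : Raw | r.labels.count y = 1} := by
    have hm' : m ∈ Finsupp.supported ℚ ℚ {r : Raw | r.labels.count y = 0} :=
      supported_le (S := {r | ∀ d ∈ r.labels, d ≠ y}) LinearMap.id
        (fun r hr => Finsupp.single_mem_supported _ _
        (Multiset.count_eq_zero_of_notMem fun h => hr y h rfl)) hm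
    refine add_mem ?_ (Submodule.smul_mem _ _ ?_)
    · simpa [Raw.labels] using pre_count ⟨0, [(k, y)], []⟩ y 0 hm'
    · simpa [Raw.labels, Node.labels, List.count_cons, hyp, hyq, hyp.symm, hyq.symm] using
        pre_count ⟨{.tri y p q}, [(.one, p), (.one, q)], []⟩ y 0 hm'
  have h2 := pre_count P y 1 h1
  rw [Multiset.count_eq_zero_of_notMem (not_mem_nodes hP).2.1, zero_add] at h2
  rw [e, cls_smooth' t hxy h2, ren_pre, ren_legFork,
    relabel_eq_self fun d hd => Function.update_of_ne (by rintro rfl; exact hP hd) _ _,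
    ren_eq_self (fun d hd => Function.update_of_ne hd _ _) hm]
  simp [Function.update_of_ne hyp.symm, Function.update_of_ne hyq.symm]

/-- All the joints can be smoothed away, provided that the names of the edges of the factors are
distinct and do not occur elsewhere. -/
theorem cls_fullyContracted {T : Theory} (t : ℕ × ℕ) (c : ℚ) (u : List (Par × ℕ))
    (Xs : List (ℕ × ℕ × ℕ)) (hlen : u.length = Xs.length) (hX : (edgeNames Xs).Nodup)
    (hu : ∀ d ∈ u, d.2 ∉ edgeNames Xs) (P : Raw) (hP : ∀ z ∈ edgeNames Xs, z ∉ P.labels) :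
    cls T t (pre P (fullyContracted c u Xs)) = cls T t (pre P (opLegs c u Xs)) := by
  induction Xs generalizing u P with
  | nil => cases u <;> simp_all [fullyContracted, opLegs]
  | cons X Xs ih =>
    cases u with
    | nil => simp at hlen
    | cons d u =>
      obtain ⟨x, p, q⟩ := X
      simp only [edgeNames, List.flatMap_cons, List.cons_append, List.nil_append,
        List.nodup_cons, List.mem_cons, not_or, forall_eq_or_imp] at hX hu hP
      obtain ⟨⟨hxp, hxq, hx⟩, ⟨hpq, hp⟩, hq, hXs⟩ := hX
      obtain ⟨⟨hdx, hdp, hdq, hd⟩, hu⟩ := hu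
      obtain ⟨hPx, hPp, hPq, hP⟩ := hP
      rw [fullyContracted, opLegs, contracted, LinearMap.comp_apply, opLeg, opLeg]
      rw [cls_smooth_legFork t c P _ d.2 x p q hdx hxp hxq hPx
        (fullyContracted_named c u Xs (fun e he => (hu e he).1)
          fun z hz => by rintro rfl; exact hx hz)]
      have hIH : ∀ P' : Raw, (∀ z ∈ edgeNames Xs, z ∉ P'.labels) →
          cls T t (pre P' (fullyContracted c u Xs)) = cls T t (pre P' (opLegs c u Xs)) :=
        ih u (by simpa using hlen) hXs (fun e he => (hu e he).2.2.2)
      simp only [legFork, LinearMap.add_apply, LinearMap.smul_apply, map_add, map_smul, pre_pre]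
      rw [hIH, hIH]
      all_goals
        intro z hz
        have h1 := (not_mem_nodes (hP z hz)).2.1
        have h2 : z ≠ d.2 ∧ z ≠ p ∧ z ≠ q :=
          ⟨by rintro rfl; exact hd hz, by rintro rfl; exact hp hz, by rintro rfl; exact hq hz⟩
        simp only [Raw.labels, Node.labels, Multiset.mem_add, Multiset.mem_coe, not_or,
          Multiset.add_bind, List.map_append, List.mem_append, Multiset.singleton_bind,
          Multiset.insert_eq_cons, Multiset.mem_cons, Multiset.mem_singleton, List.map_cons,
          List.map_nil, List.mem_cons, List.not_mem_nil, or_false, Multiset.zero_bind,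
          Multiset.notMem_zero] at h1 ⊢
        tauto

/-- The legs of the symmetric Weil diagram whose legs become the operator legs `u`. -/
def toLegs (u : List (Par × ℕ)) : List (Kind × ℕ) := u.map fun d => (d.1.toKind, d.2)

theorem opLegs_zero (u : List (Par × ℕ)) (Xs : List (ℕ × ℕ × ℕ)) (hlen : u.length = Xs.length) :
    opLegs 0 u Xs = δ ⟨0, toLegs u, []⟩ := by
  induction Xs generalizing u with
  | nil => cases u <;> simp_all [opLegs, toLegs]
  | cons X Xs ih =>
    cases u with
    | nil => simp at hlen
    | cons d u =>
      rw [opLegs, ih u (by simpa using hlen)]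
      simp [opLeg, legFork, pre_single, Raw.prepend, toLegs]

/-- The names of the edges of the forks in a list of triples `(x, p, q)`. -/
def forkNames (Xs : List (ℕ × ℕ × ℕ)) : List ℕ := Xs.flatMap fun X => [X.2.1, X.2.2]

theorem replaceLeg_eq (l : Kind × ℕ) (p q : ℕ) : replaceLeg l p q = legFork (1 / 2) l p q := by
  rw [replaceLeg, legFork, forkPart]
  split_ifs <;> simp

theorem ren_opLegs_half (g : ℕ → ℕ) (u : List (Par × ℕ)) (Xs : List (ℕ × ℕ × ℕ))
    (hlen : u.length = Xs.length) (n : ℕ)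
    (hg : (forkNames Xs).map g = List.range' n (forkNames Xs).length) :
    ren (mix id g) (opLegs (1 / 2) (evenOps u)
        (Xs.map (Prod.map oddName (Prod.map oddName oddName))))
      = replaceLegs [] n (evenLegs (toLegs u)) := by
  induction Xs generalizing u n with
  | nil =>
    cases u with
    | nil => simp [opLegs, toLegs, evenOps, evenLegs, replaceLegs, ren_single, Raw.relabel]
    | cons d u => simp at hlen
  | cons X Xs ih =>
    cases u with
    | nil => simp at hlen
    | cons d u =>
      obtain ⟨x, p, q⟩ := X
      simp only [forkNames, List.flatMap_cons, List.cons_append, List.nil_append, List.map_cons,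
        List.length_cons, List.range'_succ, List.cons.injEq] at hg
      have := ih u (by simpa using hlen) (n + 2) hg.2.2
      simp only [evenOps, evenLegs, toLegs, List.map_cons, opLegs, replaceLegs, opLeg,
        ren_legFork, replaceLeg_eq] at this ⊢
      rw [this]
      simp [mix_even_apply, mix_odd_apply, hg.1, hg.2.1]

/-- Distinct names can be renamed to `0, 1, …` by a map which is injective on all names. -/
theorem exists_injective_range' (w : List ℕ) (hw : w.Nodup) :
    ∃ g : ℕ → ℕ, Function.Injective g ∧ w.map g = List.range' 0 w.length := by
  refine ⟨fun x => if x ∈ w then w.idxOf x else x + w.length, ?_, ?_⟩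
  · intro x y h
    simp only at h
    split_ifs at h with hx hy hy
    · exact (List.idxOf_inj hx).mp h
    · have := List.idxOf_lt_length_of_mem hx; omega
    · have := List.idxOf_lt_length_of_mem hy; omega
    · omega
  · apply List.ext_getElem
    · simp
    · intro i h1 h2
      simp only [List.length_map] at h1
      simp [hw.idxOf_getElem]

/-- For `c = 1/2`, joining the operator legs to the factors has the effect of the change of basis
map, up to the names of the edges of the forks. -/
theorem cls_opLegs_half {T : Theory} (t : ℕ × ℕ) (u : List (Par × ℕ)) (Xs : List (ℕ × ℕ × ℕ))
    (hlen : u.length = Xs.length) (hX : (edgeNames Xs).Nodup) (N : Multiset Node) :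
    cls T t (pre ⟨N.map (Node.relabel evenName), [], []⟩ (opLegs (1 / 2) (evenOps u)
        (Xs.map (Prod.map oddName (Prod.map oddName oddName)))))
      = cls T t (toCurvature ⟨N, toLegs u, []⟩) := by
  have hX' : (forkNames Xs).Nodup := by
    refine hX.sublist ?_
    clear hX hlen
    induction Xs with
    | nil => simp [forkNames, edgeNames]
    | cons X Xs ih =>
      simp only [forkNames, edgeNames, List.flatMap_cons] at ih ⊢
      exact List.Sublist.append (by simp) ih
  obtain ⟨g, hg, hg'⟩ := exists_injective_range' (forkNames Xs) hX'
  rw [← cls_ren t (mix_injective Function.injective_id hg), ren_pre,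
    ren_opLegs_half g u Xs hlen 0 hg', toCurvature_eq]
  have : Raw.relabel (mix id g) ⟨N.map (Node.relabel evenName), [], []⟩
      = ⟨N.map (Node.relabel evenName), [], []⟩ := by
    have := relabel_relabel evenName (mix id g) ⟨N, [], []⟩
    rw [mix_even] at this
    simpa [Raw.relabel] using this
  rw [this]
  rfl

/-! ### Products of power series in terms of combinations of diagrams -/

theorem cls_single_mem {T : Theory} {t : ℕ × ℕ} {r : Raw} (hr : r ∈ diagrams t) :
    cls T t (δ r) = Submodule.Quotient.mk (Finsupp.single ⟨r, hr⟩ 1) := by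
  have : Finsupp.lsubtypeDomain (R := ℚ) (diagrams t) (δ r) = Finsupp.single ⟨r, hr⟩ 1 := by
    ext ⟨s, hs⟩
    classical
    change Finsupp.single r (1 : ℚ) s = _
    simp only [Finsupp.single_apply, Subtype.mk.injEq]
  rw [cls, LinearMap.comp_apply, this]
  rfl

theorem cls_single_notMem {T : Theory} {t : ℕ × ℕ} {r : Raw} (hr : r ∉ diagrams t) :
    cls T t (δ r) = 0 :=
  cls_eq_zero (S := {r}) (by simpa using hr) (Finsupp.single_mem_supported _ _ rfl)

theorem cls_lab {T : Theory} {t : ℕ × ℕ} {L : Multiset ℕ} (hL : ¬ ∀ x ∈ L, L.count x = 2)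
    {m : Comb} (hm : m ∈ lab L) : cls T t m = 0 :=
  cls_eq_zero (S := {r | r.labels = L}) (by rintro r rfl hr; exact hL hr.1) hm

theorem lift_cls' {T : Theory} {M : Type} [AddCommGroup M] [Module ℚ M] (t : ℕ × ℕ)
    (g : Comb →ₗ[ℚ] M) (hg : ∀ ρ, Relator T ρ → g ρ = 0) {m : Comb}
    (hm : m ∈ Finsupp.supported ℚ ℚ (diagrams t)) : lift t g hg (cls T t m) = g m :=
  supported_congr (lift t g hg ∘ₗ cls T t) g (fun r hr => by
    rw [LinearMap.comp_apply, cls_single_mem hr, lift_cls]) hm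

theorem operate_mem_lab (c : ℚ) (d e : Raw) :
    operate c d e ∈ lab ((d.relabel evenName).labels + (e.relabel oddName).labels) :=
  act_mem_lab _ _ (single_mem_lab rfl)

/-- The ends of edges have the same names in all the terms of `operate c d e`; if each name occurs
twice or not at all, then this is so in `d` and in `e`. -/
theorem closed_of_operate {d e : Raw}
    (h : ∀ x ∈ (d.relabel evenName).labels + (e.relabel oddName).labels,
      ((d.relabel evenName).labels + (e.relabel oddName).labels).count x = 2) :
    d.Closed ∧ e.Closed := by
  constructor
  · intro x hx
    have hx' : evenName x ∈ (d.relabel evenName).labels := by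
      rw [Raw.labels_relabel]; exact Multiset.mem_map_of_mem _ hx
    have := h _ (Multiset.mem_add.mpr (Or.inl hx'))
    rwa [Multiset.count_add, Multiset.count_eq_zero_of_notMem (even_notMem_odd e x), add_zero,
      Raw.labels_relabel, Multiset.count_map_eq_count' _ _ evenName_injective] at this
  · intro x hx
    have hx' : oddName x ∈ (e.relabel oddName).labels := by
      rw [Raw.labels_relabel]; exact Multiset.mem_map_of_mem _ hx
    have := h _ (Multiset.mem_add.mpr (Or.inr hx'))
    rwa [Multiset.count_add, Multiset.count_eq_zero_of_notMem (odd_notMem_even d x), zero_add,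
      Raw.labels_relabel, Multiset.count_map_eq_count' _ _ oddName_injective] at this

/-- No closedness is required: the result of operating with, or on, a diagram with a loose end has
loose ends, hence is zero. -/
theorem operateBilin_single {T : Theory} (c : ℚ) (t₁ t₂ t : ℕ × ℕ) (d e : Raw) :
    operateBilin T c t₁ t₂ t (cls T t₁ (δ d)) (cls T t₂ (δ e))
      = if d.type = t₁ ∧ e.type = t₂ then cls T t (operate c d e) else 0 := by
  by_cases hd : d ∈ diagrams t₁
  · by_cases he : e ∈ diagrams t₂
    · rw [cls_single_mem hd, cls_single_mem he, operateBilin, lift_cls,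
        Finsupp.linearCombination_single, one_smul, operateLeft, lift_cls,
        Finsupp.linearCombination_single, one_smul, if_pos ⟨hd.2, he.2⟩]
    · rw [cls_single_notMem he, map_zero]
      split_ifs with h
      · exact (cls_lab (fun h' => he ⟨(closed_of_operate h').2, h.2⟩) (operate_mem_lab c d e)).symm
      · rfl
  · rw [cls_single_notMem hd, map_zero, LinearMap.zero_apply]
    split_ifs with h
    · exact (cls_lab (fun h' => hd ⟨(closed_of_operate h').1, h.1⟩) (operate_mem_lab c d e)).symm
    · rfl

/-- The difference of the parameter grade and the operator grade. -/
def weight (r : Raw) : ℤ := r.type.1 - r.type.2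

theorem pre_weight (d : Raw) {k : ℤ} {m : Comb} (hm : m ∈ Finsupp.supported ℚ ℚ {r | weight r = k}) :
    pre d m ∈ Finsupp.supported ℚ ℚ
      {r | weight r = ((d.legs.map fun l => l.1.parGrade).sum : ℕ) + k} :=
  supported_le (pre d) (fun r hr => by
    rw [pre_single]
    refine Finsupp.single_mem_supported _ _ ?_
    rw [Set.mem_ofPred_eq] at hr ⊢
    rw [← hr, weight, weight, type_prepend]
    push_cast
    ring) hm

theorem push_weight (c : ℚ) (d : Par × ℕ) (q : List (Par × ℕ)) (w : List (Kind × ℕ)) :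
    push c d q w ∈ Finsupp.supported ℚ ℚ {r | weight r = weight ⟨0, w, q⟩ - d.1.grade} := by
  induction w with
  | nil =>
    refine Finsupp.single_mem_supported _ _ ?_
    simp [weight, Raw.type]
    ring
  | cons l w ih =>
    refine add_mem ?_ (Submodule.smul_mem _ _ ?_)
    · split_ifs with h
      · refine Submodule.smul_mem _ _ (Finsupp.single_mem_supported _ _ ?_)
        simp [weight, Raw.type, h, Kind.parGrade]
        ring
      · exact zero_mem _
    · have := pre_weight ⟨0, [l], []⟩ ih
      convert this using 4
      simp [weight, Raw.type]
      ring_nf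

theorem pushOp_weight (c : ℚ) (d : Par × ℕ) {k : ℤ} {m : Comb}
    (hm : m ∈ Finsupp.supported ℚ ℚ {r | weight r = k}) :
    pushOp c d m ∈ Finsupp.supported ℚ ℚ {r | weight r = k - d.1.grade} :=
  supported_le (pushOp c d) (fun r hr => by
    rw [Set.mem_ofPred_eq] at hr
    rw [pushOp_single]
    have := pre_weight ⟨r.nodes, [], []⟩ (push_weight c d r.ops r.legs)
    convert this using 4
    rw [← hr]
    simp [weight, Raw.type]) hm

theorem pushes_weight (c : ℚ) (p : List (Par × ℕ)) {k : ℤ} {m : Comb}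
    (hm : m ∈ Finsupp.supported ℚ ℚ {r | weight r = k}) :
    p.foldr (fun e F => pushOp c e ∘ₗ F) LinearMap.id m
      ∈ Finsupp.supported ℚ ℚ {r | weight r = k - ((p.map fun d => d.1.grade).sum : ℕ)} := by
  induction p with
  | nil => simpa using hm
  | cons e p ih =>
    have := pushOp_weight c e ih
    simp only [List.foldr_cons, LinearMap.comp_apply]
    convert this using 4
    simp
    ring_nf

/-- Joining an operator leg to a parameter leg lowers both grades by the same amount. -/
theorem operate_weight (c : ℚ) (d e : Raw) :
    operate c d e ∈ Finsupp.supported ℚ ℚ {r | weight r = weight d + weight e} := by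
  have h := pre_weight (d.relabel evenName) (pushes_weight c (d.relabel evenName).ops
    (Finsupp.single_mem_supported ℚ (1 : ℚ) (s := {r | weight r = weight (e.relabel oddName)})
      (a := e.relabel oddName) rfl))
  rw [operate, act, LinearMap.comp_apply]
  convert h using 4
  have h1 := Raw.type_relabel oddName e
  have h2 := Raw.type_relabel evenName d
  simp only [weight, h1, ← h2]
  simp only [Raw.type]
  ring_nf

theorem cls_operate_eq_zero {T : Theory} {c : ℚ} {d e : Raw} {t : ℕ × ℕ}
    (h : weight d + weight e ≠ t.1 - t.2) : cls T t (operate c d e) = 0 :=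
  cls_eq_zero (S := {r | weight r = weight d + weight e}) (fun r hr hr' => h (by
    rw [Set.mem_ofPred_eq] at hr
    rw [← hr, weight, hr'.2])) (operate_weight c d e)

theorem operateBilin_eq_zero {T : Theory} (c : ℚ) (t₁ t₂ t : ℕ × ℕ) (d : Raw)
    (h : (t₁.1 - t₁.2 : ℤ) + (t₂.1 - t₂.2) ≠ t.1 - t.2) (w : Space T t₂) :
    operateBilin T c t₁ t₂ t (cls T t₁ (δ d)) w = 0 := by
  suffices operateBilin T c t₁ t₂ t (cls T t₁ (δ d)) = 0 by rw [this, LinearMap.zero_apply]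
  refine space_ext fun e => ?_
  rw [← cls_single_mem e.2, operateBilin_single, LinearMap.zero_apply]
  split_ifs with h'
  · refine cls_operate_eq_zero ?_
    rwa [weight, weight, h'.1, h'.2]
  · rfl

/-- Placing a diagram without operator legs to the left of another one just juxtaposes them. -/
theorem operate_of_ops_eq_nil (c : ℚ) {d : Raw} (hd : d.ops = []) (e : Raw) :
    operate c d e = δ ((d.relabel evenName).prepend (e.relabel oddName)) := by
  rw [operate, act, LinearMap.comp_apply]
  simp [Raw.relabel, hd, pre_single]

/-- The product `#` in terms of representatives, the left-hand one without operator legs. -/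
theorem hash_cls (T : Theory) {m : Comb} (hm : m ∈ Finsupp.supported ℚ ℚ {r | r.ops = []})
    (m' : Comb) (t : ℕ × ℕ) :
    hash (fun t => cls T t m) (fun t => cls T t m') t
      = cls T t (actOn 0 (ren oddName m') (ren evenName m)) := by
  -- Both sides are bilinear, so that single diagrams suffice.
  let F : Comb → Comb →ₗ[ℚ] Space T t := fun m' =>
    ∑ i ∈ Finset.HasAntidiagonal.antidiagonal t.1, ∑ j ∈ Finset.HasAntidiagonal.antidiagonal t.2,
      LinearMap.flip (operateBilin T 0 (i.1, j.1) (i.2, j.2) t) (cls T (i.2, j.2) m')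
        ∘ₗ cls T (i.1, j.1)
  have hF : ∀ m m', F m' m = hash (fun t => cls T t m) (fun t => cls T t m') t := by
    intro m m'
    simp [F, hash, LinearMap.sum_apply]
  rw [← hF]
  refine supported_congr (F m') (cls T t ∘ₗ actOn 0 (ren oddName m') ∘ₗ ren evenName)
    (fun d hd => ?_) hm
  rw [Set.mem_ofPred_eq] at hd
  rw [hF]
  simp only [LinearMap.comp_apply, ren_single, actOn_single]
  let G : Comb →ₗ[ℚ] Space T t :=
    ∑ i ∈ Finset.HasAntidiagonal.antidiagonal t.1, ∑ j ∈ Finset.HasAntidiagonal.antidiagonal t.2,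
      operateBilin T 0 (i.1, j.1) (i.2, j.2) t (cls T (i.1, j.1) (δ d)) ∘ₗ cls T (i.2, j.2)
  have hG : ∀ m', G m' = hash (fun t => cls T t (δ d)) (fun t => cls T t m') t := by
    intro m'
    simp [G, hash, LinearMap.sum_apply]
  rw [← hG]
  refine comb_congr G (cls T t ∘ₗ act 0 (d.relabel evenName) ∘ₗ ren oddName) (fun e => ?_) m'
  rw [hG]
  simp only [LinearMap.comp_apply, ren_single, hash, operateBilin_single]
  change _ = cls T t (operate 0 d e)
  have ht : ((d.relabel evenName).prepend (e.relabel oddName)).type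
      = (d.type.1 + e.type.1, d.type.2 + e.type.2) := by
    simp [Raw.type, Raw.prepend, Raw.relabel, Function.comp_def, hd]
  -- Types add up, so at most one pair of types contributes.
  by_cases h : t = (d.type.1 + e.type.1, d.type.2 + e.type.2)
  · rw [Finset.sum_eq_single (d.type.1, e.type.1), Finset.sum_eq_single (d.type.2, e.type.2)]
    · simp
    · intro j _ hj
      rw [if_neg]
      rintro ⟨h1, h2⟩
      exact hj (Prod.ext (congrArg Prod.snd h1).symm (congrArg Prod.snd h2).symm)
    · intro hj
      simp [h] at hj
    · intro i _ hi
      refine Finset.sum_eq_zero fun j _ => if_neg ?_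
      rintro ⟨h1, h2⟩
      exact hi (Prod.ext (congrArg Prod.fst h1).symm (congrArg Prod.fst h2).symm)
    · intro hi
      simp [h] at hi
  · rw [operate_of_ops_eq_nil 0 hd, cls_single_notMem fun h' => h (h'.2.symm.trans ht)]
    refine Finset.sum_eq_zero fun i hi => Finset.sum_eq_zero fun j hj => if_neg ?_
    rintro ⟨h1, h2⟩
    rw [Finset.HasAntidiagonal.mem_antidiagonal] at hi hj
    exact h (by rw [h1, h2, hi, hj])

/-! ### The powers of the exponent -/

/-- Apply `f` to the names of the edges of a factor. -/
def mapEdges (f : ℕ → ℕ) : ℕ × ℕ × ℕ → ℕ × ℕ × ℕ := Prod.map f (Prod.map f f)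

/-- The exponent `P` (for `c = 0`) or `P^F` (for `c = 1/2`). -/
def exponent (T : Theory) (c : ℚ) : Series T := fun t =>
  cls T t (factor c (0, 1, 2) (δ ⟨0, [], []⟩))

theorem generator_eq : generator = exponent .hat 0 := by
  funext t
  simp [generator, diagram, exponent, factor, opLeg, legFork, pre_single, Raw.prepend, Par.toKind]

theorem generatorF_eq : generatorF = exponent .hatF (1 / 2) := by
  funext t
  simp [-Finsupp.smul_single, generatorF, diagram, exponent, factor, opLeg, legFork, pre_single,
    Raw.prepend, Par.toKind]

/-- The names of the edges of the factors in the `n`-th power of the exponent, which `operate`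
produces by renaming the edges of the left-hand diagram to even names and those of the right-hand
one to odd names. -/
def powNames : ℕ → List (ℕ × ℕ × ℕ)
  | 0 => []
  | n + 1 => (powNames n).map (mapEdges evenName) ++ [mapEdges oddName (0, 1, 2)]

theorem length_powNames (n : ℕ) : (powNames n).length = n := by
  induction n with
  | zero => rfl
  | succ n ih => simp [powNames, ih]

theorem edgeNames_map (f : ℕ → ℕ) (Xs : List (ℕ × ℕ × ℕ)) :
    edgeNames (Xs.map (mapEdges f)) = (edgeNames Xs).map f := by
  simp [edgeNames, List.flatMap_map, List.map_flatMap, mapEdges]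

theorem nodup_powNames (n : ℕ) : (edgeNames (powNames n)).Nodup := by
  induction n with
  | zero => simp [powNames, edgeNames]
  | succ n ih =>
    have : edgeNames (powNames (n + 1))
        = (edgeNames (powNames n)).map evenName ++ [0, 1, 2].map oddName := by
      rw [← edgeNames_map]
      simp [powNames, edgeNames, mapEdges]
    rw [this, List.nodup_append]
    refine ⟨ih.map evenName_injective, List.Nodup.map oddName_injective (by simp), ?_⟩
    intro x hx y hy
    obtain ⟨i, -, rfl⟩ := List.mem_map.mp hx
    obtain ⟨j, -, rfl⟩ := List.mem_map.mp hy
    exact even_ne_odd i j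

theorem ren_factor (f : ℕ → ℕ) (c : ℚ) (X : ℕ × ℕ × ℕ) (m : Comb) :
    ren f (factor c X m) = factor c (mapEdges f X) (ren f m) := by
  simp only [factor, LinearMap.add_apply, LinearMap.comp_apply, map_add, opLeg, ren_pre,
    ren_legFork]
  rfl

theorem ren_shuffle_nil (f : ℕ → ℕ) (c : ℚ) (Xs : List (ℕ × ℕ × ℕ)) :
    ren f (shuffle c [] Xs) = shuffle c [] (Xs.map (mapEdges f)) := by
  induction Xs with
  | nil => simp [shuffle, ren_single, Raw.relabel]
  | cons X Xs ih => simp only [shuffle, ren_factor, ih, List.map_cons]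

theorem actOn_shuffle_nil (c : ℚ) (Xs Ys : List (ℕ × ℕ × ℕ)) :
    actOn 0 (shuffle c [] Ys) (shuffle c [] Xs) = shuffle c [] (Xs ++ Ys) := by
  induction Xs with
  | nil => simp [shuffle, actOn_single, act, pre_nil]
  | cons X Xs ih =>
    simp only [shuffle, List.cons_append, ← ih, factor, opLeg, legFork, LinearMap.add_apply,
      LinearMap.smul_apply, LinearMap.comp_apply, map_add, map_smul, actOn_pre]

/-- There are no operator legs in a power of the exponent, and each factor has a parameter leg. -/
theorem shuffle_nil_supported (c : ℚ) (Xs : List (ℕ × ℕ × ℕ)) :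
    shuffle c [] Xs ∈ Finsupp.supported ℚ ℚ {r | r.ops = [] ∧ Xs.length ≤ r.type.1} := by
  induction Xs with
  | nil => exact Finsupp.single_mem_supported _ _ (by simp)
  | cons X Xs ih =>
    have h : ∀ (d : Raw) (k : ℕ) (m : Comb), k ≤ (d.legs.map fun l => l.1.parGrade).sum → ∀ j : ℕ,
        m ∈ Finsupp.supported ℚ ℚ {r : Raw | r.ops = [] ∧ j ≤ r.type.1} →
        pre d m ∈ Finsupp.supported ℚ ℚ {r : Raw | r.ops = [] ∧ j + k ≤ r.type.1} := by
      intro d k m hk j hm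
      refine supported_le (pre d) (fun r hr => ?_) hm
      rw [pre_single]
      refine Finsupp.single_mem_supported _ _ ⟨hr.1, ?_⟩
      rw [type_prepend]
      have := hr.2
      simp only
      omega
    have h' : ∀ (p : Par) (l : Kind × ℕ) (i j : ℕ), pre ⟨0, [(.par p, X.1)], []⟩
        (legFork c l i j (shuffle c [] Xs))
          ∈ Finsupp.supported ℚ ℚ {r | r.ops = [] ∧ (X :: Xs).length ≤ r.type.1} := by
      intro p l i j
      refine h _ 1 _ ?_ _ (add_mem (h _ 0 _ (Nat.zero_le _) _ ih)
        (Submodule.smul_mem _ _ (h _ 0 _ (Nat.zero_le _) _ ih)))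
      cases p <;> simp [Kind.parGrade, Par.grade]
    exact add_mem (h' _ _ _ _) (h' _ _ _ _)

theorem hashPow_exponent (T : Theory) (c : ℚ) (n : ℕ) :
    hashPow (exponent T c) n = fun t => cls T t (shuffle c [] (powNames n)) := by
  induction n with
  | zero => rfl
  | succ n ih =>
    funext t
    have h := hash_cls T (Finsupp.supported_mono (fun r hr => hr.1)
      (shuffle_nil_supported c (powNames n))) (shuffle c [] [(0, 1, 2)]) t
    rw [ren_shuffle_nil, ren_shuffle_nil, actOn_shuffle_nil] at h
    rw [hashPow, ih]
    exact h

theorem hashPow_eq_zero (T : Theory) (c : ℚ) (n : ℕ) (t : ℕ × ℕ) (h : t.1 < n ∨ t.2 ≠ 0) :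
    hashPow (exponent T c) n t = 0 := by
  rw [hashPow_exponent]
  refine cls_eq_zero (fun r hr hr' => ?_) (shuffle_nil_supported c (powNames n))
  obtain ⟨h1, h2⟩ := hr
  have h3 := hr'.2
  rw [length_powNames, h3] at h2
  rcases h with h | h
  · omega
  · exact h (by rw [← h3]; simp [Raw.type, h1])

theorem expConverges_exponent (T : Theory) (c : ℚ) : ExpConverges (exponent T c) := by
  intro t
  refine (Set.finite_le_nat t.1).subset fun n hn => ?_
  by_contra h
  exact hn (hashPow_eq_zero T c n t (Or.inl (not_le.mp h)))

theorem expHash_eq_sum (T : Theory) (c : ℚ) (t : ℕ × ℕ) :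
    expHash (exponent T c) t = ∑ n ∈ Finset.range (t.1 + 1),
      (1 / (n.factorial : ℚ)) • hashPow (exponent T c) n t := by
  refine finsum_eq_sum_of_support_subset _ fun n hn => ?_
  by_contra h
  refine hn ?_
  simp only
  rw [hashPow_eq_zero T c n t (Or.inl (by simpa [Nat.lt_succ_iff] using h)), smul_zero]

theorem expHash_eq_zero (T : Theory) (c : ℚ) (t : ℕ × ℕ) (h : t.2 ≠ 0) :
    expHash (exponent T c) t = 0 := by
  rw [expHash_eq_sum]
  exact Finset.sum_eq_zero fun n _ => by rw [hashPow_eq_zero T c n t (Or.inr h), smul_zero]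

/-! ### Operating on the exponential -/

theorem intoOp_cls (T : Theory) (t : ℕ × ℕ) {r : Raw} (hr : r ∈ diagrams (0, 0)) :
    intoOp T (cls .sym (0, 0) (δ r)) t = cls T t (δ (toOperator r)) := by
  rw [cls_single_mem hr]
  refine (lift_cls (0, 0) _ (intoOp_relator T t) ⟨r, hr⟩).trans ?_
  simp [Finsupp.lmapDomain_apply, Finsupp.mapDomain_single]

/-- Operating on a power of the exponent and setting everything to zero.  Only the power whose
exponent is the number of operator legs contributes. -/
theorem cls_operate_power (T : Theory) (c : ℚ) (N : Multiset Node) {n : ℕ} (f : Fin n → Par × ℕ)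
    (Xs : List (ℕ × ℕ × ℕ)) (hX : (edgeNames Xs).Nodup) :
    cls T (0, 0) (act 1 (Raw.relabel evenName ⟨N, [], List.ofFn f⟩)
        (ren oddName (shuffle c [] Xs)))
      = if n = Xs.length then ∑ σ : Equiv.Perm (Fin n), koszulSign (fun i => (f i).1.grade) σ
          • cls T (0, 0) (pre ⟨N.map (Node.relabel evenName), [], []⟩
            (opLegs c (evenOps (List.ofFn fun i => f (σ i))) (Xs.map (mapEdges oddName))))
        else 0 := by
  set f' : Fin n → Par × ℕ := fun i => Prod.map id evenName (f i) with hf'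
  have hact : act 1 (Raw.relabel evenName ⟨N, [], List.ofFn f⟩) (ren oddName (shuffle c [] Xs))
      = pre ⟨N.map (Node.relabel evenName), [], []⟩
        ((List.ofFn f').foldr (fun e F => pushOp 1 e ∘ₗ F) LinearMap.id
          (shuffle c [] (Xs.map (mapEdges oddName)))) := by
    rw [ren_shuffle_nil, act, LinearMap.comp_apply]
    simp only [Raw.relabel, List.map_ofFn]
    exact LinearMap.congr_fun (pre_congr rfl rfl) _
  have h1 := cls_positive (T := T) (pre_positive ⟨N.map (Node.relabel evenName), [], []⟩
    (withOps_le_positive (pushes_shuffle c (Xs.map (mapEdges oddName)) f')))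
  rw [map_sub, map_sub, sub_eq_zero] at h1
  rw [hact, h1, map_sum, map_sum]
  have h2 : ∀ u, cls T (0, 0) (pre ⟨N.map (Node.relabel evenName), [], []⟩
      (shuffle c u (Xs.map (mapEdges oddName)))) = cls T (0, 0)
        (pre ⟨N.map (Node.relabel evenName), [], []⟩
          (fullyContracted c u (Xs.map (mapEdges oddName)))) := by
    intro u
    rw [← sub_eq_zero, ← map_sub, ← map_sub]
    exact cls_positive (pre_positive _ (shuffle_sub_fullyContracted c u _))
  simp only [map_smul, h2]
  split_ifs with hn
  · refine Finset.sum_congr rfl fun σ _ => ?_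
    have he : evenOps (List.ofFn fun i => f (σ i)) = List.ofFn fun i => f' (σ i) := by
      simp [evenOps, List.map_ofFn, hf', Function.comp_def]
    rw [he, cls_fullyContracted]
    · rfl
    · rw [List.length_ofFn, List.length_map, hn]
    · rw [edgeNames_map]
      exact hX.map oddName_injective
    · intro d hd h
      obtain ⟨i, rfl⟩ := (List.mem_ofFn' _ _).mp hd
      rw [edgeNames_map, List.mem_map] at h
      obtain ⟨j, -, hj⟩ := h
      exact even_ne_odd _ _ hj.symm
    · intro z hz h
      rw [edgeNames_map, List.mem_map] at hz
      obtain ⟨j, -, rfl⟩ := hz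
      exact odd_notMem_even ⟨N, [], []⟩ j h
  · refine Finset.sum_eq_zero fun σ _ => ?_
    rw [fullyContracted_eq_zero, map_zero, map_zero, smul_zero]
    rwa [List.length_ofFn, List.length_map]

/-- The coefficients of type `(k, 0)` are the only ones which an operator diagram of type `(0, k)`
can turn into diagrams without parameters and operator legs. -/
theorem operateBilin_cls (T : Theory) (k : ℕ) {d : Raw} (hd : d.type = (0, k)) {m : Comb}
    (hm : m ∈ Finsupp.supported ℚ ℚ {r | r.ops = []}) :
    operateBilin T 1 (0, k) (k, 0) (0, 0) (cls T (0, k) (δ d)) (cls T (k, 0) m)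
      = cls T (0, 0) (act 1 (d.relabel evenName) (ren oddName m)) := by
  refine supported_congr (operateBilin T 1 (0, k) (k, 0) (0, 0) (cls T (0, k) (δ d))
    ∘ₗ cls T (k, 0)) (cls T (0, 0) ∘ₗ act 1 (d.relabel evenName) ∘ₗ ren oddName)
    (fun e he => ?_) hm
  rw [Set.mem_ofPred_eq] at he
  simp only [LinearMap.comp_apply, ren_single, operateBilin_single]
  change _ = cls T (0, 0) (operate 1 d e)
  have h2 : e.type.2 = 0 := by simp [Raw.type, he]
  split_ifs with h
  · rfl
  · refine (cls_operate_eq_zero fun hw => h ⟨hd, ?_⟩).symm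
    rw [weight, weight, hd, h2] at hw
    refine Prod.ext ?_ h2
    simp only at hw ⊢
    omega

/-- An operator diagram of type `(0, k)` takes to type `t` only coefficients of the exponential of
type `(t.1 + k - t.2, 0)`. -/
theorem operateOn_eq_zero (T : Theory) (c : ℚ) {d : Raw} {k : ℕ} (hd : d.type = (0, k))
    (t : ℕ × ℕ) (p : (ℕ × ℕ) × (ℕ × ℕ))
    (hp : ¬ (p.1 = (0, k) ∧ p.2.1 + t.2 = t.1 + k ∧ p.2.2 = 0)) :
    operateOn T p.1 p.2 t (cls T p.1 (δ d)) (expHash (exponent T c) p.2) = 0 := by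
  rw [operateOn]
  by_cases h1 : p.1 = (0, k)
  · by_cases h2 : p.2.2 = 0
    · refine operateBilin_eq_zero 1 _ _ _ d (fun h => hp ⟨h1, ?_, h2⟩) _
      rw [h1, h2] at h
      simp only at h
      omega
    · rw [expHash_eq_zero T c p.2 h2, map_zero]
  · rw [cls_single_notMem (fun h => h1 (h.2.symm.trans hd)), map_zero, LinearMap.zero_apply]

theorem converges_single (T : Theory) (c : ℚ) {d : Raw} {k : ℕ} (hd : d.type = (0, k)) :
    Converges (fun t => cls T t (δ d)) (expHash (exponent T c)) := by
  intro t
  refine ((Set.finite_singleton ((0, k) : ℕ × ℕ)).prod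
    ((Set.finite_le_nat (t.1 + k)).prod (Set.finite_singleton 0))).subset fun p hp => ?_
  by_contra h
  refine hp (operateOn_eq_zero T c hd t p fun h' => h ⟨h'.1, ?_, h'.2.2⟩)
  change p.2.1 ≤ t.1 + k
  omega

/-- For the diagram with the operator legs `f`, only the power `n` contributes, and `1 / n!` is its
coefficient in the exponential. -/
theorem setZero_single (T : Theory) (c : ℚ) (N : Multiset Node) {n : ℕ} (f : Fin n → Par × ℕ) :
    setZero (vdash (fun t => cls T t (δ ⟨N, [], List.ofFn f⟩)) (expHash (exponent T c)))
      = (1 / (n.factorial : ℚ)) • ∑ σ : Equiv.Perm (Fin n),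
        koszulSign (fun i => (f i).1.grade) σ
          • cls T (0, 0) (pre ⟨N.map (Node.relabel evenName), [], []⟩
            (opLegs c (evenOps (List.ofFn fun i => f (σ i)))
              ((powNames n).map (mapEdges oddName)))) := by
  set k := ((List.ofFn f).map fun d => d.1.grade).sum with hk
  have hd : (⟨N, [], List.ofFn f⟩ : Raw).type = (0, k) := by simp [Raw.type, hk]
  -- Each operator leg has positive grade, so the power `n` occurs in type `(k, 0)`.
  have hnk : n ≤ k := by
    have : ∀ u : List (Par × ℕ), u.length ≤ (u.map fun d => d.1.grade).sum := by
      intro u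
      induction u with
      | nil => simp
      | cons d u ih =>
        have : 1 ≤ d.1.grade := by cases d.1 <;> simp [Par.grade]
        simp only [List.length_cons, List.map_cons, List.sum_cons]
        omega
    simpa [hk] using this (List.ofFn f)
  rw [setZero, vdash, finsum_eq_single _ (((0, k), (k, 0)) : (ℕ × ℕ) × (ℕ × ℕ))]
  · simp only [operateOn, expHash_eq_sum, map_sum, map_smul, hashPow_exponent]
    have hpow : ∀ j, operateBilin T 1 (0, k) (k, 0) (0, 0)
        (cls T (0, k) (δ ⟨N, [], List.ofFn f⟩)) (cls T (k, 0) (shuffle c [] (powNames j))) = _ :=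
      fun j => (operateBilin_cls T k hd (Finsupp.supported_mono (fun r hr => hr.1)
        (shuffle_nil_supported c (powNames j)))).trans
        (cls_operate_power T c N f (powNames j) (nodup_powNames j))
    simp only [hpow, length_powNames]
    rw [Finset.sum_eq_single n]
    · rw [if_pos rfl]
    · intro j _ hj
      rw [if_neg hj.symm, smul_zero]
    · intro h
      exact absurd (Finset.mem_range.mpr (Nat.lt_succ_of_le hnk)) h
  · intro p hp
    refine operateOn_eq_zero T c hd (0, 0) p fun h => hp ?_
    obtain ⟨⟨i, j⟩, ⟨i', j'⟩⟩ := p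
    simp only [zero_add, add_zero, Prod.mk.injEq] at h ⊢
    exact ⟨h.1, h.2⟩

/-- A symmetric Weil diagram is determined by its internal vertices and its operator legs. -/
theorem exists_eq_toLegs {r : Raw} (hr : r ∈ diagrams (0, 0)) :
    ∃ (n : ℕ) (f : Fin n → Par × ℕ), r = ⟨r.nodes, toLegs (List.ofFn f), []⟩ := by
  obtain ⟨N, w, q⟩ := r
  have h1 := congrArg Prod.fst hr.2
  have h2 := congrArg Prod.snd hr.2
  simp only [Raw.type] at h1 h2
  have hq : q = [] := by
    cases q with
    | nil => rfl
    | cons d q =>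
      simp only [List.map_cons, List.sum_cons] at h2
      cases hd : d.1 <;> simp [hd, Par.grade] at h2
  have hw : ∃ u, w = toLegs u := by
    clear hr
    induction w with
    | nil => exact ⟨[], rfl⟩
    | cons l w ih =>
      simp only [List.map_cons, List.sum_cons, Nat.add_eq_zero_iff] at h1
      obtain ⟨u, rfl⟩ := ih h1.2
      obtain ⟨k, x⟩ := l
      rcases k with - | - | p
      · exact ⟨(.a, x) :: u, rfl⟩
      · exact ⟨(.b, x) :: u, rfl⟩
      · cases p <;> simp [Kind.parGrade, Par.grade] at h1
  obtain ⟨u, rfl⟩ := hw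
  exact ⟨u.length, u.get, by rw [List.ofFn_get, hq]⟩

theorem toOperator_toLegs (N : Multiset Node) (u : List (Par × ℕ)) :
    toOperator ⟨N, toLegs u, []⟩ = ⟨N, [], u⟩ := by
  have : ∀ p : Par, p.toKind.toPar = p := by intro p; cases p <;> rfl
  simp [toOperator, toLegs, Function.comp_def, this]

theorem vdash_add {T : Theory} {v v' w : Series T} (h : Converges v w) (h' : Converges v' w) :
    Converges (v + v') w ∧ vdash (v + v') w = vdash v w + vdash v' w := by
  have e : ∀ (t : ℕ × ℕ) (p : (ℕ × ℕ) × (ℕ × ℕ)), operateOn T p.1 p.2 t ((v + v') p.1) (w p.2)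
      = operateOn T p.1 p.2 t (v p.1) (w p.2) + operateOn T p.1 p.2 t (v' p.1) (w p.2) := by
    intro t p
    simp [operateOn]
  refine ⟨fun t => ((h t).union (h' t)).subset fun p hp => ?_, funext fun t => ?_⟩
  · by_contra hn
    simp only [Set.mem_union, Set.mem_ofPred_eq, not_or, not_not] at hn
    exact hp (by rw [e, hn.1, hn.2, add_zero])
  · simp only [vdash, e]
    exact finsum_add_distrib (h t) (h' t)

theorem vdash_smul {T : Theory} (a : ℚ) {v w : Series T} (h : Converges v w) :
    Converges (a • v) w ∧ vdash (a • v) w = a • vdash v w := by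
  have e : ∀ (t : ℕ × ℕ) (p : (ℕ × ℕ) × (ℕ × ℕ)), operateOn T p.1 p.2 t ((a • v) p.1) (w p.2)
      = a • operateOn T p.1 p.2 t (v p.1) (w p.2) := by
    intro t p
    simp [operateOn]
  refine ⟨fun t => (h t).subset fun p hp => ?_, funext fun t => ?_⟩
  · by_contra hn
    simp only [Set.mem_ofPred_eq, not_not] at hn
    exact hp (by rw [e, hn, smul_zero])
  · simp only [vdash, e]
    exact (smul_finsum' a (h t)).symm

/-- To identify `Op(v) ⊢ exp_#(P)` with a linear map `Φ`, it suffices to evaluate `Φ` on single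
diagrams. -/
theorem vdash_exponent (T : Theory) (c : ℚ) (Φ : W →ₗ[ℚ] Space T (0, 0))
    (hΦ : ∀ (N : Multiset Node) (n : ℕ) (f : Fin n → Par × ℕ),
      (⟨N, toLegs (List.ofFn f), []⟩ : Raw) ∈ diagrams (0, 0) →
      Φ (cls .sym (0, 0) (δ ⟨N, toLegs (List.ofFn f), []⟩))
        = (1 / (n.factorial : ℚ)) • ∑ σ : Equiv.Perm (Fin n),
          koszulSign (fun i => (f i).1.grade) σ
            • cls T (0, 0) (pre ⟨N.map (Node.relabel evenName), [], []⟩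
              (opLegs c (evenOps (List.ofFn fun i => f (σ i)))
                ((powNames n).map (mapEdges oddName))))) (v : W) :
    Converges (intoOp T v) (expHash (exponent T c))
      ∧ Φ v = setZero (vdash (intoOp T v) (expHash (exponent T c))) := by
  obtain ⟨v, rfl⟩ := Submodule.mkQ_surjective _ v
  induction v using Finsupp.induction_linear with
  | zero =>
    have e : ∀ (t₁ t₂ t : ℕ × ℕ) (w : Space T t₂), operateOn T t₁ t₂ t 0 w = 0 := by
      intro t₁ t₂ t w
      simp [operateOn]
    rw [map_zero]
    refine ⟨fun t => by simp [e], ?_⟩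
    rw [map_zero, setZero, vdash]
    simp [e]
  | add v v' h h' =>
    obtain ⟨h1, h2⟩ := vdash_add h.1 h'.1
    rw [map_add, map_add (intoOp T)]
    refine ⟨h1, ?_⟩
    rw [h2, map_add, h.2, h'.2]
    rfl
  | single r a =>
    obtain ⟨r, hr⟩ := r
    obtain ⟨n, f, hf⟩ := exists_eq_toLegs hr
    obtain ⟨N, w, q⟩ := r
    obtain ⟨-, rfl, rfl⟩ := (Raw.mk.injEq ..).mp hf
    have e : (relations .sym (0, 0)).mkQ (Finsupp.single ⟨_, hr⟩ a)
        = a • cls .sym (0, 0) (δ ⟨N, toLegs (List.ofFn f), []⟩) := by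
      rw [cls_single_mem hr, ← mul_one a, ← smul_eq_mul, ← Finsupp.smul_single, map_smul]
      simp
    have e' : intoOp T (cls .sym (0, 0) (δ ⟨N, toLegs (List.ofFn f), []⟩))
        = fun t => cls T t (δ ⟨N, [], List.ofFn f⟩) := by
      funext t
      rw [intoOp_cls T t hr, toOperator_toLegs]
    obtain ⟨h1, h2⟩ := vdash_smul a (converges_single T c (d := ⟨N, [], List.ofFn f⟩)
      (k := ((List.ofFn f).map fun d => d.1.grade).sum) (by simp [Raw.type]))
    rw [e, map_smul, map_smul, e', h2]
    refine ⟨h1, ?_⟩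
    rw [hΦ N n f hr, ← setZero_single T c N f]
    rfl

theorem toLegs_ofFn {n : ℕ} (f : Fin n → Par × ℕ) :
    toLegs (List.ofFn f) = List.ofFn fun i => ((f i).1.toKind, (f i).2) := by
  rw [toLegs, List.map_ofFn]
  rfl

theorem averageWord_supported {N : Multiset Node} {n : ℕ} {f : Fin n → Par × ℕ}
    (h : (⟨N, toLegs (List.ofFn f), []⟩ : Raw) ∈ diagrams (0, 0)) :
    averageWord N [] (fun i => ((f i).1.toKind, (f i).2))
      ∈ Finsupp.supported ℚ ℚ (diagrams (0, 0)) := by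
  refine Submodule.smul_mem _ _ (sum_mem fun σ _ => Submodule.smul_mem _ _
    (Finsupp.single_mem_supported _ _ ?_))
  have hp : (List.ofFn fun i => ((f (σ i)).1.toKind, (f (σ i)).2)).Perm (toLegs (List.ofFn f)) := by
    rw [toLegs_ofFn]
    exact Equiv.Perm.ofFn_comp_perm σ fun i => ((f i).1.toKind, (f i).2)
  refine (Raw.mem_diagrams_of_labels_eq ?_ ?_ (0, 0)).mpr h
  · simp only [Raw.labels]
    rw [Multiset.coe_eq_coe.mpr (hp.map Prod.snd)]
  · simp only [Raw.type]
    rw [(hp.map fun l => l.1.parGrade).sum_eq]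

theorem quotientMap_averageMap (N : Multiset Node) {n : ℕ} (f : Fin n → Par × ℕ)
    (h : (⟨N, toLegs (List.ofFn f), []⟩ : Raw) ∈ diagrams (0, 0)) :
    quotientMap (averageMap (cls .sym (0, 0) (δ ⟨N, toLegs (List.ofFn f), []⟩)))
      = cls .hat (0, 0) (averageWord N [] fun i => ((f i).1.toKind, (f i).2)) := by
  rw [averageMap, lift_cls' _ _ _ (Finsupp.single_mem_supported _ _ h), LinearMap.comp_apply,
    averageLin, Finsupp.linearCombination_single, one_smul,
    average_ofFn N [] (fun i => ((f i).1.toKind, (f i).2)) _ (toLegs_ofFn f).symm,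
    quotientMap, lift_cls' _ _ _ (averageWord_supported h)]

end Weil

end

theorem mainTheorem8 (v : Weil.W) :
    (Weil.ExpConverges Weil.generator ∧
      Weil.Converges (Weil.intoOp .hat v) (Weil.expHash Weil.generator) ∧
      Weil.quotientMap (Weil.averageMap v)
        = Weil.setZero (Weil.vdash (Weil.intoOp .hat v) (Weil.expHash Weil.generator))) ∧
    (Weil.ExpConverges Weil.generatorF ∧
      Weil.Converges (Weil.intoOp .hatF v) (Weil.expHash Weil.generatorF) ∧
      Weil.curvatureMap (Weil.quotientMap (Weil.averageMap v))
        = Weil.setZero (Weil.vdash (Weil.intoOp .hatF v) (Weil.expHash Weil.generatorF))) := by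
  rw [Weil.generator_eq, Weil.generatorF_eq]
  refine ⟨⟨Weil.expConverges_exponent _ _, Weil.vdash_exponent .hat 0
    (Weil.quotientMap ∘ₗ Weil.averageMap) (fun N n f h => ?_) v⟩,
    ⟨Weil.expConverges_exponent _ _, Weil.vdash_exponent .hatF (1 / 2)
    (Weil.curvatureMap ∘ₗ Weil.quotientMap ∘ₗ Weil.averageMap) (fun N n f h => ?_) v⟩⟩
  -- For `c = 0` the terms are those of the average, with even names for the edges.
  · rw [LinearMap.comp_apply, Weil.quotientMap_averageMap N f h, Weil.averageWord]
    simp only [map_smul, map_sum, Weil.toKind_grade, ← Weil.toLegs_ofFn]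
    refine congrArg _ (Finset.sum_congr rfl fun σ _ => congrArg _ ?_)
    rw [Weil.opLegs_zero _ _ (by simp [Weil.evenOps, Weil.length_powNames]), Weil.pre_single,
      ← Weil.cls_ren (0, 0) Weil.evenName_injective, Weil.ren_single]
    simp [Weil.Raw.relabel, Weil.Raw.prepend, Weil.toLegs, Weil.evenOps, Function.comp_def]
  -- For `c = 1/2` the change of basis map is applied to each term of the average.
  · rw [LinearMap.comp_apply, LinearMap.comp_apply, Weil.quotientMap_averageMap N f h,
      Weil.curvatureMap, Weil.lift_cls' _ _ _ (Weil.averageWord_supported h), Weil.averageWord]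
    simp only [map_smul, map_sum, Weil.toKind_grade, ← Weil.toLegs_ofFn]
    refine congrArg _ (Finset.sum_congr rfl fun σ _ => congrArg _ ?_)
    rw [Weil.mapEdges, Weil.cls_opLegs_half _ _ _ (by simp [Weil.length_powNames])
      (Weil.nodup_powNames n), LinearMap.comp_apply, Weil.toCurvatureLin,
      Finsupp.linearCombination_single, one_smul]
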